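/- **Setting.** Let $V$ be a complete, cocomplete, closed symmetric monoidal category with unit $I$. Let $\mathtt O$ be a (strict, Batanin–Markl) operadic category: a category with a cardinality functor $|\cdot|$ to the skeletal category of finite sets, a chosen terminal object $U_c$ in each connected component $c\in\pi_0(\mathtt O)$, with $|U_c|=\bar 1$, and, for $R\in\mathtt O$ and $i\in|R|$, a functor $\mathtt O/R\to\mathtt O$, $(f\colon T\to R)\mapsto f^{-1}(i)$, with $|f^{-1}(i)|=|f|^{-1}(i)$ and with $|f_i|$ induced by $|f|$, where $f_i\colon (gf)^{-1}(i)\to g^{-1}(i)$ denotes the value of the functor on $f\colon T\to S$ over $g\colon S\to R$. One requires that all fibres of identities are chosen terminal objects, that for $R=U_c$ the functor is the domain functor, that $f_{|g|(j)}^{-1}(j)=f^{-1}(j)$ for $j\in|S|$, and that $(f_i)_j=f_j$. For $T\in\mathtt O$ let $c_1,\dots,c_k$ ($k=|T|$) be the components of the fibres of $\mathrm{id}_T$. An $\mathtt O$-operad in $V$ is a collection $\mathcal P(T)\in V$, $T\in\mathtt O$, with units $I\to\mathcal P(U_c)$ and multiplications $\bigotimes_{i\in|S|}\mathcal P(f^{-1}(i))\otimes\mathcal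 P(S)\to\mathcal P(T)$ for $f\colon T\to S$, which are associative and unital. For a set $\mathfrak C$ of colours, $\mathtt O^{\mathfrak C}$ is the operadic category of objects $T(i_1,\dots,i_k;i)$, where $T\in\mathtt O$, $k=|T|$ and $i_1,\dots,i_k,i\in\mathfrak C$; its morphisms are the morphisms of $\mathtt O$ between objects with the same root colour $i$. The fibre over $j\in|S|$ has as root colour the colour of $j$ and inherits the other colours from $T$; the chosen terminal objects are the $U_c(i;i)$, so $\pi_0(\mathtt O^{\mathfrak C})=\pi_0(\mathtt O)\times\mathfrak C$. Let $\mathcal P$ be an $\mathtt O^{\mathfrak C}$-operad in $V$. Its underlying $V$-category $\mathtt U(\mathcal P)$ has objects $(c,i)\in\pi_0(\mathtt O)\times\mathfrak C$ and hom-objects $\mathcal P(U_c(i;j))$ from $(c,i)$ to $(c,j)$, and the initial object between different components. Let $\delta\colon\mathtt U(\mathcal P)\to V$ be a $V$-functor. For $T\in\mathtt O$ with $c=\pi_0(T)$ put $$E_T(\delta)(i)=\int^{a_1,\dots,a_k}\mathcal P(T(a_1,\dots,a_k;i))\otimes\delta(c_1,a_1)\otimes\cdots\otimes\delta(c_k,a_k),\qquad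 \mathrm{Coend}^{\mathcal P}_\delta(T)=\int_{i}V\big(\delta(c,i),E_T(\delta)(i)\big),$$ the coend and the end being taken over the components $c_1,\dots,c_k$ and $c$ of $\mathtt U(\mathcal P)$. Let $\mathtt C$ be a complete $V$-category that is colax $\mathtt O$-monoidal. Thus $\mathtt C$ carries an $\mathtt O$-multicotensor $D$: $V$-functors $D_T\colon\mathtt C^{\otimes|T|}\to\mathtt C$ with coassociative and counital $V$-natural maps $D_T\to D_S(D_{T_1},\dots,D_{T_k})$ for $f\colon T\to S$ with fibres $T_1,\dots,T_k$, and $D_{U_c}\to\mathrm{id}$, the latter being invertible (so the comonads $D_{U_c}$ are trivial). An algebra over an $\mathtt O$-operad $\mathcal Q$ in $\mathtt C$ is a family $X=(X(c))_{c\in\pi_0(\mathtt O)}$ of objects with a map of operads from $\mathcal Q$ to the endomorphism operad $\mathrm{End}^D_X(T)=\mathtt C\big(D_T(X(c_1),\dots,X(c_k)),X(\pi_0(T))\big)$; for $\mathtt O^{\mathfrak C}$-operads one uses the multicotensor $D_{T(i_1,\dots,i_k;i)}=D_T$. A $\mathcal P$-algebra $A$ in $\mathtt C$ restricts to a $V$-functor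 $\iota^*A\colon\mathtt U(\mathcal P)\to\mathtt C$, and one puts $$\mathrm{Tot}_\delta(A)_c=\int_{i}A(c,i)^{\delta(c,i)},\qquad c\in\pi_0(\mathtt O),$$ the end of cotensors being taken over the component $c$ of $\mathtt U(\mathcal P)$. **Proposition.** The collection $\mathrm{Coend}^{\mathcal P}_\delta$ exists and is an $\mathtt O$-operad in $V$, with the coendomorphism structure given by composition and by the maps $E_S(E_{T_1}(\delta),\dots,E_{T_k}(\delta))\to E_T(\delta)$ induced by the multiplication of $\mathcal P$. For every $\mathcal P$-algebra $A$ in $\mathtt C$, the $\pi_0(\mathtt O)$-collection $\mathrm{Tot}_\delta(A)$ exists, and it is an algebra over the $\mathtt O$-operad $\mathrm{Coend}^{\mathcal P}_\delta$ in a canonical way: there is exactly one algebra structure for which, for all $T$ and $i$, with $c=\pi_0(T)$, the composite $$\mathrm{Coend}^{\mathcal P}_\delta(T)\otimes\delta(c,i)\to\mathtt C\big(D_T(\mathrm{Tot}_\delta(A)_{c_1},\dots,\mathrm{Tot}_\delta(A)_{c_k}),A(c,i)\big)$$ of the action with the projection of $\mathrm{Tot}_\delta(A)_c$ to $A(c,i)^{\delta(c,i)}$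 is the composite of the evaluation $\mathrm{Coend}^{\mathcal P}_\delta(T)\otimes\delta(c,i)\to E_T(\delta)(i)$ with the map out of $E_T(\delta)(i)$ given on the terms of the coend by the evaluations $\delta(c_j,a_j)\to\mathtt C(\mathrm{Tot}_\delta(A)_{c_j},A(c_j,a_j))$ and the action of $\mathcal P(T(a_1,\dots,a_k;i))$ on $A$. This structure is natural in $A$: for each morphism $A\to B$ of $\mathcal P$-algebras, there is exactly one family of maps $\mathrm{Tot}_\delta(A)_c\to\mathrm{Tot}_\delta(B)_c$ that is compatible with the projections, and it is a morphism of $\mathrm{Coend}^{\mathcal P}_\delta$-algebras. -/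

import Mathlib

open CategoryTheory MonoidalCategory Limits MonoidalClosed

universe w v u vo uo vk uk

namespace OpCond

noncomputable section

/-! ### Finite tensor products in a (symmetric) monoidal category -/

section Tensor

variable {V : Type u} [Category.{v} V] [MonoidalCategory V]

/-- `X₀ ⊗ (X₁ ⊗ (⋯ ⊗ 𝟙))`. -/
def tens : {n : ℕ} → (Fin n → V) → V
  | 0, _ => 𝟙_ V
  | _ + 1, X => X 0 ⊗ tens fun i => X i.succ

/-- Functoriality of the finite tensor product. -/
def tensMap : {n : ℕ} → {X Y : Fin n → V} → (∀ i, X i ⟶ Y i) → (tens X ⟶ tens Y)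
  | 0, _, _, _ => 𝟙 _
  | _ + 1, _, _, f => f 0 ⊗ₘ tensMap fun i => f i.succ

/-- The canonical map `𝟙 ⟶ 𝟙 ⊗ ⋯ ⊗ 𝟙`. -/
def tensUnit : (n : ℕ) → (𝟙_ V ⟶ tens fun _ : Fin n => 𝟙_ V)
  | 0 => 𝟙 _
  | n + 1 => (λ_ (𝟙_ V)).inv ≫ 𝟙_ V ◁ tensUnit n

/-- The canonical map `𝟙 ⊗ ⋯ ⊗ 𝟙 ⟶ 𝟙`, inverse to `tensUnit`. -/
def tensCounit : (n : ℕ) → ((tens fun _ : Fin n => 𝟙_ V) ⟶ 𝟙_ V)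
  | 0 => 𝟙 _
  | n + 1 => 𝟙_ V ◁ tensCounit n ≫ (λ_ (𝟙_ V)).hom

/-- A map into the only factor of a tensor product of length one. -/
def tensOne {A : V} : {n : ℕ} → n = 1 → (X : Fin n → V) → (∀ i, A ⟶ X i) → (A ⟶ tens X)
  | _, rfl, _, a => (ρ_ A).inv ≫ a 0 ▷ 𝟙_ V

/-- `A ≅ 𝟙 ⊗ ⋯ ⊗ A ⊗ ⋯ ⊗ 𝟙 ⟶ ⨂ Y` with `A` in position `p`. -/
def spread {A : V} : {n : ℕ} → (p : Fin n) → (Y : Fin n → V) → (A ⟶ Y p) →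
    (∀ i, i ≠ p → (𝟙_ V ⟶ Y i)) → (A ⟶ tens Y)
  | n + 1, p, Y, a, b =>
    Fin.cases (motive := fun p => (A ⟶ Y p) → (∀ i, i ≠ p → (𝟙_ V ⟶ Y i)) → (A ⟶ tens Y))
      (fun a b => (ρ_ A).inv ≫
        (a ⊗ₘ (tensUnit n ≫ tensMap fun i => b i.succ (Fin.succ_ne_zero i))))
      (fun q a b => (λ_ A).inv ≫
        (b 0 (Fin.succ_ne_zero q).symm ⊗ₘ
          spread q (fun i => Y i.succ) a
            fun i hi => b i.succ fun h => hi (Fin.succ_injective _ h)))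
      p a b

/-- `⨂ Y ⟶ 𝟙 ⊗ ⋯ ⊗ A ⊗ ⋯ ⊗ 𝟙 ≅ A` with `A` in position `p`. -/
def collapse {A : V} : {n : ℕ} → (p : Fin n) → (Y : Fin n → V) → (Y p ⟶ A) →
    (∀ i, i ≠ p → (Y i ⟶ 𝟙_ V)) → (tens Y ⟶ A)
  | n + 1, p, Y, a, b =>
    Fin.cases (motive := fun p => (Y p ⟶ A) → (∀ i, i ≠ p → (Y i ⟶ 𝟙_ V)) → (tens Y ⟶ A))
      (fun a b =>
        (a ⊗ₘ ((tensMap fun i => b i.succ (Fin.succ_ne_zero i)) ≫ tensCounit n)) ≫ (ρ_ A).hom)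
      (fun q a b =>
        (b 0 (Fin.succ_ne_zero q).symm ⊗ₘ
          collapse q (fun i => Y i.succ) a
            fun i hi => b i.succ fun h => hi (Fin.succ_injective _ h)) ≫ (λ_ A).hom)
      p a b

variable [BraidedCategory V]

/-- The canonical map `(⨂ X) ⊗ (⨂ Y) ⟶ ⨂ (X ⊗ Y)`. -/
def tensZip : {n : ℕ} → (X Y : Fin n → V) → (tens X ⊗ tens Y ⟶ tens fun i => X i ⊗ Y i)
  | 0, _, _ => (λ_ (𝟙_ V)).hom
  | _ + 1, X, Y =>
    tensorμ (X 0) (tens fun i => X i.succ) (Y 0) (tens fun i => Y i.succ) ≫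
      (X 0 ⊗ Y 0) ◁ tensZip (fun i => X i.succ) (fun i => Y i.succ)

/-- The canonical map `⨂ⱼ ⨂ᵢ Y j i ⟶ ⨂ᵢ ⨂ⱼ Y j i`. -/
def tensSwap {n : ℕ} : {m : ℕ} → (Y : Fin m → Fin n → V) →
    ((tens fun j => tens fun i => Y j i) ⟶ tens fun i => tens fun j => Y j i)
  | 0, _ => tensUnit n
  | _ + 1, Y =>
    (tens fun i => Y 0 i) ◁ tensSwap (fun j => Y j.succ) ≫
      tensZip (fun i => Y 0 i) (fun i => tens fun j => Y j.succ i)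

/-- The canonical map `⨂ⱼ X j ⟶ ⨂ᵢ ⨂ₖ X (e (i, k))` for a partition `e` of the index set:
insert units, interchange the products, and remove the units again. -/
def tensRegroup {m n : ℕ} {c : Fin n → ℕ} (e : (Σ i : Fin n, Fin (c i)) ≃ Fin m)
    (X : Fin m → V) : tens X ⟶ tens fun i => tens fun k => X (e ⟨i, k⟩) :=
  let Z : Fin m → (i : Fin n) → Fin (c i) → V := fun j i k => if e ⟨i, k⟩ = j then X j else 𝟙_ V
  (tensMap fun j =>
    spread (e.symm j).1 (fun i => tens fun k => Z j i k)
      (spread (e.symm j).2 (fun k => Z j (e.symm j).1 k)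
        (eqToHom (if_pos (e.apply_symm_apply j)).symm)
        fun k hk => eqToHom (if_neg fun h => hk (by
          have h' : (⟨(e.symm j).1, k⟩ : Σ i : Fin n, Fin (c i)) = e.symm j :=
            (Equiv.eq_symm_apply e).2 h
          exact eq_of_heq (Sigma.mk.inj h').2)).symm)
      fun i hi => tensUnit _ ≫ tensMap fun k => eqToHom (if_neg fun h => hi (by
          rw [← h, e.symm_apply_apply])).symm) ≫
  tensSwap (fun j i => tens fun k => Z j i k) ≫
  tensMap fun i => tensSwap (fun j k => Z j i k) ≫
    tensMap fun k =>
      collapse (e ⟨i, k⟩) (fun j => Z j i k) (eqToHom (if_pos rfl))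
        fun j hj => eqToHom (if_neg hj.symm)

end Tensor

/-! ### Operadic categories -/

/-- The data of a strict operadic category: the cardinality functor to the category of the sets
`Fin n`, the set of connected components, the chosen local terminal objects, and the fibre
functors. -/
class OperadicData (O : Type uo) [Category.{vo} O] where
  card : O → ℕ
  cardMap {T S : O} (f : T ⟶ S) : Fin (card T) → Fin (card S)
  cardMap_id (T : O) : cardMap (𝟙 T) = id
  cardMap_comp {T S R : O} (f : T ⟶ S) (g : S ⟶ R) : cardMap (f ≫ g) = cardMap g ∘ cardMap f
  /-- the set of connected components: `π₀` is invariant under morphisms, and every `T` maps to the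
  object `U (π₀ T)`, so `π₀ T = π₀ S` if and only if `T` and `S` are connected -/
  Comp : Type w
  π₀ : O → Comp
  π₀_eq {T S : O} (f : T ⟶ S) : π₀ T = π₀ S
  /-- the chosen terminal object of a component -/
  U : Comp → O
  π₀_U (c : Comp) : π₀ (U c) = c
  toU (T : O) : T ⟶ U (π₀ T)
  toU_unique {T : O} {c : Comp} (f g : T ⟶ U c) : f = g
  /-- the functor sending `f : T ⟶ R` to its `i`-th fibre -/
  Fib {R : O} (i : Fin (card R)) : Over R ⥤ O
  card_Fib {R : O} (i : Fin (card R)) (f : Over R) :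
    card ((Fib i).obj f) = (Finset.univ.filter fun j => cardMap f.hom j = i).card

open OperadicData

section Fibres

variable {O : Type uo} [Category.{vo} O] [OperadicData.{w} O]

/-- The fibre `f⁻¹(i)`. -/
def fib {T S : O} (f : T ⟶ S) (i : Fin (card S)) : O := (Fib i).obj (Over.mk f)

theorem card_fib {T S : O} (f : T ⟶ S) (i : Fin (card S)) :
    (Finset.univ.filter fun j => cardMap f j = i).card = card (fib f i) :=
  (card_Fib i (Over.mk f)).symm

/-- The order-preserving identification of `|f⁻¹(i)|` with the preimage `|f|⁻¹(i) ⊆ |T|`. -/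
def emb {T S : O} (f : T ⟶ S) (i : Fin (card S)) : Fin (card (fib f i)) ↪o Fin (card T) :=
  (Finset.univ.filter fun j => cardMap f j = i).orderEmbOfFin (card_fib f i)

/-- The map `fᵢ : (gf)⁻¹(i) ⟶ g⁻¹(i)` of fibres. -/
def fibMap {T S R : O} (f : T ⟶ S) (g : S ⟶ R) (i : Fin (card R)) : fib (f ≫ g) i ⟶ fib g i :=
  (Fib i).map (Over.homMk f : Over.mk (f ≫ g) ⟶ Over.mk g)

end Fibres

/-- Strict operadic categories. -/
class OperadicCategory (O : Type uo) [Category.{vo} O] extends OperadicData.{w} O where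
  card_U (c : Comp) : card (U c) = 1
  /-- identities are trivial -/
  fib_id_eq (T : O) (i : Fin (card T)) : ∃ c, fib (𝟙 T) i = U c
  /-- `|fᵢ|` is induced by `|f|` -/
  emb_cardMap_fibMap {T S R : O} (f : T ⟶ S) (g : S ⟶ R) (i : Fin (card R))
    (k : Fin (card (fib (f ≫ g) i))) :
    emb g i (cardMap (fibMap f g i) k) = cardMap f (emb (f ≫ g) i k)
  /-- over a chosen terminal object, the fibre functor is the domain functor -/
  Fib_U (c : Comp) (i : Fin (card (U c))) : Fib i = Over.forget (U c)
  /-- the fibres of `fᵢ` are fibres of `f` -/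
  fib_fibMap {T S R : O} (f : T ⟶ S) (g : S ⟶ R) (i : Fin (card R)) (k : Fin (card (fib g i))) :
    fib (fibMap f g i) k = fib f (emb g i k)
  /-- the maps between them agree, `(fᵢ)ⱼ = fⱼ` -/
  fibMap_fibMap {T S Q R : O} (f : T ⟶ S) (a : S ⟶ Q) (c : Q ⟶ R) (i : Fin (card R))
    (k : Fin (card (fib c i))) :
    HEq (fibMap (fibMap f (a ≫ c) i) (fibMap a c i) k) (fibMap f a (emb c i k))

open OperadicCategory

section FibreLemmas

variable {O : Type uo} [Category.{vo} O]

section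
variable [OperadicData.{w} O]

theorem range_emb {T S : O} (f : T ⟶ S) (i : Fin (card S)) :
    Set.range (emb f i) = {j | cardMap f j = i} := by
  unfold emb
  rw [Finset.range_orderEmbOfFin]
  ext; simp

theorem cardMap_emb {T S : O} (f : T ⟶ S) (i : Fin (card S)) (k : Fin (card (fib f i))) :
    cardMap f (emb f i k) = i := by
  have : emb f i k ∈ Set.range (emb f i) := ⟨k, rfl⟩
  rw [range_emb] at this
  exact this

/-- The fibres partition `|T|`. -/
def embEquiv {T S : O} (f : T ⟶ S) : (Σ i : Fin (card S), Fin (card (fib f i))) ≃ Fin (card T) :=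
  Equiv.ofBijective (fun p => emb f p.1 p.2) (by
    constructor
    · rintro ⟨i, k⟩ ⟨i', k'⟩ h
      dsimp only at h
      have hi : i = i' := by rw [← cardMap_emb f i k, h, cardMap_emb]
      subst hi
      rw [(emb f i).injective h]
    · intro j
      have : j ∈ Set.range (emb f (cardMap f j)) := by rw [range_emb]; rfl
      obtain ⟨k, hk⟩ := this
      exact ⟨⟨_, k⟩, hk⟩)

theorem heq_fibMap_comp {T S Q R : O} (f : T ⟶ S) (a : S ⟶ Q) (c : Q ⟶ R) (i : Fin (card R)) :
    HEq (fibMap f (a ≫ c) i ≫ fibMap a c i) (fibMap (f ≫ a) c i) := by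
  have key : ∀ (h : T ⟶ R) (_ : h = (f ≫ a) ≫ c) (u : Over.mk h ⟶ Over.mk c)
      (_ : u.left = f ≫ a), HEq ((Fib i).map u) (fibMap (f ≫ a) c i) := by
    rintro h rfl u hu
    have : u = Over.homMk (f ≫ a) := Over.OverMorphism.ext hu
    rw [this]
    rfl
  have h2 := key (f ≫ a ≫ c) (Category.assoc _ _ _).symm
    ((Over.homMk f : Over.mk (f ≫ a ≫ c) ⟶ Over.mk (a ≫ c)) ≫
      (Over.homMk a : Over.mk (a ≫ c) ⟶ Over.mk c)) rfl
  rwa [Functor.map_comp] at h2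

/-- Order embeddings out of two equal objects with the same range agree. -/
theorem heq_comp_of_range {A B : O} (h : A = B) {n : ℕ} {α : Type*} (X : Fin n → α)
    (p : Fin (card A) ↪o Fin n) (q : Fin (card B) ↪o Fin n) (hr : Set.range p = Set.range q) :
    HEq (X ∘ p) (X ∘ q) := by
  subst h
  have : p = q := by
    have := (OrderEmbedding.range_inj (f := p) (g := q)).1 hr
    exact this
  rw [this]

theorem emb_id {T : O} (i : Fin (card T)) (k : Fin (card (fib (𝟙 T) i))) : emb (𝟙 T) i k = i := by
  have := cardMap_emb (𝟙 T) i k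
  rwa [cardMap_id] at this

end

variable [OperadicCategory.{w} O]

/-- The component of the `i`-th fibre of the identity of `T`: the `i`-th source colour of `T`. -/
def src (T : O) (i : Fin (card T)) : Comp O := π₀ (fib (𝟙 T) i)

theorem fib_id (T : O) (i : Fin (card T)) : fib (𝟙 T) i = U (src T i) := by
  obtain ⟨c, hc⟩ := fib_id_eq T i
  unfold src
  rw [hc, π₀_U]

theorem fib_U {T : O} {c : Comp O} (f : T ⟶ U c) (i : Fin (card (U c))) : fib f i = T := by
  unfold fib
  rw [Fib_U]
  rfl

theorem src_U (c : Comp O) (i : Fin (card (U c))) : src (U c) i = c := by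
  unfold src
  rw [fib_U, π₀_U]

theorem π₀_fib {T S : O} (f : T ⟶ S) (i : Fin (card S)) : π₀ (fib f i) = src S i := by
  have h : fib f i = fib (f ≫ 𝟙 S) i := by rw [Category.comp_id]
  rw [h]
  exact π₀_eq (fibMap f (𝟙 S) i)

theorem heq_comp_emb_id {T : O} (i : Fin (card T)) {α : Type*} (X : Fin (card T) → α) :
    HEq (X ∘ emb (𝟙 T) i) (fun _ : Fin (card (U (src T i))) => X i) := by
  have h : X ∘ emb (𝟙 T) i = fun _ => X i := funext fun k => congrArg X (emb_id i k)
  rw [h, ← fib_id]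

theorem src_fib {T S : O} (f : T ⟶ S) (i : Fin (card S)) (k : Fin (card (fib f i))) :
    src (fib f i) k = src T (emb f i k) := by
  exact (π₀_fib (fibMap (𝟙 T) f i) k).symm.trans (congrArg π₀ (fib_fibMap (𝟙 T) f i k))

/-- The positions of the fibres of `fᵢ` in `|T|` are those of the fibres of `f`. -/
theorem range_emb_fibMap {T S R : O} (f : T ⟶ S) (g : S ⟶ R) (i : Fin (card R))
    (k : Fin (card (fib g i))) :
    Set.range ((emb (fibMap f g i) k).trans (emb (f ≫ g) i)) =
      Set.range (emb f (emb g i k)) := by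
  ext j
  rw [range_emb]
  constructor
  · rintro ⟨l, rfl⟩
    have h := emb_cardMap_fibMap f g i (emb (fibMap f g i) k l)
    rw [cardMap_emb] at h
    exact h.symm
  · intro hj
    have hj' : j ∈ Set.range (emb (f ≫ g) i) := by
      rw [range_emb]
      change cardMap (f ≫ g) j = i
      rw [cardMap_comp, Function.comp_apply, show cardMap f j = _ from hj, cardMap_emb]
    obtain ⟨l, rfl⟩ := hj'
    have hl : l ∈ Set.range (emb (fibMap f g i) k) := by
      rw [range_emb]
      apply (emb g i).injective
      rw [emb_cardMap_fibMap]
      exact hj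
    obtain ⟨l', rfl⟩ := hl
    exact ⟨l', rfl⟩

theorem heq_comp_emb_fibMap {T S R : O} (f : T ⟶ S) (g : S ⟶ R) (i : Fin (card R))
    (k : Fin (card (fib g i))) {α : Type*} (X : Fin (card T) → α) :
    HEq ((X ∘ emb (f ≫ g) i) ∘ emb (fibMap f g i) k) (X ∘ emb f (emb g i k)) :=
  heq_comp_of_range (fib_fibMap f g i k) X _ _ (range_emb_fibMap f g i k)

theorem heq_comp_emb_U {T : O} {c : Comp O} (f : T ⟶ U c) (i : Fin (card (U c))) {α : Type*}
    (X : Fin (card T) → α) : HEq (X ∘ emb f i) X := by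
  refine heq_comp_of_range (fib_U f i) X (emb f i) (RelEmbedding.refl _) ?_
  rw [range_emb]
  refine Set.ext fun j => ⟨fun _ => ⟨j, rfl⟩, fun _ => ?_⟩
  have := card_U (O := O) c
  exact Fin.ext (by omega)

end FibreLemmas

/-! ### Coloured objects -/

/-- The objects `T(i₁, …, iₖ; i)` of `O^C`: objects of `O` with colours on the elements of `|T|`
and a root colour. -/
structure Colored (O : Type uo) [Category.{vo} O] [OperadicData.{w} O] (C : Type v) where
  obj : O
  col : Fin (card obj) → C
  root : C

namespace Colored

variable {O : Type uo} [Category.{vo} O] {C : Type v}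

section
variable [OperadicData.{w} O]

/-- Morphisms of coloured objects are morphisms of objects with the same root colour. -/
structure Hom (T S : Colored O C) where
  hom : T.obj ⟶ S.obj
  root_eq : T.root = S.root

instance : Category.{vo} (Colored O C) where
  Hom T S := Hom T S
  id T := ⟨𝟙 T.obj, rfl⟩
  comp f g := ⟨f.hom ≫ g.hom, f.root_eq.trans g.root_eq⟩
  id_comp _ := congrArg (Hom.mk · _) (Category.id_comp _)
  comp_id _ := congrArg (Hom.mk · _) (Category.comp_id _)
  assoc _ _ _ := congrArg (Hom.mk · _) (Category.assoc _ _ _)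

theorem eq_of {T S : Colored O C} (h : T.obj = S.obj) (hc : HEq T.col S.col)
    (hr : T.root = S.root) : T = S := by
  cases T; cases S
  cases h; cases hc; cases hr
  rfl

theorem hom_ext {T S : Colored O C} (f g : T ⟶ S) (h : f.hom = g.hom) : f = g :=
  match f, g, h with
  | ⟨_, _⟩, ⟨_, _⟩, rfl => rfl

theorem hom_heq {T S T' S' : Colored O C} (hT : T = T') (hS : S = S') {f : T ⟶ S} {g : T' ⟶ S'}
    (h : HEq f.hom g.hom) : HEq f g := by
  subst hT hS
  exact heq_of_eq (hom_ext f g (eq_of_heq h))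

/-- Forgetting the colours, on slices. -/
def overForget (R : Colored O C) : Over R ⥤ Over R.obj where
  obj f := Over.mk f.hom.hom
  map u := Over.homMk u.left.hom (congrArg Hom.hom (Over.w u))

instance : OperadicData.{max w v} (Colored O C) where
  card T := card T.obj
  cardMap f := cardMap f.hom
  cardMap_id T := cardMap_id T.obj
  cardMap_comp f g := cardMap_comp f.hom g.hom
  Comp := Comp O × C
  π₀ T := (π₀ T.obj, T.root)
  π₀_eq f := Prod.ext (π₀_eq f.hom) f.root_eq
  U c := ⟨U c.1, fun _ => c.2, c.2⟩
  π₀_U c := Prod.ext (π₀_U c.1) rfl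
  toU T := ⟨toU T.obj, rfl⟩
  toU_unique f g := hom_ext f g (toU_unique f.hom g.hom)
  Fib {R} i :=
    { obj f := ⟨fib f.hom.hom i, f.left.col ∘ emb f.hom.hom i, R.col i⟩
      map u := ⟨(Fib i).map ((overForget R).map u), rfl⟩
      map_id f := hom_ext _ _ ((congrArg (Fib i).map ((overForget R).map_id f)).trans
        ((Fib i).map_id _))
      map_comp u u' := hom_ext _ _ ((congrArg (Fib i).map ((overForget R).map_comp u u')).trans
        ((Fib i).map_comp _ _)) }
  card_Fib {R} i f := card_Fib i ((overForget R).obj f)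

end

variable [OperadicCategory.{w} O]

theorem fib_fibMap' {T S R : Colored O C} (f : T ⟶ S) (g : S ⟶ R) (i : Fin (card R))
    (k : Fin (card (fib g i))) : fib (fibMap f g i) k = fib f (emb g i k) :=
  eq_of (fib_fibMap f.hom g.hom i k) (heq_comp_emb_fibMap f.hom g.hom i k _) rfl

/-- The operadic category `O^C`. -/
instance : OperadicCategory.{max w v} (Colored O C) where
  card_U c := card_U c.1
  fib_id_eq T i := by
    obtain ⟨c, hc⟩ := fib_id_eq T.obj i
    refine ⟨(c, T.col i), eq_of hc ?_ rfl⟩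
    have h : T.col ∘ emb (𝟙 T.obj) i = fun _ => T.col i :=
      funext fun k => congrArg T.col (emb_id i k)
    change HEq (T.col ∘ emb (𝟙 T.obj) i) (fun _ : Fin (card (U c)) => T.col i)
    rw [h, hc]
  emb_cardMap_fibMap f g i k := emb_cardMap_fibMap f.hom g.hom i k
  Fib_U c i := by
    have hobj : ∀ f : Over (U c : Colored O C),
        (Fib i).obj f = (Over.forget (U c : Colored O C)).obj f := fun f =>
      eq_of (fib_U f.hom.hom i) (heq_comp_emb_U f.hom.hom i f.left.col) f.hom.root_eq.symm
    refine CategoryTheory.Functor.hext hobj fun f g u => hom_heq (hobj f) (hobj g) ?_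
    change HEq ((Fib (R := U c.1) i).map ((overForget (U c)).map u)) u.left.hom
    rw [Fib_U]
    rfl
  fib_fibMap := fib_fibMap'
  fibMap_fibMap {T S Q R} f a c i k := by
    have key : ∀ (h : T ⟶ R) (_ : h = (f ≫ a) ≫ c) (u : fib h i ⟶ fib c i)
        (_ : HEq u (fibMap (f ≫ a) c i)), fib u k = fib (f ≫ a) (emb c i k) := by
      rintro h rfl u hu
      rw [eq_of_heq hu]
      exact fib_fibMap' (f ≫ a) c i k
    exact hom_heq (key _ (Category.assoc _ _ _).symm _ (heq_fibMap_comp f a c i))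
      (fib_fibMap' a c i k) (fibMap_fibMap f.hom a.hom c.hom i k)

end Colored

/-! ### Operads -/

/-- The structure maps of an `O`-operad in `V`, without axioms. -/
structure PreOperad (O : Type uo) [Category.{vo} O] [OperadicCategory.{w} O]
    (V : Type u) [Category.{v} V] [MonoidalCategory V] where
  obj : O → V
  unit (c : Comp O) : 𝟙_ V ⟶ obj (U c)
  mul {T S : O} (f : T ⟶ S) : (tens fun i => obj (fib f i)) ⊗ obj S ⟶ obj T

/-- Morphisms: families of maps commuting with units and multiplications. -/
@[ext]
structure PreOperad.Hom {O : Type uo} [Category.{vo} O] [OperadicCategory.{w} O]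
    {V : Type u} [Category.{v} V] [MonoidalCategory V] (P Q : PreOperad O V) where
  app (T : O) : P.obj T ⟶ Q.obj T
  unit_app (c : Comp O) : P.unit c ≫ app (U c) = Q.unit c
  mul_app {T S : O} (f : T ⟶ S) :
    P.mul f ≫ app T = ((tensMap fun i => app (fib f i)) ⊗ₘ app S) ≫ Q.mul f

/-- `O`-operads in a symmetric monoidal category `V`. -/
structure Operad (O : Type uo) [Category.{vo} O] [OperadicCategory.{w} O]
    (V : Type u) [Category.{v} V] [MonoidalCategory V] [BraidedCategory V]
    extends PreOperad O V where
  assoc {T S R : O} (f : T ⟶ S) (g : S ⟶ R) :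
    (tens fun j => obj (fib f j)) ◁ mul g ≫ mul f =
      (α_ (tens fun j => obj (fib f j)) (tens fun i => obj (fib g i)) (obj R)).inv ≫
        ((tensRegroup (embEquiv g) (fun j => obj (fib f j)) ≫
          tensMap fun i => tensMap fun k =>
            eqToHom (congrArg obj (fib_fibMap f g i k).symm)) ▷ (tens fun i => obj (fib g i)) ≫
          tensZip (fun i => tens fun k => obj (fib (fibMap f g i) k)) (fun i => obj (fib g i)) ≫
          tensMap fun i => mul (fibMap f g i)) ▷ obj R ≫
        mul (f ≫ g)
  unit_mul (T : O) :
    (λ_ (obj T)).inv ≫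
      (tensUnit (card T) ≫ tensMap fun i =>
        unit (src T i) ≫ eqToHom (congrArg obj (fib_id T i).symm)) ▷ obj T ≫
      mul (𝟙 T) = 𝟙 (obj T)
  mul_unit (T : O) :
    (ρ_ (obj T)).inv ≫
      (tensOne (card_U (π₀ T)) (fun i => obj (fib (toU T) i))
        (fun i => eqToHom (congrArg obj (fib_U (toU T) i).symm)) ⊗ₘ unit (π₀ T)) ≫
      mul (toU T) = 𝟙 (obj T)

/-! ### Multicotensors and algebras -/

/-- `V`-functors `K ⊗ ⋯ ⊗ K ⟶ K` of `n` variables. -/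
structure MultiFunctor (V : Type u) [Category.{v} V] [MonoidalCategory V] [BraidedCategory V]
    (K : Type uk) [Category.{vk} K] [EnrichedOrdinaryCategory V K] (n : ℕ) where
  obj : (Fin n → K) → K
  map (X Y : Fin n → K) : (tens fun i => X i ⟶[V] Y i) ⟶ (obj X ⟶[V] obj Y)
  map_id (X : Fin n → K) :
    tensUnit n ≫ (tensMap fun i => eId V (X i)) ≫ map X X = eId V (obj X)
  map_comp (X Y Z : Fin n → K) :
    tensZip (fun i => X i ⟶[V] Y i) (fun i => Y i ⟶[V] Z i) ≫
      (tensMap fun i => eComp V (X i) (Y i) (Z i)) ≫ map X Z =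
    (map X Y ⊗ₘ map Y Z) ≫ eComp V (obj X) (obj Y) (obj Z)

/-- The action of a multifunctor on morphisms of the underlying category. -/
def MultiFunctor.mapHom {V : Type u} [Category.{v} V] [MonoidalCategory V] [BraidedCategory V]
    {K : Type uk} [Category.{vk} K] [EnrichedOrdinaryCategory V K] {n : ℕ}
    (F : MultiFunctor V K n) {X Y : Fin n → K} (φ : ∀ i, X i ⟶ Y i) : F.obj X ⟶ F.obj Y :=
  (eHomEquiv V).symm (tensUnit n ≫ (tensMap fun i => eHomEquiv V (φ i)) ≫ F.map X Y)

section Multicotensors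

variable {O : Type uo} [Category.{vo} O] [OperadicCategory.{w} O]
  {V : Type u} [Category.{v} V] [MonoidalCategory V] [BraidedCategory V]
  {K : Type uk} [Category.{vk} K] [EnrichedOrdinaryCategory V K]

theorem obj_congr (D : ∀ T : O, MultiFunctor V K (card T)) {A B : O} (h : A = B)
    {X : Fin (card A) → K} {Y : Fin (card B) → K} (hX : HEq X Y) :
    (D A).obj X = (D B).obj Y := by
  subst h
  rw [eq_of_heq hX]

theorem eq_of_card_U {c : Comp O} (i k : Fin (card (U c))) : k = i := by
  have := card_U (O := O) c
  exact Fin.ext (by omega)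

/-- The unique element of `|U|` for a chosen terminal object `U`. -/
def pt {W : O} {c : Comp O} (h : W = U c) : Fin (card W) := ⟨0, by rw [h, card_U]; exact one_pos⟩

/-- `O`-multicotensors: colax morphisms from the terminal `O`-operad to the operad of
`V`-functors `K ⊗ ⋯ ⊗ K ⟶ K`. -/
structure Multicotensor (O : Type uo) [Category.{vo} O] [OperadicCategory.{w} O]
    (V : Type u) [Category.{v} V] [MonoidalCategory V] [BraidedCategory V]
    (K : Type uk) [Category.{vk} K] [EnrichedOrdinaryCategory V K] where
  D (T : O) : MultiFunctor V K (card T)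
  comul {T S : O} (f : T ⟶ S) (X : Fin (card T) → K) :
    (D T).obj X ⟶ (D S).obj fun i => (D (fib f i)).obj (X ∘ emb f i)
  /-- `V`-naturality of the comultiplication -/
  comul_natural {T S : O} (f : T ⟶ S) (X Y : Fin (card T) → K) :
    (D T).map X Y ≫ eHomWhiskerLeft V ((D T).obj X) (comul f Y) =
      tensRegroup (embEquiv f) (fun j => X j ⟶[V] Y j) ≫
        (tensMap fun i => (D (fib f i)).map (X ∘ emb f i) (Y ∘ emb f i)) ≫
        (D S).map (fun i => (D (fib f i)).obj (X ∘ emb f i))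
          (fun i => (D (fib f i)).obj (Y ∘ emb f i)) ≫
        eHomWhiskerRight V (comul f X) _
  /-- the counit `D_U(x) ⟶ x` for a chosen terminal object `U` -/
  counit (c : Comp O) (X : Fin (card (U c)) → K) (i : Fin (card (U c))) :
    (D (U c)).obj X ⟶ X i
  /-- `V`-naturality of the counit -/
  counit_natural (c : Comp O) (X Y : Fin (card (U c)) → K) (i : Fin (card (U c))) :
    (D (U c)).map X Y ≫ eHomWhiskerLeft V ((D (U c)).obj X) (counit c Y i) =
      collapse i (fun k => X k ⟶[V] Y k) (𝟙 _) (fun k hk => absurd (eq_of_card_U i k) hk) ≫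
        eHomWhiskerRight V (counit c X i) (Y i)
  coassoc {T S R : O} (f : T ⟶ S) (g : S ⟶ R) (X : Fin (card T) → K) :
    comul f X ≫ comul g (fun j => (D (fib f j)).obj (X ∘ emb f j)) =
      comul (f ≫ g) X ≫
        (D R).mapHom (fun i => comul (fibMap f g i) (X ∘ emb (f ≫ g) i)) ≫
        eqToHom (congrArg (D R).obj (funext fun i => congrArg (D (fib g i)).obj (funext fun k =>
          obj_congr D (fib_fibMap f g i k) (heq_comp_emb_fibMap f g i k X))))
  counit_comul (T : O) (X : Fin (card T) → K) :
    comul (𝟙 T) X ≫ (D T).mapHom (fun i =>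
      eqToHom (obj_congr D (fib_id T i) (heq_comp_emb_id i X)) ≫
        counit (src T i) (fun _ => X i) (pt rfl)) = 𝟙 ((D T).obj X)
  comul_counit (T : O) (X : Fin (card T) → K) (i : Fin (card (U (π₀ T)))) :
    comul (toU T) X ≫ counit (π₀ T) (fun i => (D (fib (toU T) i)).obj (X ∘ emb (toU T) i)) i =
      eqToHom (obj_congr D (fib_U (toU T) i) (heq_comp_emb_U (toU T) i X)).symm

/-- The multicotensor `D^C` over `O^C` obtained from `D` by forgetting the colours. -/
def Multicotensor.colored (D : Multicotensor O V K) (C : Type v) :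
    Multicotensor (Colored O C) V K where
  D T := D.D T.obj
  comul f X := D.comul f.hom X
  comul_natural f X Y := D.comul_natural f.hom X Y
  counit c X i := D.counit c.1 X i
  counit_natural c X Y i := D.counit_natural c.1 X Y i
  coassoc f g X := D.coassoc f.hom g.hom X
  counit_comul T X := D.counit_comul T.obj X
  comul_counit T X i := D.comul_counit T.obj X i

/-- The endomorphism operad `End^D_X` of a family `X` of objects of `K` indexed by the connected
components of `O`. -/
def Multicotensor.endOperad (D : Multicotensor O V K) (X : Comp O → K) : PreOperad O V where
  obj T := (D.D T).obj (fun k => X (src T k)) ⟶[V] X (π₀ T)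
  unit c := eHomEquiv V (D.counit c (fun k => X (src (U c) k)) (pt rfl) ≫
    eqToHom (congrArg X ((src_U c (pt rfl)).trans (π₀_U c).symm)))
  mul {T S} f :=
    ((tensMap fun i => eHomWhiskerLeft V ((D.D (fib f i)).obj fun k => X (src (fib f i) k))
        (eqToHom (congrArg X (π₀_fib f i)))) ≫
      (D.D S).map (fun i => (D.D (fib f i)).obj fun k => X (src (fib f i) k))
        (fun i => X (src S i))) ▷ ((D.D S).obj (fun k => X (src S k)) ⟶[V] X (π₀ S)) ≫
    eComp V ((D.D S).obj fun i => (D.D (fib f i)).obj fun k => X (src (fib f i) k))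
      ((D.D S).obj fun i => X (src S i)) (X (π₀ S)) ≫
    eHomWhiskerRight V (D.comul f (fun k => X (src T k)) ≫
      eqToHom (congrArg (D.D S).obj (funext fun i => congrArg (D.D (fib f i)).obj
        (funext fun k => congrArg X (src_fib f i k).symm)))) (X (π₀ S)) ≫
    eHomWhiskerLeft V ((D.D T).obj fun k => X (src T k)) (eqToHom (congrArg X (π₀_eq f).symm))

/-- A `P`-algebra structure on the family `X`: a map of operads from `P` to `End^D_X`. -/
abbrev Algebra (D : Multicotensor O V K) (P : PreOperad O V) (X : Comp O → K) :=
  PreOperad.Hom P (D.endOperad X)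

/-- A family of morphisms `φ c : X c ⟶ Y c` is a morphism of `P`-algebras. -/
def IsAlgebraHom {D : Multicotensor O V K} {P : PreOperad O V} {X Y : Comp O → K}
    (A : Algebra D P X) (B : Algebra D P Y) (φ : ∀ c, X c ⟶ Y c) : Prop :=
  ∀ T : O, A.app T ≫ eHomWhiskerLeft V ((D.D T).obj fun k => X (src T k)) (φ (π₀ T)) =
    B.app T ≫ eHomWhiskerRight V ((D.D T).mapHom fun k => φ (src T k)) (Y (π₀ T))

/-- Colax `O`-monoidal structures on `K`: the comonads `D_U` are trivial, i.e. their counits are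
invertible. (The compatibility of `D` with the strengths `B ⊗ D_T(…, X, …) ⟶ D_T(…, B ⊗ X, …)`
is a special case of the `V`-naturality of the comultiplication and the counit: the strength is
adjoint to `B ⟶ K(X, B ⊗ X) ⟶ K(D_T(…, X, …), D_T(…, B ⊗ X, …))`.) -/
structure ColaxMonoidal (O : Type uo) [Category.{vo} O] [OperadicCategory.{w} O]
    (V : Type u) [Category.{v} V] [MonoidalCategory V] [BraidedCategory V]
    (K : Type uk) [Category.{vk} K] [EnrichedOrdinaryCategory V K]
    extends Multicotensor O V K where
  isIso_counit (c : Comp O) (X : Fin (card (U c)) → K) (i : Fin (card (U c))) :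
    IsIso (counit c X i)

end Multicotensors

/-! ### Complete `V`-categories -/

/-- `K` is complete as a `V`-category: it has cotensors `Y^B` and all small conical limits. -/
structure IsVComplete (V : Type u) [Category.{v} V] [MonoidalCategory V]
    (K : Type uk) [Category.{vk} K] [EnrichedOrdinaryCategory V K] : Prop where
  cotensor (B : V) (Y : K) : ∃ (Z : K) (e : B ⟶ (Z ⟶[V] Y)), ∀ (X : K) (W : V)
    (x : W ⊗ B ⟶ (X ⟶[V] Y)), ∃! y : W ⟶ (X ⟶[V] Z), (y ⊗ₘ e) ≫ eComp V X Z Y = x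
  conical : Enriched.HasConicalLimitsOfSize.{v, v} V K

/-! ### The underlying category of an `O^C`-operad -/

section Underlying

variable {O : Type uo} [Category.{vo} O] [OperadicCategory.{w} O] {C : Type v}
  {V : Type u} [Category.{v} V] [MonoidalCategory V]

/-- The object `T(a₁, …, aₖ; i)` of `O^C`. -/
abbrev colObj (T : O) (a : Fin (card T) → C) (i : C) : Colored O C := ⟨T, a, i⟩

/-- The object `U_c(i; j)` of `O^C`. -/
abbrev linObj (c : Comp O) (i j : C) : Colored O C := ⟨U c, fun _ => i, j⟩

/-- The morphism `T(a; i) ⟶ S(b; i)` given by `f : T ⟶ S`. -/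
abbrev colHom {T S : O} (f : T ⟶ S) (a : Fin (card T) → C) (b : Fin (card S) → C) (i : C) :
    colObj T a i ⟶ colObj S b i := ⟨f, rfl⟩

theorem fib_colHom_id (T : O) (a b : Fin (card T) → C) (i : C) (k : Fin (card T)) :
    fib (colHom (𝟙 T) a b i) k = linObj (src T k) (a k) (b k) :=
  Colored.eq_of (fib_id T k) (heq_comp_emb_id k a) rfl

theorem fib_colHom_toU (T : O) (a : Fin (card T) → C) (i j : C) (k : Fin (card (U (π₀ T)))) :
    fib (colHom (toU T) a (fun _ => i) j) k = colObj T a i :=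
  Colored.eq_of (fib_U (toU T) k) (heq_comp_emb_U (toU T) k a) rfl

theorem fib_colHom_lin (c : Comp O) (i j l : C) (k : Fin (card (U c))) :
    fib (colHom (𝟙 (U c)) (fun _ => i) (fun _ => j) l) k = linObj c i j :=
  Colored.eq_of (fib_U (𝟙 (U c)) k) (heq_comp_emb_U (𝟙 (U c)) k fun _ => i) rfl

variable (P : PreOperad (Colored O C) V)

/-- The hom-object of the underlying category `U(P)` from `(c, i)` to `(c, j)`. The hom-objects
between objects in different components `c ≠ d` are initial, so that `V`-functors out of `U(P)` are
families, indexed by `c`, of `V`-functors out of the full subcategories on the objects `(c, i)`. -/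
def uHom (c : Comp O) (i j : C) : V := P.obj (linObj c i j)

/-- The identities of `U(P)`. -/
def uId (c : Comp O) (i : C) : 𝟙_ V ⟶ uHom P c i i :=
  P.unit ((c, i) : Comp O × C)

/-- The composition of `U(P)`, induced by `U_c(i; l) ⟶ U_c(j; l)`. -/
def uComp (c : Comp O) (i j l : C) : uHom P c i j ⊗ uHom P c j l ⟶ uHom P c i l :=
  tensOne (card_U c) (fun k => P.obj (fib (colHom (𝟙 (U c)) (fun _ => i) (fun _ => j) l) k))
      (fun k => eqToHom (congrArg P.obj (fib_colHom_lin c i j l k).symm)) ▷ uHom P c j l ≫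
    P.mul (colHom (𝟙 (U c)) (fun _ => i) (fun _ => j) l)

/-- The contravariant action `⨂ₖ U(P)(aₖ, bₖ) ⊗ P(T(b; i)) ⟶ P(T(a; i))`. -/
def contraAct (T : O) (a b : Fin (card T) → C) (i : C) :
    (tens fun k => uHom P (src T k) (a k) (b k)) ⊗ P.obj (colObj T b i) ⟶ P.obj (colObj T a i) :=
  (tensMap fun k => eqToHom (congrArg P.obj (fib_colHom_id T a b i k).symm)) ▷
      P.obj (colObj T b i) ≫
    P.mul (colHom (𝟙 T) a b i)

/-- The covariant action `P(T(a; i)) ⊗ U(P)(i, j) ⟶ P(T(a; j))`. -/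
def coAct (T : O) (a : Fin (card T) → C) (i j : C) :
    P.obj (colObj T a i) ⊗ uHom P (π₀ T) i j ⟶ P.obj (colObj T a j) :=
  tensOne (card_U (π₀ T)) (fun k => P.obj (fib (colHom (toU T) a (fun _ => i) j) k))
      (fun k => eqToHom (congrArg P.obj (fib_colHom_toU T a i j k).symm)) ▷
        uHom P (π₀ T) i j ≫
    P.mul (colHom (toU T) a (fun _ => i) j)

/-- Families of objects of a `V`-category `K` and morphisms of hom-objects out of `U(P)`. -/
structure UDiagram (K : Type uk) [EnrichedCategory V K] where
  obj : Comp O → C → K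
  map (c : Comp O) (i j : C) : uHom P c i j ⟶ (obj c i ⟶[V] obj c j)

/-- `V`-functors `U(P) ⟶ K`. -/
structure UFunctor (K : Type uk) [EnrichedCategory V K] extends UDiagram P K where
  map_id (c : Comp O) (i : C) : uId P c i ≫ map c i i = eId V (obj c i)
  map_comp (c : Comp O) (i j l : C) :
    uComp P c i j l ≫ map c i l = (map c i j ⊗ₘ map c j l) ≫ eComp V (obj c i) (obj c j) (obj c l)

variable {P}

/-- The restriction `ι^* A` of a `P`-algebra to the underlying category: `(c, i) ↦ A(c, i)`, with
action of the hom-objects `P(U_c(i; j))` given by the algebra structure and the identification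
`D_{U_c}(A(c, i)) ≅ A(c, i)`. -/
def restrict [BraidedCategory V] {K : Type uk} [Category.{vk} K] [EnrichedOrdinaryCategory V K]
    (D : ColaxMonoidal O V K) {X : Comp (Colored O C) → K}
    (A : Algebra (D.toMulticotensor.colored C) P X) : UDiagram P K where
  obj c i := X ((c, i) : Comp O × C)
  map c i j :=
    A.app (linObj c i j) ≫
      eHomWhiskerRight V
        ((haveI := D.isIso_counit c (fun _ => X ((c, i) : Comp O × C)) (pt rfl)
          inv (D.counit c (fun _ => X ((c, i) : Comp O × C)) (pt rfl))) ≫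
          eqToHom (congrArg (D.D (U c)).obj (funext fun k =>
            congrArg (fun d => X ((d, i) : Comp O × C)) (src_U c k).symm))) _ ≫
      eHomWhiskerLeft V _
        (eqToHom (congrArg (fun d => X ((d, j) : Comp O × C)) (π₀_U c)))

end Underlying

/-! ### Totalization, convolution and condensation -/

section Condensation

variable {O : Type uo} [Category.{vo} O] [OperadicCategory.{w} O] {C : Type v}
  {V : Type u} [Category.{v} V] [MonoidalCategory V] [MonoidalClosed V]
  {P : PreOperad (Colored O C) V}

/-- The action `δ(c, i) ⊗ U(P)(i, j) ⟶ δ(c, j)` of a `V`-functor `δ : U(P) ⟶ V`. -/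
def UFunctor.act (δ : UFunctor P V) (c : Comp O) (i j : C) :
    δ.obj c i ⊗ uHom P c i j ⟶ δ.obj c j :=
  δ.obj c i ◁ δ.map c i j ≫ (ihom.ev (δ.obj c i)).app (δ.obj c j)

/-- The component at `c` of the `δ`-totalization, the end `∫ᵢ B(c, i)^δ(c, i)` in `K`: an object `L`
with evaluations `δ(c, i) ⟶ K(L, B(c, i))` inducing isomorphisms
`K(X, L) ≅ ∫ᵢ V(δ(c, i), K(X, B(c, i)))` for all `X`. -/
structure Totalization (δ : UFunctor P V) {K : Type uk} [EnrichedCategory V K]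
    (B : UDiagram P K) (c : Comp O) where
  pt : K
  ev (i : C) : δ.obj c i ⟶ (pt ⟶[V] B.obj c i)
  wedge (i j : C) : δ.act c i j ≫ ev j =
    (ev i ⊗ₘ B.map c i j) ≫ eComp V pt (B.obj c i) (B.obj c j)
  existsUnique_lift (X : K) (W : V) (x : ∀ i, W ⊗ δ.obj c i ⟶ (X ⟶[V] B.obj c i))
    (hx : ∀ i j, W ◁ δ.act c i j ≫ x j =
      (α_ W (δ.obj c i) (uHom P c i j)).inv ≫
        (x i ⊗ₘ B.map c i j) ≫ eComp V X (B.obj c i) (B.obj c j)) :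
    ∃! y : W ⟶ (X ⟶[V] pt), ∀ i, (y ⊗ₘ ev i) ≫ eComp V X pt (B.obj c i) = x i

variable [BraidedCategory V]

/-- The convolution product `E_T(δ, …, δ)`, a `V`-functor on the component `π₀ T` of `U(P)`: the
coends `∫^{a₁, …, aₖ} P(T(a₁, …, aₖ; i)) ⊗ δ(a₁) ⊗ ⋯ ⊗ δ(aₖ)` with the action of `U(P)` induced
by the covariant action on `P(T(a; i))`. (As `V` is closed, the coend is the quotient of the
coproduct of its terms by the actions of the hom-objects of `U(P)`.) -/
structure Convolution (δ : UFunctor P V) (T : O) where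
  obj (i : C) : V
  ι (a : Fin (card T) → C) (i : C) :
    (P.obj (colObj T a i) ⊗ tens fun k => δ.obj (src T k) (a k)) ⟶ obj i
  wedge (a b : Fin (card T) → C) (i : C) :
    contraAct P T a b i ▷ (tens fun k => δ.obj (src T k) (a k)) ≫ ι a i =
      (β_ (tens fun k => uHom P (src T k) (a k) (b k)) (P.obj (colObj T b i))).hom ▷ _ ≫
        (α_ _ _ _).hom ≫
        P.obj (colObj T b i) ◁
          ((β_ (tens fun k => uHom P (src T k) (a k) (b k))
              (tens fun k => δ.obj (src T k) (a k))).hom ≫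
            tensZip (fun k => δ.obj (src T k) (a k)) (fun k => uHom P (src T k) (a k) (b k)) ≫
            tensMap fun k => δ.act (src T k) (a k) (b k)) ≫
        ι b i
  existsUnique_desc (i : C) (W : V)
    (x : ∀ a, (P.obj (colObj T a i) ⊗ tens fun k => δ.obj (src T k) (a k)) ⟶ W)
    (hx : ∀ a b, contraAct P T a b i ▷ (tens fun k => δ.obj (src T k) (a k)) ≫ x a =
      (β_ (tens fun k => uHom P (src T k) (a k) (b k)) (P.obj (colObj T b i))).hom ▷ _ ≫
        (α_ _ _ _).hom ≫
        P.obj (colObj T b i) ◁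
          ((β_ (tens fun k => uHom P (src T k) (a k) (b k))
              (tens fun k => δ.obj (src T k) (a k))).hom ≫
            tensZip (fun k => δ.obj (src T k) (a k)) (fun k => uHom P (src T k) (a k) (b k)) ≫
            tensMap fun k => δ.act (src T k) (a k) (b k)) ≫
        x b) :
    ∃! y : obj i ⟶ W, ∀ a, ι a i ≫ y = x a
  act (i j : C) : obj i ⊗ uHom P (π₀ T) i j ⟶ obj j
  ι_act (a : Fin (card T) → C) (i j : C) :
    ι a i ▷ uHom P (π₀ T) i j ≫ act i j =
      (α_ _ _ _).hom ≫ P.obj (colObj T a i) ◁ (β_ _ _).hom ≫ (α_ _ _ _).inv ≫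
        coAct P T a i j ▷ (tens fun k => δ.obj (src T k) (a k)) ≫ ι a j

/-- The `δ`-condensation of `P`: the `O`-operad with components the ends
`∫ᵢ V(δ(i), E_T(δ, …, δ)(i))`, with the operad structure of the coendomorphism operad of `δ` for
the multitensor `E`. -/
structure Condensation (δ : UFunctor P V) where
  /-- the convolution products `E_T(δ, …, δ)` -/
  conv (T : O) : Convolution δ T
  operad : Operad O V
  /-- the universal wedge of the end, in adjoint form -/
  ev (T : O) (i : C) : operad.obj T ⊗ δ.obj (π₀ T) i ⟶ (conv T).obj i
  wedge (T : O) (i j : C) : operad.obj T ◁ δ.act (π₀ T) i j ≫ ev T j =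
    (α_ _ _ _).inv ≫ ev T i ▷ uHom P (π₀ T) i j ≫ (conv T).act i j
  existsUnique_lift (T : O) (W : V) (x : ∀ i, W ⊗ δ.obj (π₀ T) i ⟶ (conv T).obj i)
    (hx : ∀ i j, W ◁ δ.act (π₀ T) i j ≫ x j =
      (α_ _ _ _).inv ≫ x i ▷ uHom P (π₀ T) i j ≫ (conv T).act i j) :
    ∃! y : W ⟶ operad.obj T, ∀ i, y ▷ δ.obj (π₀ T) i ≫ ev T i = x i
  /-- the units are induced by `δ(c, i) ⟶ P(U_c(i; i)) ⊗ δ(c, i) ⟶ E_{U_c}(δ)(i)` -/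
  unit_ev (c : Comp O) (i : C) :
    operad.unit c ▷ δ.obj (π₀ (U c)) i ≫ ev (U c) i =
      (uId P c i ⊗ₘ tensOne (card_U c) (fun k => δ.obj (src (U c) k) i)
        fun k => eqToHom (congrArg (δ.obj · i) ((π₀_U c).trans (src_U c k).symm))) ≫
      (conv (U c)).ι (fun _ => i) i
  /-- the structure map `E_S(E_{T₁}(δ, …, δ), …, E_{Tₙ}(δ, …, δ)) ⟶ E_T(δ, …, δ)` of the
  multitensor, on the terms of the outer coend -/
  μ {T S : O} (f : T ⟶ S) (a : Fin (card S) → C) (i : C) :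
    (P.obj (colObj S a i) ⊗ tens fun k => (conv (fib f k)).obj (a k)) ⟶ (conv T).obj i
  /-- the multitensor structure is induced by the multiplication of `P` -/
  ι_μ {T S : O} (f : T ⟶ S) (b : Fin (card T) → C) (a : Fin (card S) → C) (i : C) :
    P.mul (colHom f b a i) ▷ (tens fun l => δ.obj (src T l) (b l)) ≫ (conv T).ι b i =
      (β_ _ _).hom ▷ _ ≫ (α_ _ _ _).hom ≫
        P.obj (colObj S a i) ◁
          ((tens fun k => P.obj (colObj (fib f k) (b ∘ emb f k) (a k))) ◁
              (tensRegroup (embEquiv f) (fun l => δ.obj (src T l) (b l)) ≫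
                tensMap fun k => tensMap fun l =>
                  eqToHom (congrArg (δ.obj · (b (emb f k l))) (src_fib f k l).symm)) ≫
            tensZip (fun k => P.obj (colObj (fib f k) (b ∘ emb f k) (a k)))
              (fun k => tens fun l => δ.obj (src (fib f k) l) (b (emb f k l))) ≫
            tensMap fun k => (conv (fib f k)).ι (b ∘ emb f k) (a k)) ≫
        μ f a i
  /-- composition of `E_S(δ, …, δ)(i) ⟶ E_S(E_{T₁}(δ, …, δ), …, E_{Tₙ}(δ, …, δ))(i)`, given by
  the functoriality of `E_S`, with the multitensor structure -/
  ν {T S : O} (f : T ⟶ S) (i : C) :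
    (tens fun k => operad.obj (fib f k)) ⊗ (conv S).obj i ⟶ (conv T).obj i
  ι_ν {T S : O} (f : T ⟶ S) (a : Fin (card S) → C) (i : C) :
    (tens fun k => operad.obj (fib f k)) ◁ (conv S).ι a i ≫ ν f i =
      (α_ _ _ _).inv ≫ (β_ _ _).hom ▷ _ ≫ (α_ _ _ _).hom ≫
        P.obj (colObj S a i) ◁
          (tensZip (fun k => operad.obj (fib f k)) (fun k => δ.obj (src S k) (a k)) ≫
            tensMap fun k =>
              operad.obj (fib f k) ◁ eqToHom (congrArg (δ.obj · (a k)) (π₀_fib f k).symm) ≫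
                ev (fib f k) (a k)) ≫
        μ f a i
  /-- the multiplication is composition of `V`-natural transformations, followed by `μ` -/
  mul_ev {T S : O} (f : T ⟶ S) (i : C) :
    operad.mul f ▷ δ.obj (π₀ T) i ≫ ev T i =
      (α_ _ _ _).hom ≫
        (tens fun k => operad.obj (fib f k)) ◁
          (operad.obj S ◁ eqToHom (congrArg (δ.obj · i) (π₀_eq f)) ≫ ev S i) ≫
        ν f i

/-- The algebra structure `α` on the totalization is the one induced by the `P`-algebra structure
of `A`: for all `T` and `i`, the composite of `α` with the projection of the totalization to
`A(π₀ T, i)^δ(i)` is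
`Q(T) ⊗ δ(i) ⟶ E_T(δ, …, δ)(i) ⟶ K(D_T(Tot, …, Tot), A(π₀ T, i))`, where the second map is given
on the term `P(T(a; i)) ⊗ δ(a₁) ⊗ ⋯ ⊗ δ(aₖ)` of the coend by the evaluations
`δ(aₖ) ⟶ K(Tot, A(aₖ))` and the action of `P(T(a; i))` on `A`. -/
def IsInducedAction {δ : UFunctor P V} (Q : Condensation δ)
    {K : Type uk} [Category.{vk} K] [EnrichedOrdinaryCategory V K]
    {D : ColaxMonoidal O V K} {X : Comp (Colored O C) → K}
    (A : Algebra (D.toMulticotensor.colored C) P X)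
    (t : ∀ c, Totalization δ (restrict D A) c)
    (α : Algebra D.toMulticotensor Q.operad.toPreOperad fun c => (t c).pt) : Prop :=
  ∀ (T : O) (i : C), ∃ θ : (Q.conv T).obj i ⟶
      ((D.D T).obj (fun k => (t (src T k)).pt) ⟶[V] (restrict D A).obj (π₀ T) i),
    (∀ a : Fin (card T) → C, (Q.conv T).ι a i ≫ θ =
      (A.app (colObj T a i) ⊗ₘ
        ((tensMap fun k => (t (src T k)).ev (a k)) ≫
          (D.D T).map (fun k => (t (src T k)).pt)
            (fun k => (restrict D A).obj (src T k) (a k)))) ≫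
        (β_ _ _).hom ≫
        eComp V ((D.D T).obj fun k => (t (src T k)).pt)
          ((D.D T).obj fun k => (restrict D A).obj (src T k) (a k))
          ((restrict D A).obj (π₀ T) i)) ∧
    (α.app T ⊗ₘ (t (π₀ T)).ev i) ≫
        eComp V ((D.D T).obj fun k => (t (src T k)).pt) (t (π₀ T)).pt
          ((restrict D A).obj (π₀ T) i) =
      Q.ev T i ≫ θ

end Condensation

end

end OpCond

/-! The condensation is a coendomorphism operad. Writing the class of p ⊗ d₁ ⊗ ⋯ ⊗ dₖ in the coend
E_T(δ)(i) as [p; d], the multiplication of P induces maps E_S(E_{T₁}(δ), …, E_{Tₙ}(δ)) → E_T(δ),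
sending [q; [p₁; d¹], …] to [q(p₁, …); d¹, d², …]. An element of Coend(T) is a natural
transformation δ → E_T(δ), and two such compose through these maps. If A is an algebra, then [p; d]
↦ p ∘ D_T(ev(d₁), …, ev(dₖ)) is a well-defined map from E_T(δ)(i) to maps D_T(Tot, …, Tot) → A(c,
i). Thus q in Coend(T) yields, for each d in δ(c, i), the map attached to q(d). These form a wedge
in i, so they factor uniquely through Tot. Operad axioms, algebra axioms and naturality are then
checked by evaluating ends and testing coends on classes [p; d], where they reduce to associativity
and units of P and to the algebra axioms of A.

Such an argument needs elements, which objects of V do not have. For a family X of objects of V, an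
element of Y over X is here a map to Y from a bracketed tensor word in X, modulo canonical maps
between words. These elements form a lax symmetric monoidal functor in Y, and every structural map
acts on tensor products of elements by the expected formula. By `Shape.hom_ext`, maps out of an
iterated tensor product may be compared on tensor products of elements. The reason is that there are
generic elements, in which each leaf is its own letter: equality there gives a canonical
endomorphism of a word without repetitions, and this is the identity by the coherence theorem
`IsCanonical.eq_id`. Coherence is proved by inserting the letters of a word one after the other into
a list. Precomposing an insertion with a canonical map gives an insertion again, and insertions into
a list without repetitions are determined by their source and target.

Two further points carry the argument. The tensor product of the inner convolution products must
again be a coend (`isCoend_tens`). This holds because V is closed and because the identities of U(P)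
make the relations reflexive. Moreover, fibres of fibres and fibres of identities are equal to other
objects, but not definitionally so; elements are therefore transported along these equalities and
compared heterogeneously, with positions compared as natural numbers.

The central steps are `exists_multitensor` and `elMulti_assoc` for the structure on convolution
products, `elNu_elNu` for composition of natural transformations, and `elEvalConv_elMu` with
`IsAction.elEvalConv_elNu` for the action on totalizations. -/

namespace OpCond

noncomputable section

/-! ### Coherence for symmetric monoidal categories -/

section Coherence

/-- Bracketed words with letters in `ι`. -/
inductive Word (ι : Type) : Type
  | one : Word ι
  | of : ι → Word ι
  | mul : Word ι → Word ι → Word ι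

namespace Word

variable {ι : Type}

/-- The list of letters of a word. -/
def letters : Word ι → List ι
  | one => []
  | of i => [i]
  | mul a b => a.letters ++ b.letters

end Word

variable {V : Type u} [Category.{v} V] [MonoidalCategory V] {ι : Type}

/-- The tensor product of a word. -/
def Word.eval (X : ι → V) : Word ι → V
  | .one => 𝟙_ V
  | .of i => X i
  | .mul a b => a.eval X ⊗ b.eval X

/-- The right-bracketed tensor product of a list. -/
def evalList (X : ι → V) : List ι → V
  | [] => 𝟙_ V
  | a :: l => X a ⊗ evalList X l

variable [SymmetricCategory V]

variable (X : ι → V)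

/-- Canonical maps between words. -/
inductive IsCanonical : (a b : Word ι) → (a.eval X ⟶ b.eval X) → Prop
  | id (a : Word ι) : IsCanonical a a (𝟙 _)
  | comp {a b c : Word ι} {f : a.eval X ⟶ b.eval X} {g : b.eval X ⟶ c.eval X} :
      IsCanonical a b f → IsCanonical b c g → IsCanonical a c (f ≫ g)
  | tensor {a b a' b' : Word ι} {f : a.eval X ⟶ a'.eval X} {g : b.eval X ⟶ b'.eval X} :
      IsCanonical a a' f → IsCanonical b b' g → IsCanonical (.mul a b) (.mul a' b') (f ⊗ₘ g)
  | assoc_hom (a b c : Word ι) :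
      IsCanonical (.mul (.mul a b) c) (.mul a (.mul b c)) (α_ (a.eval X) (b.eval X) (c.eval X)).hom
  | assoc_inv (a b c : Word ι) :
      IsCanonical (.mul a (.mul b c)) (.mul (.mul a b) c) (α_ (a.eval X) (b.eval X) (c.eval X)).inv
  | left_hom (a : Word ι) : IsCanonical (.mul .one a) a (λ_ (a.eval X)).hom
  | left_inv (a : Word ι) : IsCanonical a (.mul .one a) (λ_ (a.eval X)).inv
  | right_hom (a : Word ι) : IsCanonical (.mul a .one) a (ρ_ (a.eval X)).hom
  | right_inv (a : Word ι) : IsCanonical a (.mul a .one) (ρ_ (a.eval X)).inv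
  | braid (a b : Word ι) : IsCanonical (.mul a b) (.mul b a) (β_ (a.eval X) (b.eval X)).hom

/-- The generators come in mutually inverse pairs. For the braiding this is where symmetry is
needed: the inverse of a braiding is again a braiding. -/
theorem IsCanonical.exists_inv {a b : Word ι} {f : a.eval X ⟶ b.eval X}
    (h : IsCanonical X a b f) : ∃ g, IsCanonical X b a g ∧ f ≫ g = 𝟙 _ ∧ g ≫ f = 𝟙 _ := by
  induction h with
  | id a => exact ⟨_, .id a, by simp, by simp⟩
  | comp _ _ h₁ h₂ =>
    obtain ⟨g₁, c₁, e₁, e₁'⟩ := h₁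
    obtain ⟨g₂, c₂, e₂, e₂'⟩ := h₂
    exact ⟨_, .comp c₂ c₁, by simp [reassoc_of% e₂, e₁], by simp [reassoc_of% e₁', e₂']⟩
  | tensor _ _ h₁ h₂ =>
    obtain ⟨g₁, c₁, e₁, e₁'⟩ := h₁
    obtain ⟨g₂, c₂, e₂, e₂'⟩ := h₂
    exact ⟨_, .tensor c₁ c₂, by simp [Word.eval, e₁, e₂], by simp [Word.eval, e₁', e₂']⟩
  | assoc_hom a b c => exact ⟨_, .assoc_inv a b c, by simp [Word.eval], by simp [Word.eval]⟩
  | assoc_inv a b c => exact ⟨_, .assoc_hom a b c, by simp [Word.eval], by simp [Word.eval]⟩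
  | left_hom a => exact ⟨_, .left_inv a, by simp [Word.eval], by simp [Word.eval]⟩
  | left_inv a => exact ⟨_, .left_hom a, by simp [Word.eval], by simp [Word.eval]⟩
  | right_hom a => exact ⟨_, .right_inv a, by simp [Word.eval], by simp [Word.eval]⟩
  | right_inv a => exact ⟨_, .right_hom a, by simp [Word.eval], by simp [Word.eval]⟩
  | braid a b => exact ⟨_, .braid b a, by simp [Word.eval], by simp [Word.eval]⟩

/-- Insertion of a letter into a list. -/
inductive Insertion (a : ι) :
    (l l' : List ι) → (X a ⊗ evalList X l ⟶ evalList X l') → Prop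
  | here (l : List ι) : Insertion a l (a :: l) (𝟙 _)
  | there (b : ι) {l l' : List ι} {f : X a ⊗ evalList X l ⟶ evalList X l'} :
      Insertion a l l' f → Insertion a (b :: l) (b :: l')
        ((α_ (X a) (X b) (evalList X l)).inv ≫ (β_ (X a) (X b)).hom ▷ evalList X l ≫
          (α_ (X b) (X a) (evalList X l)).hom ≫ X b ◁ f)

/-- Insertion of the letters of a word into a list. -/
inductive Insertions :
    (a : Word ι) → (l l' : List ι) → (a.eval X ⊗ evalList X l ⟶ evalList X l') → Prop
  | one (l : List ι) : Insertions .one l l (λ_ _).hom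
  | of {a : ι} {l l' : List ι} {f : X a ⊗ evalList X l ⟶ evalList X l'} :
      Insertion X a l l' f → Insertions (.of a) l l' f
  | mul {a b : Word ι} {l l₁ l₂ : List ι} {f : b.eval X ⊗ evalList X l ⟶ evalList X l₁}
      {g : a.eval X ⊗ evalList X l₁ ⟶ evalList X l₂} :
      Insertions b l l₁ f → Insertions a l₁ l₂ g → Insertions (.mul a b) l l₂
        ((α_ (a.eval X) (b.eval X) (evalList X l)).hom ≫ a.eval X ◁ f ≫ g)

variable {X}

theorem Insertion.mem {a : ι} {l l' : List ι} {f} (h : Insertion X a l l' f) : a ∈ l' := by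
  induction h with
  | here l => simp
  | there b _ ih => simp [ih]

/-- Without repetitions, the list before an insertion can be recovered from the list after it. -/
theorem Insertion.eq_erase [DecidableEq ι] {a : ι} {l l' : List ι} {f}
    (h : Insertion X a l l' f) (hl : l'.Nodup) : l = l'.erase a := by
  induction h with
  | here l => simp
  | there b h ih =>
    have hb : b ≠ a := by
      rintro rfl
      exact (List.nodup_cons.1 hl).1 h.mem
    rw [List.erase_cons_tail (by simpa using hb), ← ih (List.nodup_cons.1 hl).2]

/-- The target list fixes where the letter lands, as there is no second occurrence of it, and so
fixes the chain of adjacent swaps that carries it there. -/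
theorem Insertion.unique {a : ι} {l l' : List ι} {f g} (h : Insertion X a l l' f)
    (h' : Insertion X a l l' g) (hl : l'.Nodup) : f = g := by
  induction h with
  | here l =>
    cases h' with
    | here => rfl
    | there _ h' => exact absurd h'.mem (List.nodup_cons.1 hl).1
  | there b h ih =>
    cases h' with
    | here => exact absurd h.mem (List.nodup_cons.1 hl).1
    | there _ h' => rw [ih h' (List.nodup_cons.1 hl).2]

theorem Insertion.sublist {a : ι} {l l' : List ι} {f} (h : Insertion X a l l' f) :
    l.Sublist l' := by
  induction h with
  | here l => simp
  | there b _ ih => simpa using ih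

theorem Insertions.sublist {a : Word ι} {l l' : List ι} {f} (h : Insertions X a l l' f) :
    l.Sublist l' := by
  induction h with
  | one l => simp
  | of h => exact h.sublist
  | mul _ _ h₁ h₂ => exact h₁.trans h₂

/-- For a product of words the intermediate list is not visible in the source and target. The
erasing function depends only on the word, so two derivations with the same target have the same
intermediate list. -/
theorem Insertions.exists_erase [DecidableEq ι] (a : Word ι) :
    ∃ e : List ι → List ι, ∀ {l l' : List ι} {f}, Insertions X a l l' f → l'.Nodup → l = e l' := by
  induction a with
  | one => exact ⟨id, fun h _ => by cases h; rfl⟩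
  | of i => exact ⟨fun l => l.erase i, fun h hl => by cases h with | of h => exact h.eq_erase hl⟩
  | mul a b ha hb =>
    obtain ⟨e, he⟩ := ha
    obtain ⟨e', he'⟩ := hb
    refine ⟨e' ∘ e, fun h hl => ?_⟩
    cases h with
    | mul h₁ h₂ =>
      rw [he' h₁ (hl.sublist h₂.sublist), he h₂ hl]
      rfl

theorem Insertions.unique {a : Word ι} {l l' : List ι} {f g} (h : Insertions X a l l' f)
    (h' : Insertions X a l l' g) (hl : l'.Nodup) : f = g := by
  classical
  induction h with
  | one l => cases h'; rfl
  | of h => cases h' with | of h' => exact h.unique h' hl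
  | mul h₁ h₂ ih₁ ih₂ =>
    cases h' with
    | mul h₁' h₂' =>
      obtain ⟨e, he⟩ := Insertions.exists_erase (X := X) _
      have := (he h₂ hl).trans (he h₂' hl).symm
      subst this
      rw [ih₁ h₁' (hl.sublist h₂.sublist), ih₂ h₂' hl]

/-- Putting every letter at the head needs no swaps, so only associators, unitors and identities
occur. The target is a variable with an equation, which avoids transporting the map along
associativity of `++`. -/
theorem Insertions.exists_isIso (a : Word ι) (l : List ι) :
    ∃ l', l' = a.letters ++ l ∧ ∃ f, Insertions X a l l' f ∧ IsIso f := by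
  induction a generalizing l with
  | one => exact ⟨l, rfl, _, .one l, inferInstanceAs (IsIso (λ_ (evalList X l)).hom)⟩
  | of i => exact ⟨_, rfl, _, .of (.here l), inferInstanceAs (IsIso (𝟙 _))⟩
  | mul a b ha hb =>
    obtain ⟨l₁, h₁, f, hf, _⟩ := hb l
    obtain ⟨l₂, h₂, g, hg, _⟩ := ha l₁
    exact ⟨l₂, by rw [h₂, h₁, Word.letters, List.append_assoc], _, .mul hf hg,
      inferInstanceAs (IsIso ((α_ (a.eval X) (b.eval X) (evalList X l)).hom ≫ _))⟩

/-- The Yang–Baxter equation with a spectator `L`, in the bracketing produced by moving a letter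
past the head of a list. -/
theorem yang_baxter_right (A B C L : V) :
    (α_ A B (C ⊗ L)).hom ≫
      A ◁ ((α_ B C L).inv ≫ (β_ B C).hom ▷ L ≫ (α_ C B L).hom) ≫
      ((α_ A C (B ⊗ L)).inv ≫ (β_ A C).hom ▷ (B ⊗ L) ≫ (α_ C A (B ⊗ L)).hom) ≫
      C ◁ ((α_ A B L).inv ≫ (β_ A B).hom ▷ L ≫ (α_ B A L).hom) =
    (β_ A B).hom ▷ (C ⊗ L) ≫ (α_ B A (C ⊗ L)).hom ≫
      B ◁ ((α_ A C L).inv ≫ (β_ A C).hom ▷ L ≫ (α_ C A L).hom) ≫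
      ((α_ B C (A ⊗ L)).inv ≫ (β_ B C).hom ▷ (A ⊗ L) ≫ (α_ C B (A ⊗ L)).hom) := by
  have h := congrArg (· ▷ L) (BraidedCategory.yang_baxter A B C)
  calc _ = (α_ A B (C ⊗ L)).hom ≫ A ◁ (α_ B C L).inv ≫ (α_ A (B ⊗ C) L).inv ≫
        (A ◁ (β_ B C).hom ≫ (α_ A C B).inv ≫ (β_ A C).hom ▷ B ≫ (α_ C A B).hom ≫
          C ◁ (β_ A B).hom) ▷ L ≫ (α_ C (B ⊗ A) L).hom ≫ C ◁ (α_ B A L).hom := by monoidal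
    _ = _ := by rw [← h]; monoidal

theorem swap_left_naturality (A B : V) {L L' : V} (h : L ⟶ L') :
    A ◁ B ◁ h ≫ (α_ A B L').inv ≫ (β_ A B).hom ▷ L' ≫ (α_ B A L').hom =
      (α_ A B L).inv ≫ (β_ A B).hom ▷ L ≫ (α_ B A L).hom ≫ B ◁ A ◁ h := by
  rw [associator_inv_naturality_right_assoc, whisker_exchange_assoc, associator_naturality_right]

/-- Two letters can be inserted in either order at the cost of a braiding. If one of them stays at
the head, naturality or the symmetry of the braiding suffices; if both pass the head `c`, the two
ways of crossing the three letters agree by the Yang–Baxter equation. -/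
theorem Insertion.exchange {a b : ι} {l l₁ l₂ : List ι} {f g} (hf : Insertion X a l l₁ f)
    (hg : Insertion X b l₁ l₂ g) : ∃ l' f' g', Insertion X b l l' f' ∧ Insertion X a l' l₂ g' ∧
      (α_ (X a) (X b) (evalList X l)).hom ≫ X a ◁ f' ≫ g' =
        (β_ (X a) (X b)).hom ▷ evalList X l ≫ (α_ (X b) (X a) (evalList X l)).hom ≫
          X b ◁ f ≫ g := by
  induction hg generalizing l with
  | here l₁ =>
    refine ⟨_, _, _, .here l, .there b hf, ?_⟩
    simp [evalList]
  | @there c l₁ l₂ g hg ih =>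
    cases hf with
    | here =>
      refine ⟨_, _, _, hg, .here _, ?_⟩
      simp only [evalList, Category.comp_id, MonoidalCategory.whiskerLeft_id, Category.id_comp,
        Iso.hom_inv_id_assoc, ← comp_whiskerRight_assoc, SymmetricCategory.symmetry]
      simp
    | @there _ l _ f hf =>
      obtain ⟨l', f', g', hf', hg', e⟩ := ih hf
      refine ⟨_, _, _, .there c hf', .there c hg', ?_⟩
      have e' : X a ◁ f' ≫ g' = ((α_ (X a) (X b) (evalList X l)).inv ≫
          (β_ (X a) (X b)).hom ▷ evalList X l ≫ (α_ (X b) (X a) (evalList X l)).hom) ≫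
          X b ◁ f ≫ g := by
        rw [Category.assoc, Category.assoc, ← e, Iso.inv_hom_id_assoc]
      have h₂ := yang_baxter_right (X a) (X b) (X c) (evalList X l)
      have h₃ := swap_left_naturality (X a) (X c) f'
      have h₄ := swap_left_naturality (X b) (X c) f
      have e'' := congrArg (X c ◁ ·) e'
      simp only [evalList, MonoidalCategory.whiskerLeft_comp, Category.assoc] at h₂ h₃ h₄ e'' ⊢
      rw [reassoc_of% h₃, e'', reassoc_of% h₂, reassoc_of% h₄]

/-- The hexagon splits the braiding of `A` past `B ⊗ C` into the two braidings that occur in `e` and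
`e'`. -/
theorem exchange_mul_right {A B C L L' L'' L₀ L₁ L₂ : V} {f : A ⊗ L ⟶ L₀} {g : C ⊗ L₀ ⟶ L₁}
    {h : B ⊗ L₁ ⟶ L₂} {f' : C ⊗ L ⟶ L'} {g' : A ⊗ L' ⟶ L₁} {f'' : B ⊗ L' ⟶ L''}
    {g'' : A ⊗ L'' ⟶ L₂}
    (e : (α_ A C L).hom ≫ A ◁ f' ≫ g' = (β_ A C).hom ▷ L ≫ (α_ C A L).hom ≫ C ◁ f ≫ g)
    (e' : (α_ A B L').hom ≫ A ◁ f'' ≫ g'' = (β_ A B).hom ▷ L' ≫ (α_ B A L').hom ≫ B ◁ g' ≫ h) :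
    (α_ A (B ⊗ C) L).hom ≫ A ◁ ((α_ B C L).hom ≫ B ◁ f' ≫ f'') ≫ g'' =
      (β_ A (B ⊗ C)).hom ▷ L ≫ (α_ (B ⊗ C) A L).hom ≫ (B ⊗ C) ◁ f ≫
        (α_ B C L₀).hom ≫ B ◁ g ≫ h := by
  have k := congrArg (B ◁ ·) e
  have s := swap_left_naturality A B f'
  have hx := congrArg (· ▷ L) (BraidedCategory.hexagon_forward A B C)
  have k' : A ◁ f'' ≫ g'' =
      (α_ A B L').inv ≫ (β_ A B).hom ▷ L' ≫ (α_ B A L').hom ≫ B ◁ g' ≫ h := by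
    rw [← e', Iso.inv_hom_id_assoc]
  simp only [MonoidalCategory.whiskerLeft_comp] at k
  have hx' : (α_ A (B ⊗ C) L).hom ≫ A ◁ (α_ B C L).hom ≫ (α_ A B (C ⊗ L)).inv ≫
      (β_ A B).hom ▷ (C ⊗ L) ≫ (α_ B A (C ⊗ L)).hom ≫ B ◁ (α_ A C L).inv ≫
        B ◁ (β_ A C).hom ▷ L ≫ B ◁ (α_ C A L).hom =
      (β_ A (B ⊗ C)).hom ▷ L ≫ (α_ (B ⊗ C) A L).hom ≫ (α_ B C (A ⊗ L)).hom := by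
    calc _ = (α_ A B C).inv ▷ L ≫ ((α_ A B C).hom ≫ (β_ A (B ⊗ C)).hom ≫ (α_ B C A).hom) ▷ L ≫
          (α_ B (C ⊗ A) L).hom ≫ B ◁ (α_ C A L).hom := by rw [hx]; monoidal
      _ = _ := by monoidal
  have k₂ : B ◁ A ◁ f' ≫ B ◁ g' = B ◁ (α_ A C L).inv ≫ B ◁ (β_ A C).hom ▷ L ≫
      B ◁ (α_ C A L).hom ≫ B ◁ C ◁ f ≫ B ◁ g := by
    rw [← k, ← MonoidalCategory.whiskerLeft_comp_assoc, Iso.inv_hom_id]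
    simp
  simp only [MonoidalCategory.whiskerLeft_comp, Category.assoc]
  rw [k', reassoc_of% s, reassoc_of% k₂, reassoc_of% hx', tensor_whiskerLeft]
  simp

/-- As the braiding is symmetric, the two exchange equations can be read backwards; this turns the
claim into `exchange_mul_right`. -/
theorem exchange_mul_left {A B C L L' L'' L₀ L₁ L₂ : V} {f : C ⊗ L ⟶ L₀} {g : B ⊗ L₀ ⟶ L₁}
    {h : A ⊗ L₁ ⟶ L₂} {f' : A ⊗ L₀ ⟶ L'} {g' : B ⊗ L' ⟶ L₂} {f'' : A ⊗ L ⟶ L''}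
    {g'' : C ⊗ L'' ⟶ L'}
    (e : (α_ B A L₀).hom ≫ B ◁ f' ≫ g' = (β_ B A).hom ▷ L₀ ≫ (α_ A B L₀).hom ≫ A ◁ g ≫ h)
    (e' : (α_ C A L).hom ≫ C ◁ f'' ≫ g'' = (β_ C A).hom ▷ L ≫ (α_ A C L).hom ≫ A ◁ f ≫ f') :
    (α_ (B ⊗ C) A L).hom ≫ (B ⊗ C) ◁ f'' ≫ (α_ B C L'').hom ≫ B ◁ g'' ≫ g' =
      (β_ (B ⊗ C) A).hom ▷ L ≫ (α_ A (B ⊗ C) L).hom ≫ A ◁ ((α_ B C L).hom ≫ B ◁ f ≫ g) ≫ h := by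
  have e₁ : (α_ A B L₀).hom ≫ A ◁ g ≫ h =
      (β_ A B).hom ▷ L₀ ≫ (α_ B A L₀).hom ≫ B ◁ f' ≫ g' := by
    rw [e, ← comp_whiskerRight_assoc, SymmetricCategory.symmetry]
    simp
  have e₂ : (α_ A C L).hom ≫ A ◁ f ≫ f' =
      (β_ A C).hom ▷ L ≫ (α_ C A L).hom ≫ C ◁ f'' ≫ g'' := by
    rw [e', ← comp_whiskerRight_assoc, SymmetricCategory.symmetry]
    simp
  rw [exchange_mul_right e₂ e₁, ← comp_whiskerRight_assoc, SymmetricCategory.symmetry]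
  simp

theorem Insertions.exchange_insertion {a : ι} {b : Word ι} {l l₁ l₂ : List ι} {f g}
    (hf : Insertion X a l l₁ f) (hg : Insertions X b l₁ l₂ g) :
    ∃ l' f' g', Insertions X b l l' f' ∧ Insertion X a l' l₂ g' ∧
      (α_ (X a) (b.eval X) (evalList X l)).hom ≫ X a ◁ f' ≫ g' =
        (β_ (X a) (b.eval X)).hom ▷ evalList X l ≫ (α_ (b.eval X) (X a) (evalList X l)).hom ≫
          b.eval X ◁ f ≫ g := by
  induction hg generalizing l with
  | one l₁ =>
    refine ⟨_, _, _, .one l, hf, ?_⟩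
    simp [Word.eval]
  | of hg =>
    obtain ⟨l', f', g', hf', hg', e⟩ := hf.exchange hg
    exact ⟨_, _, _, .of hf', hg', e⟩
  | @mul b c l₀ l₁ l₂ g h h₁ h₂ ih₁ ih₂ =>
    obtain ⟨l', f', g', hf', hg', e⟩ := ih₁ hf
    obtain ⟨l'', f'', g'', hf'', hg'', e'⟩ := ih₂ hg'
    refine ⟨_, _, _, .mul hf' hf'', hg'', ?_⟩
    exact exchange_mul_right e e'

theorem Insertions.exchange {a b : Word ι} {l l₁ l₂ : List ι} {f g}
    (hf : Insertions X a l l₁ f) (hg : Insertions X b l₁ l₂ g) :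
    ∃ l' f' g', Insertions X b l l' f' ∧ Insertions X a l' l₂ g' ∧
      (α_ (a.eval X) (b.eval X) (evalList X l)).hom ≫ a.eval X ◁ f' ≫ g' =
        (β_ (a.eval X) (b.eval X)).hom ▷ evalList X l ≫
          (α_ (b.eval X) (a.eval X) (evalList X l)).hom ≫ b.eval X ◁ f ≫ g := by
  induction hf generalizing l₂ with
  | one l₁ =>
    refine ⟨_, _, _, hg, .one l₂, ?_⟩
    simp [Word.eval]
  | of hf =>
    obtain ⟨l', f', g', hf', hg', e⟩ := exchange_insertion hf hg
    exact ⟨_, _, _, hf', .of hg', e⟩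
  | @mul b c l₀ l₁ l₂ g h h₁ h₂ ih₁ ih₂ =>
    obtain ⟨l', f', g', hf', hg', e⟩ := ih₂ hg
    obtain ⟨l'', f'', g'', hf'', hg'', e'⟩ := ih₁ hf'
    exact ⟨_, _, _, hf'', .mul hg'' hg', exchange_mul_left e e'⟩

/-- This is the invariant behind coherence: precomposition with a canonical map preserves
insertions. It is enough to check generators. Associators and unitors only rebracket the derivation,
and the braiding is the exchange property. -/
theorem IsCanonical.insertions {a b : Word ι} {c} (h : IsCanonical X a b c) {l l' : List ι} {f}
    (hf : Insertions X b l l' f) : ∃ g, Insertions X a l l' g ∧ g = c ▷ evalList X l ≫ f := by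
  induction h generalizing l l' with
  | id a => exact ⟨f, hf, by simp⟩
  | comp _ _ h₁ h₂ =>
    obtain ⟨g, hg, e⟩ := h₂ hf
    obtain ⟨g', hg', e'⟩ := h₁ hg
    exact ⟨g', hg', by simp [e', e]⟩
  | tensor _ _ h₁ h₂ =>
    cases hf with
    | mul k₁ k₂ =>
      obtain ⟨g, hg, e⟩ := h₂ k₁
      obtain ⟨g', hg', e'⟩ := h₁ k₂
      refine ⟨_, .mul hg hg', ?_⟩
      rw [e, e']
      simp only [Word.eval, tensorHom_def', comp_whiskerRight, MonoidalCategory.whiskerLeft_comp,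
        Category.assoc, whisker_assoc, Iso.inv_hom_id_assoc, associator_naturality_left_assoc,
        whisker_exchange_assoc]
  | assoc_hom a b c =>
    cases hf with
    | mul k₁ k₂ =>
      cases k₁ with
      | mul k₁ k₁' =>
        refine ⟨_, .mul k₁ (.mul k₁' k₂), ?_⟩
        simp [Word.eval]
  | assoc_inv a b c =>
    cases hf with
    | mul k₁ k₂ =>
      cases k₂ with
      | mul k₂ k₂' =>
        refine ⟨_, .mul (.mul k₁ k₂) k₂', ?_⟩
        simp [Word.eval]
  | left_hom a =>
    refine ⟨_, .mul hf (.one _), ?_⟩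
    simp [Word.eval]
  | left_inv a =>
    cases hf with
    | mul k₁ k₂ =>
      cases k₂
      refine ⟨_, k₁, ?_⟩
      simp [Word.eval]
  | right_hom a =>
    refine ⟨_, .mul (.one _) hf, ?_⟩
    simp [Word.eval]
  | right_inv a =>
    cases hf with
    | mul k₁ k₂ =>
      cases k₁
      refine ⟨_, k₂, ?_⟩
      simp [Word.eval]
  | braid a b =>
    cases hf with
    | mul k₁ k₂ =>
      obtain ⟨l', f', g', hf', hg', e⟩ := k₁.exchange k₂
      exact ⟨_, .mul hf' hg', e⟩

/-- Coherence: the only canonical endomorphism of a word without repeated letters is the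
identity. -/
theorem IsCanonical.eq_id {a : Word ι} {c} (h : IsCanonical X a a c) (ha : a.letters.Nodup) :
    c = 𝟙 _ := by
  obtain ⟨l', hl, f, hf, _⟩ := Insertions.exists_isIso (X := X) a []
  obtain ⟨g, hg, e⟩ := h.insertions hf
  -- The canonical map followed by the insertion `f` is itself an insertion between the same lists,
  -- hence equals `f`. Since `f` is invertible it cancels, and the remaining unit factor is removed
  -- by the right unitor.
  have hfg := hg.unique hf (by simpa [hl] using ha)
  rw [hfg] at e
  have e₂ : c ▷ evalList X [] = 𝟙 _ := by
    rw [← cancel_mono f, ← e, Category.id_comp]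
  change c ▷ 𝟙_ V = 𝟙 (_ ⊗ 𝟙_ V) at e₂
  rw [← cancel_epi (ρ_ _).hom, ← rightUnitor_naturality, e₂]
  simp

end Coherence

/-! ### Generalized elements -/

section Elements

variable {V : Type u} [Category.{v} V] [MonoidalCategory V] [SymmetricCategory V]
  {ι : Type} {X : ι → V}

/-- Maps out of tensor products of words, up to canonical maps. -/
def elSetoid (X : ι → V) (Y : V) : Setoid (Σ a : Word ι, a.eval X ⟶ Y) where
  r p q := ∃ c, IsCanonical X p.1 q.1 c ∧ p.2 = c ≫ q.2
  iseqv :=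
    { refl p := ⟨_, .id _, by simp⟩
      symm := by
        rintro p q ⟨c, hc, e⟩
        obtain ⟨c', hc', -, e'⟩ := hc.exists_inv
        exact ⟨c', hc', by rw [e, reassoc_of% e']⟩
      trans := by
        rintro p q r ⟨c, hc, e⟩ ⟨c', hc', e'⟩
        exact ⟨_, hc.comp hc', by rw [e, e', Category.assoc]⟩ }

/-- The elements of `Y` over the frame `X`. They form a lax symmetric monoidal functor. -/
def El (X : ι → V) (Y : V) : Type v := Quotient (elSetoid X Y)

namespace El

/-- The element given by a map out of a word. -/
def mk {Y : V} (a : Word ι) (f : a.eval X ⟶ Y) : El X Y := Quotient.mk (elSetoid X Y) ⟨a, f⟩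

theorem sound {Y : V} {a b : Word ι} {f : a.eval X ⟶ Y} {g : b.eval X ⟶ Y} {c}
    (hc : IsCanonical X a b c) (h : f = c ≫ g) : mk a f = mk b g :=
  Quotient.sound ⟨c, hc, h⟩

theorem exists_mk {Y : V} (x : El X Y) : ∃ a f, x = mk a f := by
  obtain ⟨⟨a, f⟩⟩ := x
  exact ⟨a, f, rfl⟩

/-- The action of morphisms on elements. -/
def map {Y Z : V} (f : Y ⟶ Z) : El X Y → El X Z :=
  Quotient.map (fun p => ⟨p.1, p.2 ≫ f⟩) (by
    rintro p q ⟨c, hc, e⟩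
    exact ⟨c, hc, by simp [e]⟩)

/-- The tensor product of elements. -/
def tmul {Y Z : V} : El X Y → El X Z → El X (Y ⊗ Z) :=
  Quotient.map₂ (fun p q => ⟨.mul p.1 q.1, p.2 ⊗ₘ q.2⟩) (by
    rintro p q ⟨c, hc, e⟩ p' q' ⟨c', hc', e'⟩
    exact ⟨_, hc.tensor hc', by simp [e, e', Word.eval]⟩)

/-- The unit element. -/
def one : El X (𝟙_ V) := mk .one (𝟙 _)

infixr:75 " ⊳ " => El.map
infixr:77 " ⊠ " => El.tmul

@[simp] theorem map_mk {Y Z : V} (f : Y ⟶ Z) (a : Word ι) (g : a.eval X ⟶ Y) :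
    f ⊳ mk a g = mk a (g ≫ f) := rfl

@[simp] theorem tmul_mk {Y Z : V} (a b : Word ι) (f : a.eval X ⟶ Y) (g : b.eval X ⟶ Z) :
    mk a f ⊠ mk b g = mk (.mul a b) (f ⊗ₘ g) := rfl

@[simp] theorem map_id {Y : V} (x : El X Y) : 𝟙 Y ⊳ x = x := by
  obtain ⟨a, f, rfl⟩ := x.exists_mk
  simp

@[simp] theorem map_comp {Y Z W : V} (f : Y ⟶ Z) (g : Z ⟶ W) (x : El X Y) :
    f ≫ g ⊳ x = g ⊳ f ⊳ x := by
  obtain ⟨a, k, rfl⟩ := x.exists_mk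
  simp

@[simp] theorem map_tensorHom {Y Z Y' Z' : V} (f : Y ⟶ Y') (g : Z ⟶ Z') (x : El X Y) (y : El X Z) :
    (f ⊗ₘ g) ⊳ x ⊠ y = (f ⊳ x) ⊠ (g ⊳ y) := by
  obtain ⟨a, k, rfl⟩ := x.exists_mk
  obtain ⟨b, l, rfl⟩ := y.exists_mk
  simp only [tmul_mk, map_mk, ← tensorHom_comp_tensorHom]
  rfl

@[simp] theorem map_whiskerRight {Y Z Y' : V} (f : Y ⟶ Y') (x : El X Y) (y : El X Z) :
    (f ▷ Z) ⊳ x ⊠ y = (f ⊳ x) ⊠ y := by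
  rw [← tensorHom_id, map_tensorHom, map_id]

@[simp] theorem map_whiskerLeft {Y Z Z' : V} (g : Z ⟶ Z') (x : El X Y) (y : El X Z) :
    (Y ◁ g) ⊳ x ⊠ y = x ⊠ (g ⊳ y) := by
  rw [← id_tensorHom, map_tensorHom, map_id]

-- By naturality the associator may be moved to the words, where it is canonical and so disappears
-- in the quotient. Unitors and braidings are treated alike.
@[simp] theorem map_associator_hom {Y Z W : V} (x : El X Y) (y : El X Z) (z : El X W) :
    (α_ Y Z W).hom ⊳ (x ⊠ y) ⊠ z = x ⊠ y ⊠ z := by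
  obtain ⟨a, f, rfl⟩ := x.exists_mk
  obtain ⟨b, g, rfl⟩ := y.exists_mk
  obtain ⟨c, h, rfl⟩ := z.exists_mk
  exact sound (.assoc_hom a b c) (associator_naturality f g h)

@[simp] theorem map_associator_inv {Y Z W : V} (x : El X Y) (y : El X Z) (z : El X W) :
    (α_ Y Z W).inv ⊳ x ⊠ y ⊠ z = (x ⊠ y) ⊠ z := by
  rw [← map_associator_hom, ← map_comp, Iso.hom_inv_id, map_id]

@[simp] theorem map_leftUnitor_hom {Y : V} (x : El X Y) : (λ_ Y).hom ⊳ one ⊠ x = x := by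
  obtain ⟨a, f, rfl⟩ := x.exists_mk
  refine sound (.left_hom a) ?_
  change (𝟙 _ ⊗ₘ f) ≫ _ = _
  rw [id_tensorHom]
  exact leftUnitor_naturality f

@[simp] theorem map_leftUnitor_inv {Y : V} (x : El X Y) : (λ_ Y).inv ⊳ x = one ⊠ x := by
  rw [← map_leftUnitor_hom x, ← map_comp, Iso.hom_inv_id, map_id, map_leftUnitor_hom]

@[simp] theorem map_rightUnitor_hom {Y : V} (x : El X Y) : (ρ_ Y).hom ⊳ x ⊠ one = x := by
  obtain ⟨a, f, rfl⟩ := x.exists_mk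
  refine sound (.right_hom a) ?_
  change (f ⊗ₘ 𝟙 _) ≫ _ = _
  rw [tensorHom_id]
  exact rightUnitor_naturality f

@[simp] theorem map_rightUnitor_inv {Y : V} (x : El X Y) : (ρ_ Y).inv ⊳ x = x ⊠ one := by
  rw [← map_rightUnitor_hom x, ← map_comp, Iso.hom_inv_id, map_id, map_rightUnitor_hom]

@[simp] theorem map_braiding_hom {Y Z : V} (x : El X Y) (y : El X Z) :
    (β_ Y Z).hom ⊳ x ⊠ y = y ⊠ x := by
  obtain ⟨a, f, rfl⟩ := x.exists_mk
  obtain ⟨b, g, rfl⟩ := y.exists_mk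
  exact sound (.braid a b) (BraidedCategory.braiding_naturality f g)

/-- The tensor product of a finite family of elements. -/
def tprod : {n : ℕ} → {Y : Fin n → V} → (∀ i, El X (Y i)) → El X (tens Y)
  | 0, _, _ => one
  | _ + 1, _, x => x 0 ⊠ tprod fun i => x i.succ

theorem tprod_succ {n : ℕ} {Y : Fin (n + 1) → V} (x : ∀ i, El X (Y i)) :
    tprod x = x 0 ⊠ tprod fun i => x i.succ := rfl

@[simp] theorem map_tensMap {n : ℕ} {Y Z : Fin n → V} (f : ∀ i, Y i ⟶ Z i)
    (x : ∀ i, El X (Y i)) : tensMap f ⊳ tprod x = tprod fun i => f i ⊳ x i := by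
  induction n with
  | zero => exact map_id _
  | succ n ih => exact (map_tensorHom _ _ _ _).trans (by rw [ih, tprod_succ])

@[simp] theorem map_tensUnit (n : ℕ) : tensUnit n ⊳ (one : El X (𝟙_ V)) = tprod fun _ => one := by
  induction n with
  | zero => exact map_id _
  | succ n ih =>
    exact (map_comp _ _ _).trans ((congrArg _ (map_leftUnitor_inv _)).trans
      ((map_whiskerLeft _ _ _).trans (congrArg _ ih)))

@[simp] theorem map_tensCounit (n : ℕ) :
    tensCounit n ⊳ (tprod fun _ : Fin n => (one : El X (𝟙_ V))) = one := by
  induction n with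
  | zero => exact map_id _
  | succ n ih =>
    exact (map_comp _ _ _).trans <| (congrArg _ ((map_whiskerLeft _ _ _).trans (congrArg _ ih))).trans
      (map_leftUnitor_hom _)

@[simp] theorem map_tensOne {A : V} {n : ℕ} (h : n = 1) (Y : Fin n → V) (a : ∀ i, A ⟶ Y i)
    (x : El X A) : tensOne h Y a ⊳ x = tprod fun i => a i ⊳ x := by
  subst h
  exact (map_comp _ _ _).trans ((congrArg _ (map_rightUnitor_inv x)).trans (map_whiskerRight _ _ _))

theorem map_tensorμ {A B C D : V} (a : El X A) (b : El X B) (c : El X C) (d : El X D) :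
    tensorμ A B C D ⊳ (a ⊠ b) ⊠ (c ⊠ d) = (a ⊠ c) ⊠ (b ⊠ d) := by
  simp only [tensorμ, map_comp, map_associator_hom, map_associator_inv, map_whiskerLeft,
    map_whiskerRight, map_braiding_hom]

@[simp] theorem map_tensZip {n : ℕ} {Y Z : Fin n → V} (x : ∀ i, El X (Y i)) (y : ∀ i, El X (Z i)) :
    tensZip Y Z ⊳ tprod x ⊠ tprod y = tprod fun i => x i ⊠ y i := by
  induction n with
  | zero => exact map_leftUnitor_hom _
  | succ n ih =>
    exact (map_comp _ _ _).trans ((congrArg _ (map_tensorμ _ _ _ _)).trans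
      ((map_whiskerLeft _ _ _).trans (congrArg _ (ih _ _))))

theorem map_tensSwap {m n : ℕ} {Y : Fin m → Fin n → V} (x : ∀ j i, El X (Y j i)) :
    tensSwap Y ⊳ (tprod fun j => tprod fun i => x j i) = tprod fun i => tprod fun j => x j i := by
  induction m with
  | zero => exact map_tensUnit n
  | succ m ih =>
    exact (map_comp _ _ _).trans ((congrArg _ ((map_whiskerLeft _ _ _).trans
      (congrArg _ (ih fun j => x j.succ)))).trans (map_tensZip _ _))

theorem map_spread {A : V} {n : ℕ} (p : Fin n) (Y : Fin n → V) (a : A ⟶ Y p)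
    (b : ∀ i, i ≠ p → (𝟙_ V ⟶ Y i)) (x : El X A) (y : ∀ i, El X (Y i)) (hp : y p = a ⊳ x)
    (hy : ∀ i h, y i = b i h ⊳ one) : spread p Y a b ⊳ x = tprod y := by
  induction n with
  | zero => exact p.elim0
  | succ n ih =>
    induction p using Fin.cases with
    | zero =>
      refine (map_comp _ _ _).trans ?_
      rw [map_rightUnitor_inv]
      refine (map_tensorHom _ _ _ _).trans ?_
      rw [map_comp, map_tensUnit, map_tensMap, tprod_succ, hp]
      congr 2
      funext i
      exact (hy _ _).symm
    | succ q =>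
      refine (map_comp _ _ _).trans ?_
      rw [map_leftUnitor_inv]
      refine (map_tensorHom _ _ _ _).trans ?_
      rw [ih q _ a _ (fun i => y i.succ) hp (fun i h => hy i.succ _), tprod_succ, hy 0]

theorem map_collapse {A : V} {n : ℕ} (p : Fin n) (Y : Fin n → V) (a : Y p ⟶ A)
    (b : ∀ i, i ≠ p → (Y i ⟶ 𝟙_ V)) (y : ∀ i, El X (Y i)) (hy : ∀ i h, b i h ⊳ y i = one) :
    collapse p Y a b ⊳ tprod y = a ⊳ y p := by
  induction n with
  | zero => exact p.elim0
  | succ n ih =>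
    induction p using Fin.cases with
    | zero =>
      refine (map_comp _ _ _).trans ?_
      refine (congrArg _ (map_tensorHom _ _ _ _)).trans ?_
      rw [map_comp, map_tensMap, show (fun i : Fin n => b i.succ (Fin.succ_ne_zero i) ⊳ y i.succ) =
        fun _ => one from funext fun i => hy _ _, map_tensCounit, map_rightUnitor_hom]
    | succ q =>
      refine (map_comp _ _ _).trans ?_
      refine (congrArg _ (map_tensorHom _ _ _ _)).trans ?_
      rw [hy, ih q _ a _ (fun i => y i.succ) (fun i h => hy i.succ _), map_leftUnitor_hom]

/-- The definition of `tensRegroup` replaces each factor by a row with unit objects in the other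
places, transposes, and removes the units. The matrix `z` follows the elements through this: it has
`y j` at the position of `j` and the unit element elsewhere. -/
theorem map_tensRegroup {m n : ℕ} {c : Fin n → ℕ} (e : (Σ i : Fin n, Fin (c i)) ≃ Fin m)
    (Y : Fin m → V) (y : ∀ j, El X (Y j)) :
    tensRegroup e Y ⊳ tprod y = tprod fun i => tprod fun k => y (e ⟨i, k⟩) := by
  let z : ∀ (j : Fin m) (i : Fin n) (k : Fin (c i)),
      El X (if e ⟨i, k⟩ = j then Y j else 𝟙_ V) := fun j i k =>
    if h : e ⟨i, k⟩ = j then eqToHom (if_pos h).symm ⊳ y j else eqToHom (if_neg h).symm ⊳ one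
  have hz : ∀ j i k (h : e ⟨i, k⟩ = j), z j i k = eqToHom (if_pos h).symm ⊳ y j :=
    fun j i k h => dif_pos h
  have hz' : ∀ j i k (h : ¬ e ⟨i, k⟩ = j), z j i k = eqToHom (if_neg h).symm ⊳ one :=
    fun j i k h => dif_neg h
  rw [tensRegroup]
  dsimp only
  rw [map_comp, map_comp, map_tensMap]
  refine (congrArg (El.map _) (congrArg (El.map _)
    (?_ : _ = tprod fun j => tprod fun i => tprod fun k => z j i k))).trans ?_
  · congr 1
    funext j
    apply map_spread
    · symm
      apply map_spread
      · exact hz j _ _ (e.apply_symm_apply j)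
      · intro k hk
        refine hz' j _ _ fun h => hk ?_
        have h' : (⟨(e.symm j).1, k⟩ : Σ i : Fin n, Fin (c i)) = e.symm j :=
          (Equiv.eq_symm_apply e).2 h
        exact eq_of_heq (Sigma.mk.inj h').2
    · intro i hi
      rw [map_comp, map_tensUnit, map_tensMap]
      congr 1
      funext k
      exact hz' j _ _ fun h => hi (by rw [← h, e.symm_apply_apply])
  rw [map_tensSwap, map_tensMap]
  congr 1
  funext i
  rw [map_comp, map_tensSwap, map_tensMap]
  congr 1
  funext k
  rw [map_collapse]
  · rw [hz _ i k rfl, ← map_comp, eqToHom_trans, eqToHom_refl, map_id]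
  · intro j hj
    rw [hz' _ _ _ hj.symm, ← map_comp, eqToHom_trans, eqToHom_refl, map_id]

end El

end Elements

end

/-! ### Testing morphisms on generic elements -/

noncomputable section

section Elements

variable {V : Type u}

/-- Bracketings of iterated tensor products, with objects as leaves. -/
inductive Shape (V : Type u) : Type u
  | leaf : V → Shape V
  | mul : Shape V → Shape V → Shape V
  | tens (n : ℕ) : (Fin n → Shape V) → Shape V

namespace Shape

/-- The set of leaves. -/
def Leaf : Shape V → Type
  | leaf _ => Unit
  | mul s t => s.Leaf ⊕ t.Leaf
  | tens n s => Σ i : Fin n, (s i).Leaf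

/-- The object on a leaf. -/
def obj : (s : Shape V) → s.Leaf → V
  | leaf A, _ => A
  | mul s _, .inl p => s.obj p
  | mul _ t, .inr p => t.obj p
  | tens _ s, ⟨i, p⟩ => (s i).obj p

variable [Category.{v} V] [MonoidalCategory V]

/-- The tensor product of the leaves. -/
def eval : Shape V → V
  | leaf A => A
  | mul s t => s.eval ⊗ t.eval
  | tens _ s => OpCond.tens fun i => (s i).eval

variable [SymmetricCategory V] {ι : Type} (X : ι → V)

/-- Families of elements of the leaves. -/
def Fam : Shape V → Type v
  | leaf A => El X A
  | mul s t => s.Fam × t.Fam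
  | tens _ s => ∀ i, (s i).Fam

variable {X}

/-- The tensor product of a family of elements of the leaves. -/
def total : (s : Shape V) → s.Fam X → El X s.eval
  | leaf _, x => x
  | mul s t, x => s.total x.1 ⊠ t.total x.2
  | tens _ s, x => El.tprod fun i => (s i).total (x i)

/-- Words with pairwise disjoint letters multiply to a word without repetitions, and tensor products
of isomorphisms are invertible, so genericity passes to finite tensor products. -/
theorem exists_generic_tprod {n : ℕ} {Y : Fin n → V} (x : ∀ i, El X (Y i)) (a : Fin n → Word ι)
    (ha : ∀ i, (a i).letters.Nodup)
    (hd : ∀ i j, i ≠ j → (a i).letters.Disjoint (a j).letters)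
    (hx : ∀ i, ∃ f, IsIso f ∧ x i = El.mk (a i) f) :
    ∃ b : Word ι, b.letters.Nodup ∧ (∀ l ∈ b.letters, ∃ i, l ∈ (a i).letters) ∧
      ∃ f, IsIso f ∧ El.tprod x = El.mk b f := by
  induction n with
  | zero => exact ⟨.one, List.nodup_nil, by simp [Word.letters], _,
      inferInstanceAs (IsIso (𝟙 _)), rfl⟩
  | succ n ih =>
    obtain ⟨b, hb, hb', g, _, hg⟩ := ih (fun i => x i.succ) (fun i => a i.succ) (fun i => ha _)
      (fun i j h => hd _ _ fun h' => h (Fin.succ_injective _ h')) (fun i => hx _)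
    obtain ⟨f, _, hf⟩ := hx 0
    refine ⟨.mul (a 0) b, List.nodup_append'.2 ⟨ha 0, hb, fun l h h' => ?_⟩, ?_, f ⊗ₘ g,
      inferInstanceAs (IsIso (f ⊗ₘ g)), ?_⟩
    · obtain ⟨i, hi⟩ := hb' l h'
      exact hd 0 i.succ (Fin.succ_ne_zero i).symm h hi
    · intro l hl
      rcases List.mem_append.1 hl with h | h
      · exact ⟨0, h⟩
      · obtain ⟨i, hi⟩ := hb' l h
        exact ⟨_, hi⟩
    · rw [El.tprod_succ, hf, hg]
      rfl

/-- Each leaf is assigned its own letter. An arbitrary injection `φ` is allowed, because in the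
induction the leaves of a subshape are named by letters of the whole shape; control of the letters
used gives the disjointness of subshapes. -/
theorem exists_generic (s : Shape V) (φ : s.Leaf → ι) (hφ : Function.Injective φ)
    (hX : ∀ p, X (φ p) = s.obj p) :
    ∃ (x : s.Fam X) (a : Word ι), a.letters.Nodup ∧ (∀ l ∈ a.letters, ∃ p, φ p = l) ∧
      ∃ f, IsIso f ∧ s.total x = El.mk a f := by
  induction s with
  | leaf A =>
    exact ⟨El.mk (.of (φ ())) (eqToHom (hX ())), .of (φ ()), List.nodup_singleton _,
      fun l hl => ⟨(), (List.mem_singleton.1 hl).symm⟩, eqToHom (hX ()),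
      inferInstanceAs (IsIso (eqToHom (show X (φ ()) = A from hX ()))), rfl⟩
  | mul s t hs ht =>
    obtain ⟨x, a, ha, ha', f, _, hf⟩ :=
      hs (φ ∘ Sum.inl) (hφ.comp Sum.inl_injective) fun p => hX (.inl p)
    obtain ⟨y, b, hb, hb', g, _, hg⟩ :=
      ht (φ ∘ Sum.inr) (hφ.comp Sum.inr_injective) fun p => hX (.inr p)
    refine ⟨(x, y), .mul a b, List.nodup_append'.2 ⟨ha, hb, fun l h h' => ?_⟩, fun l hl => ?_,
      f ⊗ₘ g, inferInstanceAs (IsIso (f ⊗ₘ g)), ?_⟩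
    · obtain ⟨p, hp⟩ := ha' l h
      obtain ⟨q, hq⟩ := hb' l h'
      exact Sum.inl_ne_inr (hφ (hp.trans hq.symm))
    · rcases List.mem_append.1 hl with h | h
      · obtain ⟨p, hp⟩ := ha' l h
        exact ⟨_, hp⟩
      · obtain ⟨p, hp⟩ := hb' l h
        exact ⟨_, hp⟩
    · exact congrArg₂ El.tmul hf hg
  | tens n s hs =>
    choose x a ha ha' f hi hf using fun i => hs i (fun p => φ ⟨i, p⟩)
      (hφ.comp sigma_mk_injective) fun p => hX ⟨i, p⟩
    obtain ⟨b, hb, hb', g, hg, e⟩ := exists_generic_tprod (fun i => (s i).total (x i)) a ha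
      (fun i j hij l h h' => by
        obtain ⟨p, hp⟩ := ha' i l h
        obtain ⟨q, hq⟩ := ha' j l h'
        exact hij (congrArg Sigma.fst (hφ (hp.trans hq.symm))))
      fun i => ⟨f i, hi i, hf i⟩
    refine ⟨x, b, hb, fun l hl => ?_, g, hg, e⟩
    obtain ⟨i, hl'⟩ := hb' l hl
    obtain ⟨p, hp⟩ := ha' i l hl'
    exact ⟨_, hp⟩

/-- Morphisms out of iterated tensor products agree if they agree on tensor products of elements. -/
theorem hom_ext (s : Shape V) {W : V} {F G : s.eval ⟶ W}
    (h : ∀ (ι : Type) (X : ι → V) (x : s.Fam X), F ⊳ s.total x = G ⊳ s.total x) : F = G := by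
  obtain ⟨x, a, ha, -, f, hf, e⟩ := s.exists_generic (X := s.obj) id Function.injective_id
    fun _ => rfl
  have h' := h _ s.obj x
  rw [e, El.map_mk, El.map_mk] at h'
  -- Equality of the two classes is witnessed by a canonical endomorphism of a word without
  -- repetitions. Coherence makes it the identity, and the isomorphism `f` cancels.
  obtain ⟨c, hc, hc'⟩ := Quotient.exact h'
  dsimp only at hc hc'
  rwa [hc.eq_id ha, Category.id_comp, cancel_epi] at hc'

end Shape

variable [Category.{v} V] [MonoidalCategory V] [SymmetricCategory V]

theorem hom_ext_el {A W : V} {F G : A ⟶ W}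
    (h : ∀ (ι : Type) (X : ι → V) (a : El X A), F ⊳ a = G ⊳ a) : F = G :=
  Shape.hom_ext (.leaf A) h

theorem hom_ext_tmul {A B W : V} {F G : A ⊗ B ⟶ W}
    (h : ∀ (ι : Type) (X : ι → V) (a : El X A) (b : El X B), F ⊳ a ⊠ b = G ⊳ a ⊠ b) : F = G :=
  Shape.hom_ext (.mul (.leaf A) (.leaf B)) fun ι X x => h ι X x.1 x.2

theorem hom_ext_tmul_tmul {A B D W : V} {F G : A ⊗ B ⊗ D ⟶ W}
    (h : ∀ (ι : Type) (X : ι → V) (a : El X A) (b : El X B) (d : El X D),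
      F ⊳ a ⊠ b ⊠ d = G ⊳ a ⊠ b ⊠ d) : F = G :=
  Shape.hom_ext (.mul (.leaf A) (.mul (.leaf B) (.leaf D))) fun ι X x => h ι X x.1 x.2.1 x.2.2

theorem hom_ext_tmul_tprod {n : ℕ} {A : Fin n → V} {B W : V} {F G : B ⊗ tens A ⟶ W}
    (h : ∀ (ι : Type) (X : ι → V) (b : El X B) (a : ∀ i, El X (A i)),
      F ⊳ b ⊠ El.tprod a = G ⊳ b ⊠ El.tprod a) : F = G :=
  Shape.hom_ext (.mul (.leaf B) (.tens n fun i => .leaf (A i))) fun ι X x => h ι X x.1 x.2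

theorem hom_ext_relation {n m : ℕ} {A : Fin n → V} {A' : Fin m → V} {B D W : V}
    {F G : ((tens A ⊗ B) ⊗ tens A') ⊗ D ⟶ W}
    (h : ∀ (ι : Type) (X : ι → V) (a : ∀ i, El X (A i)) (b : El X B) (a' : ∀ i, El X (A' i))
      (d : El X D), F ⊳ ((El.tprod a ⊠ b) ⊠ El.tprod a') ⊠ d = G ⊳ ((El.tprod a ⊠ b) ⊠ El.tprod a') ⊠ d) :
    F = G :=
  Shape.hom_ext (.mul (.mul (.mul (.tens n fun i => .leaf (A i)) (.leaf B))
    (.tens m fun i => .leaf (A' i))) (.leaf D)) fun ι X x => h ι X x.1.1.1 x.1.1.2 x.1.2 x.2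

end Elements

end

/-! ### Elements of hom-objects, multicotensors and operads -/

noncomputable section

open OperadicData OperadicCategory

section EnrichedElements

variable {V : Type u} [Category.{v} V] [MonoidalCategory V] [SymmetricCategory V]
  {ι : Type} {X : ι → V}

namespace El

section

variable {K : Type uk} [EnrichedCategory V K]

/-- The composition of elements of hom-objects. -/
def comp {A B C : K} (x : El X (A ⟶[V] B)) (y : El X (B ⟶[V] C)) : El X (A ⟶[V] C) :=
  eComp V A B C ⊳ x ⊠ y

infixr:73 " ⊙ " => El.comp

theorem map_eComp {A B C : K} (x : El X (A ⟶[V] B)) (y : El X (B ⟶[V] C)) :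
    eComp V A B C ⊳ x ⊠ y = x ⊙ y := rfl

theorem comp_assoc {A B C D : K} (x : El X (A ⟶[V] B)) (y : El X (B ⟶[V] C))
    (z : El X (C ⟶[V] D)) : (x ⊙ y) ⊙ z = x ⊙ y ⊙ z := by
  have h := congrArg (· ⊳ x ⊠ y ⊠ z) (e_assoc V A B C D)
  simpa only [map_comp, map_associator_inv, map_whiskerRight, map_whiskerLeft, map_eComp] using h

end

variable {K : Type uk} [Category.{vk} K] [EnrichedOrdinaryCategory V K]

/-- The element of a hom-object given by a morphism. -/
def ofHom {A B : K} (f : A ⟶ B) : El X (A ⟶[V] B) := eHomEquiv V f ⊳ one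

theorem map_eId (A : K) : eId V A ⊳ (one : El X (𝟙_ V)) = ofHom (𝟙 A) := by
  rw [ofHom, eHomEquiv_id]

@[simp] theorem ofHom_id_comp {A B : K} (x : El X (A ⟶[V] B)) : ofHom (𝟙 A) ⊙ x = x := by
  have h := congrArg (· ⊳ x) (e_id_comp V A B)
  simpa only [map_comp, map_leftUnitor_inv, map_whiskerRight, map_eId, map_eComp, map_id] using h

@[simp] theorem comp_ofHom_id {A B : K} (x : El X (A ⟶[V] B)) : x ⊙ ofHom (𝟙 B) = x := by
  have h := congrArg (· ⊳ x) (e_comp_id V A B)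
  simpa only [map_comp, map_rightUnitor_inv, map_whiskerLeft, map_eId, map_eComp, map_id] using h

theorem ofHom_comp {A B C : K} (f : A ⟶ B) (g : B ⟶ C) :
    (ofHom (f ≫ g) : El X (A ⟶[V] C)) = ofHom f ⊙ ofHom g := by
  rw [ofHom, eHomEquiv_comp, map_comp, map_comp, map_leftUnitor_inv, map_tensorHom]
  rfl

theorem ofHom_comp_assoc {A B C D : K} (f : A ⟶ B) (g : B ⟶ C) (x : El X (C ⟶[V] D)) :
    ofHom f ⊙ ofHom g ⊙ x = ofHom (f ≫ g) ⊙ x := by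
  rw [ofHom_comp, comp_assoc]

theorem map_eHomWhiskerLeft {A B C : K} (x : El X (A ⟶[V] B)) (g : B ⟶ C) :
    eHomWhiskerLeft V A g ⊳ x = x ⊙ ofHom g := by
  rw [eHomWhiskerLeft, map_comp, map_comp, map_rightUnitor_inv, map_whiskerLeft]
  rfl

theorem map_eHomWhiskerRight {A B C : K} (f : A ⟶ B) (x : El X (B ⟶[V] C)) :
    eHomWhiskerRight V f C ⊳ x = ofHom f ⊙ x := by
  rw [eHomWhiskerRight, map_comp, map_comp, map_leftUnitor_inv, map_whiskerRight]
  rfl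

end El

variable {K : Type uk} [Category.{vk} K] [EnrichedOrdinaryCategory V K]

open El

/-- The action of a multifunctor on elements of hom-objects. -/
def MultiFunctor.elMap {n : ℕ} (F : MultiFunctor V K n) {A B : Fin n → K}
    (x : ∀ i, El X (A i ⟶[V] B i)) : El X (F.obj A ⟶[V] F.obj B) :=
  F.map A B ⊳ tprod x

theorem MultiFunctor.elMap_comp {n : ℕ} (F : MultiFunctor V K n) {A B C : Fin n → K}
    (x : ∀ i, El X (A i ⟶[V] B i)) (y : ∀ i, El X (B i ⟶[V] C i)) :
    F.elMap x ⊙ F.elMap y = F.elMap fun i => x i ⊙ y i := by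
  have h := congrArg (· ⊳ tprod x ⊠ tprod y) (F.map_comp A B C)
  simp only [El.map_comp, map_tensZip, map_tensMap, map_tensorHom, map_eComp] at h
  exact h.symm

theorem MultiFunctor.elMap_ofHom {n : ℕ} (F : MultiFunctor V K n) {A B : Fin n → K}
    (φ : ∀ i, A i ⟶ B i) :
    (F.elMap fun i => (ofHom (φ i) : El X (A i ⟶[V] B i))) = ofHom (F.mapHom φ) := by
  rw [MultiFunctor.mapHom, ofHom, Equiv.apply_symm_apply, El.map_comp, map_tensUnit, El.map_comp,
    map_tensMap]
  rfl

theorem eHomEquiv_symm_ofHom {A B : K} (x : 𝟙_ V ⟶ (A ⟶[V] B)) :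
    ofHom ((eHomEquiv V).symm x) = x ⊳ (one : El X (𝟙_ V)) := by
  rw [ofHom, Equiv.apply_symm_apply]

variable {O : Type uo} [Category.{vo} O] [OperadicCategory.{w} O]

namespace Multicotensor

variable (D : Multicotensor O V K)

theorem elMap_comul {T S : O} (f : T ⟶ S) {A B : Fin (card T) → K}
    (x : ∀ j, El X (A j ⟶[V] B j)) :
    (D.D T).elMap x ⊙ ofHom (D.comul f B) =
      ofHom (D.comul f A) ⊙ (D.D S).elMap fun i => (D.D (fib f i)).elMap fun k => x (emb f i k) := by
  have h := congrArg (· ⊳ tprod x) (D.comul_natural f A B)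
  simp only [El.map_comp, map_tensRegroup, map_eHomWhiskerLeft, map_eHomWhiskerRight] at h
  exact h.trans (congrArg (fun t => ofHom (D.comul f A) ⊙ (D.D S).map _ _ ⊳ t) (map_tensMap _ _))

theorem elMap_counit (c : Comp O) {A B : Fin (card (U c)) → K}
    (x : ∀ j, El X (A j ⟶[V] B j)) (i : Fin (card (U c))) :
    (D.D (U c)).elMap x ⊙ ofHom (D.counit c B i) = ofHom (D.counit c A i) ⊙ x i := by
  have h := congrArg (· ⊳ tprod x) (D.counit_natural c A B i)
  simp only [El.map_comp, map_eHomWhiskerLeft, map_eHomWhiskerRight] at h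
  refine h.trans (congrArg _ ?_)
  rw [map_collapse, map_id]
  intro k hk
  exact absurd (eq_of_card_U i k) hk

end Multicotensor

/-- The multiplication of an operad on elements. -/
def PreOperad.elMul (P : PreOperad O V) {T S : O} (f : T ⟶ S)
    (x : ∀ i, El X (P.obj (fib f i))) (y : El X (P.obj S)) : El X (P.obj T) :=
  P.mul f ⊳ tprod x ⊠ y

/-- The units of an operad as elements. -/
def PreOperad.elUnit (P : PreOperad O V) (c : Comp O) : El X (P.obj (U c)) := P.unit c ⊳ one

/-- On elements, the regrouping and interchange of factors in the associativity axiom reduce to the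
reindexing of `x` by `emb g i k`. -/
theorem Operad.elMul_assoc (P : Operad O V) {T S R : O} (f : T ⟶ S) (g : S ⟶ R)
    (x : ∀ j, El X (P.obj (fib f j))) (y : ∀ i, El X (P.obj (fib g i))) (z : El X (P.obj R)) :
    P.elMul f x (P.elMul g y z) =
      P.elMul (f ≫ g) (fun i => P.elMul (fibMap f g i) (fun k =>
        eqToHom (congrArg P.obj (fib_fibMap f g i k).symm) ⊳ x (emb g i k)) (y i)) z := by
  have h := congrArg (· ⊳ tprod x ⊠ tprod y ⊠ z) (P.assoc f g)
  simp only [El.map_comp, map_associator_inv, map_whiskerLeft, map_whiskerRight] at h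
  refine h.trans ?_
  refine congrArg (fun t => P.mul (f ≫ g) ⊳ t ⊠ z) ?_
  rw [map_tensRegroup]
  refine (congrArg (fun t => tensMap _ ⊳ tensZip _ _ ⊳ t ⊠ tprod y) (map_tensMap _ _)).trans ?_
  simp only [map_tensMap]
  refine (congrArg (fun t => tensMap _ ⊳ t) (map_tensZip _ _)).trans ?_
  exact map_tensMap _ _

theorem Operad.unit_elMul (P : Operad O V) (T : O) (x : El X (P.obj T)) :
    P.elMul (𝟙 T) (fun i => eqToHom (congrArg P.obj (fib_id T i).symm) ⊳ P.elUnit (src T i)) x =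
      x := by
  have h := congrArg (· ⊳ x) (P.unit_mul T)
  simp only [El.map_comp, map_leftUnitor_inv, map_whiskerRight, map_tensUnit, map_tensMap,
    El.map_id] at h
  exact h

theorem Operad.elMul_unit (P : Operad O V) (T : O) (x : El X (P.obj T)) :
    P.elMul (toU T) (fun i => eqToHom (congrArg P.obj (fib_U (toU T) i).symm) ⊳ x)
      (P.elUnit (π₀ T)) = x := by
  have h := congrArg (· ⊳ x) (P.mul_unit T)
  simp only [El.map_comp, map_rightUnitor_inv, map_tensorHom, map_tensOne, El.map_id] at h
  exact h

variable {D : Multicotensor O V K} {P : PreOperad O V} {Y : Comp O → K}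

theorem Algebra.app_elMul (A : Algebra D P Y) {T S : O} (f : T ⟶ S)
    (x : ∀ i, El X (P.obj (fib f i))) (y : El X (P.obj S)) :
    A.app T ⊳ P.elMul f x y =
      (ofHom (D.comul f (fun k => Y (src T k)) ≫
        eqToHom (congrArg (D.D S).obj (funext fun i => congrArg (D.D (fib f i)).obj
          (funext fun k => congrArg Y (src_fib f i k).symm)))) ⊙
      ((D.D S).elMap fun i => (A.app (fib f i) ⊳ x i) ⊙ ofHom (eqToHom (congrArg Y (π₀_fib f i)))) ⊙
      (A.app S ⊳ y)) ⊙ ofHom (eqToHom (congrArg Y (π₀_eq f).symm)) := by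
  have h := congrArg (· ⊳ tprod x ⊠ y) (A.mul_app f)
  simp only [El.map_comp, map_tensorHom, map_tensMap, Multicotensor.endOperad, map_whiskerRight,
    map_eHomWhiskerLeft, map_eHomWhiskerRight] at h
  exact h

theorem Algebra.app_elUnit (A : Algebra D P Y) (c : Comp O) :
    A.app (U c) ⊳ (P.elUnit c : El X (P.obj (U c))) =
      ofHom (D.counit c (fun k => Y (src (U c) k)) (pt rfl) ≫
        eqToHom (congrArg Y ((src_U c (pt rfl)).trans (π₀_U c).symm))) := by
  have h := congrArg (· ⊳ (one : El X _)) (A.unit_app c)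
  simp only [El.map_comp] at h
  exact h

end EnrichedElements

end

/-! ### Coends, ends and finite tensor products of coends -/

noncomputable section

section Coends

variable {V : Type u} [Category.{v} V]

/-- `E` is the quotient of the objects `G a` by the relations `l, r : R a b ⟶ G a, G b`. -/
structure IsCoend {A : Type v} {G : A → V} {R : A → A → V} (l : ∀ a b, R a b ⟶ G a)
    (r : ∀ a b, R a b ⟶ G b) {E : V} (p : ∀ a, G a ⟶ E) : Prop where
  wedge (a b : A) : l a b ≫ p a = r a b ≫ p b
  existsUnique_desc (W : V) (x : ∀ a, G a ⟶ W) (hx : ∀ a b, l a b ≫ x a = r a b ≫ x b) :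
    ∃! y : E ⟶ W, ∀ a, p a ≫ y = x a

/-- The coequalizer of the two maps from the coproduct of the relations to the coproduct of the
terms; both coproducts are small because the index type lies in `Type v`. -/
theorem exists_isCoend [HasColimits V] {A : Type v} {G : A → V} {R : A → A → V}
    (l : ∀ a b, R a b ⟶ G a) (r : ∀ a b, R a b ⟶ G b) :
    ∃ (E : V) (p : ∀ a, G a ⟶ E), IsCoend l r p := by
  let L : (∐ fun q : A × A => R q.1 q.2) ⟶ ∐ G := Sigma.desc fun q => l q.1 q.2 ≫ Sigma.ι G q.1
  let L' : (∐ fun q : A × A => R q.1 q.2) ⟶ ∐ G := Sigma.desc fun q => r q.1 q.2 ≫ Sigma.ι G q.2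
  refine ⟨coequalizer L L', fun a => Sigma.ι G a ≫ coequalizer.π L L', fun a b => ?_,
    fun W x hx => ?_⟩
  · have h := Sigma.ι (fun q : A × A => R q.1 q.2) (a, b) ≫= coequalizer.condition L L'
    simpa [L, L'] using h
  · have e : L ≫ Sigma.desc x = L' ≫ Sigma.desc x := Sigma.hom_ext _ _ fun q => by
      simpa [L, L'] using hx q.1 q.2
    refine ⟨coequalizer.desc (Sigma.desc x) e, fun a => by simp, fun y hy => ?_⟩
    · refine coequalizer.hom_ext (Sigma.hom_ext _ _ fun a => ?_)
      simpa using hy a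

/-- Ends in the form of a universal family equalizing given pairs of maps. -/
theorem exists_end [HasLimits V] {A : Type v} {F : A → V} {H : A → A → V}
    (l : ∀ a b, F a ⟶ H a b) (r : ∀ a b, F b ⟶ H a b) :
    ∃ (L : V) (p : ∀ a, L ⟶ F a), (∀ a b, p a ≫ l a b = p b ≫ r a b) ∧
      ∀ (W : V) (x : ∀ a, W ⟶ F a), (∀ a b, x a ≫ l a b = x b ≫ r a b) →
        ∃! y : W ⟶ L, ∀ a, y ≫ p a = x a := by
  let f : ∏ᶜ F ⟶ ∏ᶜ fun q : A × A => H q.1 q.2 := Pi.lift fun q => Pi.π F q.1 ≫ l q.1 q.2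
  let g : ∏ᶜ F ⟶ ∏ᶜ fun q : A × A => H q.1 q.2 := Pi.lift fun q => Pi.π F q.2 ≫ r q.1 q.2
  refine ⟨equalizer f g, fun a => equalizer.ι f g ≫ Pi.π F a, fun a b => ?_, fun W x hx => ?_⟩
  · have h := equalizer.condition f g =≫ Pi.π (fun q : A × A => H q.1 q.2) (a, b)
    simpa [f, g] using h
  · have e : Pi.lift x ≫ f = Pi.lift x ≫ g := Pi.hom_ext _ _ fun q => by
      simpa [f, g] using hx q.1 q.2
    refine ⟨equalizer.lift (Pi.lift x) e, fun a => by simp, fun y hy => ?_⟩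
    · refine equalizer.hom_ext (Pi.hom_ext _ _ fun a => ?_)
      simpa using hy a

namespace IsCoend

variable {A : Type v} {G : A → V} {R : A → A → V} {l : ∀ a b, R a b ⟶ G a}
  {r : ∀ a b, R a b ⟶ G b} {E : V} {p : ∀ a, G a ⟶ E}

theorem hom_ext (h : IsCoend l r p) {W : V} {f g : E ⟶ W} (e : ∀ a, p a ≫ f = p a ≫ g) : f = g :=
  (h.existsUnique_desc W (fun a => p a ≫ g) fun a b => by
    rw [← Category.assoc, ← Category.assoc, h.wedge]).unique e fun _ => rfl

variable [MonoidalCategory V] [MonoidalClosed V]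

/-- Tensoring with `Z` is a left adjoint: descent is carried through currying. -/
theorem whiskerLeft (h : IsCoend l r p) (Z : V) :
    IsCoend (G := fun a => Z ⊗ G a) (R := fun a b => Z ⊗ R a b) (fun a b => Z ◁ l a b)
      (fun a b => Z ◁ r a b) (fun a => Z ◁ p a) where
  wedge a b := by simp only [← MonoidalCategory.whiskerLeft_comp, h.wedge]
  existsUnique_desc W x hx := by
    obtain ⟨y, hy, hy'⟩ := h.existsUnique_desc ((ihom Z).obj W) (fun a => curry (x a)) fun a b => by
      rw [← curry_natural_left, ← curry_natural_left, hx]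
    refine ⟨uncurry y, fun a => ?_, fun y' e => ?_⟩
    · rw [← uncurry_natural_left, hy, uncurry_curry]
    · rw [← hy' (curry y') fun a => ?_, uncurry_curry]
      rw [← curry_natural_left]
      exact congrArg curry (e a)

variable [SymmetricCategory V]

theorem whiskerRight (h : IsCoend l r p) (Z : V) :
    IsCoend (G := fun a => G a ⊗ Z) (R := fun a b => R a b ⊗ Z) (fun a b => l a b ▷ Z)
      (fun a b => r a b ▷ Z) (fun a => p a ▷ Z) where
  wedge a b := by simp only [← comp_whiskerRight, h.wedge]
  existsUnique_desc W x hx := by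
    obtain ⟨y, hy, hy'⟩ := (h.whiskerLeft Z).existsUnique_desc W
      (fun a => (β_ Z (G a)).hom ≫ x a) fun a b => by simp [hx]
    refine ⟨(β_ E Z).hom ≫ y, fun a => ?_, fun y' e => ?_⟩
    · have := hy a
      rw [BraidedCategory.braiding_naturality_left_assoc, this,
        SymmetricCategory.symmetry_assoc]
    · rw [← hy' ((β_ Z E).hom ≫ y') fun a => by simp [← e], SymmetricCategory.symmetry_assoc]

variable {A' : Type v} {G' : A' → V} {R' : A' → A' → V} {l' : ∀ a b, R' a b ⟶ G' a}
  {r' : ∀ a b, R' a b ⟶ G' b} {E' : V} {p' : ∀ a, G' a ⟶ E'}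

/-- The tensor product of two reflexive coends. -/
theorem tensor (h : IsCoend l r p) (h' : IsCoend l' r' p')
    (s : ∀ a, ∃ s : G a ⟶ R a a, s ≫ l a a = 𝟙 _ ∧ s ≫ r a a = 𝟙 _)
    (s' : ∀ a, ∃ s : G' a ⟶ R' a a, s ≫ l' a a = 𝟙 _ ∧ s ≫ r' a a = 𝟙 _) :
    IsCoend (A := A × A') (G := fun a => G a.1 ⊗ G' a.2) (R := fun a b => R a.1 b.1 ⊗ R' a.2 b.2)
      (fun a b => l a.1 b.1 ⊗ₘ l' a.2 b.2) (fun a b => r a.1 b.1 ⊗ₘ r' a.2 b.2)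
      (fun a => p a.1 ⊗ₘ p' a.2) where
  wedge a b := by simp only [tensorHom_comp_tensorHom, h.wedge, h'.wedge]
  existsUnique_desc W x hx := by
    -- Reflexivity enters here. Inserting a common section of one pair of relations holds that
    -- variable constant, so a family compatible in both variables at once is compatible in each
    -- variable separately.
    have k₁ : ∀ a b a', l a b ▷ G' a' ≫ x (a, a') = r a b ▷ G' a' ≫ x (b, a') := by
      intro a b a'
      obtain ⟨t, e, e'⟩ := s' a'
      have := R a b ◁ t ≫= hx (a, a') (b, a')
      simpa only [← tensorHom_id, ← id_tensorHom, tensorHom_comp_tensorHom_assoc, e, e',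
        Category.id_comp] using this
    have k₂ : ∀ a a' b', G a ◁ l' a' b' ≫ x (a, a') = G a ◁ r' a' b' ≫ x (a, b') := by
      intro a a' b'
      obtain ⟨t, e, e'⟩ := s a
      have := t ▷ R' a' b' ≫= hx (a, a') (a, b')
      simpa only [← tensorHom_id, ← id_tensorHom, tensorHom_comp_tensorHom_assoc, e, e',
        Category.id_comp] using this
    choose y hy using fun a' => (h.whiskerRight (G' a')).existsUnique_desc W
      (fun a => x (a, a')) fun a b => k₁ a b a'
    -- After descent in the first variable with the second one fixed, the maps `y` are themselves
    -- compatible in the second variable; this can be tested on the terms of the first coend.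
    obtain ⟨z, hz, -⟩ := (h'.whiskerLeft E).existsUnique_desc W y fun a' b' => by
      refine (h.whiskerRight (R' a' b')).hom_ext fun a => ?_
      have e₁ := (hy a').1 a
      have e₂ := (hy b').1 a
      rw [← whisker_exchange_assoc, e₁, ← whisker_exchange_assoc, e₂, k₂]
    have e : ∀ a, (p a.1 ⊗ₘ p' a.2) ≫ z = x a := fun a => by
      have e₁ := hz a.2
      have e₂ := (hy a.2).1 a.1
      rw [MonoidalCategory.tensorHom_def, Category.assoc, e₁, e₂]
    refine ⟨z, e, fun z' e' => (h'.whiskerLeft E).hom_ext fun a' =>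
      (h.whiskerRight (G' a')).hom_ext fun a => ?_⟩
    have e₁ := (e' (a, a')).trans (e (a, a')).symm
    simpa only [MonoidalCategory.tensorHom_def, Category.assoc] using e₁

end IsCoend

variable [MonoidalCategory V] [MonoidalClosed V] [SymmetricCategory V]

/-- Finite tensor products of reflexive coends. -/
theorem isCoend_tens {n : ℕ} {A : Fin n → Type v} {G : ∀ k, A k → V} {R : ∀ k, A k → A k → V}
    {l : ∀ k a b, R k a b ⟶ G k a} {r : ∀ k a b, R k a b ⟶ G k b} {E : Fin n → V}
    {p : ∀ k a, G k a ⟶ E k} (h : ∀ k, IsCoend (l k) (r k) (p k))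
    (s : ∀ k a, ∃ s : G k a ⟶ R k a a, s ≫ l k a a = 𝟙 _ ∧ s ≫ r k a a = 𝟙 _) :
    IsCoend (A := ∀ k, A k) (G := fun a => tens fun k => G k (a k))
        (R := fun a b => tens fun k => R k (a k) (b k))
        (fun a b => tensMap fun k => l k (a k) (b k)) (fun a b => tensMap fun k => r k (a k) (b k))
        (fun a => tensMap fun k => p k (a k)) ∧
      ∀ a : ∀ k, A k, ∃ s : (tens fun k => G k (a k)) ⟶ tens fun k => R k (a k) (a k),
        s ≫ (tensMap fun k => l k (a k) (a k)) = 𝟙 _ ∧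
          s ≫ (tensMap fun k => r k (a k) (a k)) = 𝟙 _ := by
  induction n with
  | zero =>
    refine ⟨⟨fun _ _ => rfl, fun W x _ => ?_⟩, fun a => ⟨𝟙 _, Category.id_comp _,
      Category.id_comp _⟩⟩
    refine ⟨x fun k => k.elim0, fun a => ?_, fun y hy => ?_⟩
    · obtain rfl : a = fun k => k.elim0 := funext fun k => k.elim0
      exact Category.id_comp _
    · rw [← hy]
      exact (Category.id_comp y).symm
  | succ n ih =>
    obtain ⟨h₂, s₂⟩ := ih (fun k => h k.succ) fun k => s k.succ
    have h₁ := (h 0).tensor h₂ (s 0) s₂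
    refine ⟨⟨fun a b => h₁.wedge (a 0, fun k => a k.succ) (b 0, fun k => b k.succ),
      fun W x hx => ?_⟩, fun a => ?_⟩
    · obtain ⟨y, hy, hy'⟩ := h₁.existsUnique_desc W (fun a => x (Fin.cons a.1 a.2)) fun a b =>
        hx (Fin.cons a.1 a.2) (Fin.cons b.1 b.2)
      refine ⟨y, fun a => ?_, fun z hz => hy' z fun a => hz (Fin.cons a.1 a.2)⟩
      have e := hy (a 0, fun k => a k.succ)
      have ea : (Fin.cons (a 0) fun k => a k.succ : ∀ k, A k) = a := Fin.cons_self_tail a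
      dsimp only at e
      rw [← ea]
      exact e
    · obtain ⟨t, e₁, e₂⟩ := s 0 (a 0)
      obtain ⟨t', e₁', e₂'⟩ := s₂ fun k => a k.succ
      refine ⟨t ⊗ₘ t', ?_, ?_⟩
      · refine (tensorHom_comp_tensorHom _ _ _ _).trans ?_
        rw [e₁, e₁']
        exact id_tensorHom_id _ _
      · refine (tensorHom_comp_tensorHom _ _ _ _).trans ?_
        rw [e₂, e₂']
        exact id_tensorHom_id _ _

end Coends

end

/-! ### Fibre maps for chosen terminal objects and identities -/

noncomputable section

open OperadicData OperadicCategory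

section FibreMaps

variable {O : Type uo} [Category.{vo} O] [OperadicCategory.{w} O]

/-- Over a chosen terminal object the fibre functor is the domain functor. The equality is
heterogeneous because the fibres are equal to `T` and `S` only propositionally. -/
theorem heq_fibMap_of_U {T S : O} {c : Comp O} (f : T ⟶ S) (g : S ⟶ U c)
    (i : Fin (card (U c))) : HEq (fibMap f g i) f := by
  change HEq ((Fib i).map (Over.homMk f : Over.mk (f ≫ g) ⟶ Over.mk g)) f
  rw [Fib_U]
  rfl

theorem heq_fibMap_id {T S : O} (f : T ⟶ S) (i : Fin (card S)) :
    HEq (fibMap (𝟙 T) f i) (𝟙 (fib f i)) := by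
  -- The morphism `𝟙 T ≫ f` equals `f` only propositionally, so the source of the slice morphism is
  -- generalized before functoriality on identities is used.
  have key : ∀ (h : T ⟶ S) (_ : h = f) (u : Over.mk h ⟶ Over.mk f) (_ : u.left = 𝟙 T),
      HEq ((Fib i).map u) (𝟙 (fib f i)) := by
    rintro h rfl u hu
    have : u = 𝟙 _ := Over.OverMorphism.ext hu
    rw [this]
    exact heq_of_eq ((Fib i).map_id _)
  exact key (𝟙 T ≫ f) (Category.id_comp f) (Over.homMk (𝟙 T)) rfl

theorem heq_toU {T S : O} {c : Comp O} (hS : S = U c) (f : T ⟶ S) : HEq f (toU T) := by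
  subst hS
  obtain rfl : π₀ T = c := (π₀_eq f).trans (π₀_U c)
  exact heq_of_eq (toU_unique _ _)

theorem heq_toU' {T T' S : O} {c : Comp O} (hT : T = T') (hS : S = U c) (f : T ⟶ S) :
    HEq f (toU T') := by
  subst hT
  exact heq_toU hS f

end FibreMaps

/-! ### Structure maps of coloured operads on elements, and transport -/

section

variable {V : Type u} [Category.{v} V] [MonoidalCategory V] [SymmetricCategory V]
  {ι : Type} {X : ι → V}

open El

theorem El.heq_map_eqToHom {A B : V} (h : A = B) (x : El X A) : HEq (eqToHom h ⊳ x) x := by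
  subst h
  rw [eqToHom_refl, El.map_id]

variable {O : Type uo} [Category.{vo} O] [OperadicCategory.{w} O]

variable {C : Type v}

/-- Transport of elements of the components of an operad. -/
def PreOperad.elCast (P : PreOperad O V) {T T' : O} (h : T = T') (x : El X (P.obj T)) :
    El X (P.obj T') :=
  eqToHom (congrArg P.obj h) ⊳ x

theorem PreOperad.heq_elCast (P : PreOperad O V) {T T' : O} (h : T = T') (x : El X (P.obj T)) :
    HEq (P.elCast h x) x :=
  heq_map_eqToHom _ _

theorem colObj_fib_id (T : O) (a b : Fin (card T) → C) (k : Fin (card T)) :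
    colObj (fib (𝟙 T) k) (a ∘ emb (𝟙 T) k) (b k) = linObj (src T k) (a k) (b k) :=
  Colored.eq_of (fib_id T k) (heq_comp_emb_id k a) rfl

theorem colObj_fib_toU (T : O) (a : Fin (card T) → C) (i : C) (k : Fin (card (U (π₀ T)))) :
    colObj (fib (toU T) k) (a ∘ emb (toU T) k) i = colObj T a i :=
  Colored.eq_of (fib_U (toU T) k) (heq_comp_emb_U (toU T) k a) rfl

theorem colObj_fib_fibMap {T S R : O} (f : T ⟶ S) (g : S ⟶ R) (b : Fin (card T) → C)
    (a : Fin (card S) → C) (k : Fin (card R)) (l : Fin (card (fib g k))) :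
    colObj (fib (fibMap f g k) l) ((b ∘ emb (f ≫ g) k) ∘ emb (fibMap f g k) l)
      ((a ∘ emb g k) l) = colObj (fib f (emb g k l)) (b ∘ emb f (emb g k l)) (a (emb g k l)) :=
  Colored.eq_of (fib_fibMap f g k l) (heq_comp_emb_fibMap f g k l b) rfl

/-- The multiplication of an operad on `O^C` along a map of `O` between coloured objects. -/
def PreOperad.colMul (P : PreOperad (Colored O C) V) {T S : O} (f : T ⟶ S) (b : Fin (card T) → C)
    (a : Fin (card S) → C) (i : C) (x : ∀ k, El X (P.obj (colObj (fib f k) (b ∘ emb f k) (a k))))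
    (y : El X (P.obj (colObj S a i))) : El X (P.obj (colObj T b i)) :=
  P.elMul (colHom f b a i) x y

/-- The contravariant action on elements. -/
def PreOperad.elContra (P : PreOperad (Colored O C) V) {T : O} {a b : Fin (card T) → C}
    {i : C} (u : ∀ k, El X (uHom P (src T k) (a k) (b k))) (p : El X (P.obj (colObj T b i))) :
    El X (P.obj (colObj T a i)) :=
  contraAct P T a b i ⊳ tprod u ⊠ p

/-- The covariant action on elements. -/
def PreOperad.elCo (P : PreOperad (Colored O C) V) {T : O} {a : Fin (card T) → C}
    {i j : C} (p : El X (P.obj (colObj T a i))) (u : El X (uHom P (π₀ T) i j)) :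
    El X (P.obj (colObj T a j)) :=
  coAct P T a i j ⊳ p ⊠ u

/-- Elements of hom-objects of the underlying category as elements of components of the operad. -/
def PreOperad.elLin (P : PreOperad (Colored O C) V) {c : Comp O} {i j : C}
    (u : El X (uHom P c i j)) : El X (P.obj (linObj c i j)) := u

/-- Transport of elements of hom-objects of the underlying category. -/
def PreOperad.castU (P : PreOperad (Colored O C) V) {c c' : Comp O} (h : c = c') {i j : C}
    (u : El X (uHom P c i j)) : El X (uHom P c' i j) :=
  eqToHom (congrArg (fun c => uHom P c i j) h) ⊳ u

theorem PreOperad.heq_castU (P : PreOperad (Colored O C) V) {c c' : Comp O} (h : c = c') {i j : C}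
    (u : El X (uHom P c i j)) : HEq (P.castU h u) u :=
  heq_map_eqToHom _ _

theorem PreOperad.elContra_eq (P : PreOperad (Colored O C) V) {T : O} {a b : Fin (card T) → C}
    {i : C} (u : ∀ k, El X (uHom P (src T k) (a k) (b k))) (p : El X (P.obj (colObj T b i))) :
    P.elContra u p = P.colMul (𝟙 T) a b i
      (fun k => P.elCast (colObj_fib_id T a b k).symm (P.elLin (u k))) p :=
  (El.map_comp _ _ _).trans (congrArg _ ((map_whiskerRight _ _ _).trans
    (congrArg (· ⊠ p) (map_tensMap _ _))))

theorem PreOperad.elCo_eq (P : PreOperad (Colored O C) V) {T : O} {a : Fin (card T) → C}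
    {i j : C} (p : El X (P.obj (colObj T a i))) (u : El X (uHom P (π₀ T) i j)) :
    P.elCo p u = P.colMul (toU T) a (fun _ => i) j
      (fun k => P.elCast (colObj_fib_toU T a i k).symm p) (P.elLin u) :=
  (El.map_comp _ _ _).trans (congrArg _ ((map_whiskerRight _ _ _).trans
    (congrArg (· ⊠ u) (map_tensOne _ _ _ _))))

/-- The identities of the underlying category as elements. -/
def PreOperad.elUId (P : PreOperad (Colored O C) V) (c : Comp O) (i : C) : El X (uHom P c i i) :=
  uId P c i ⊳ one

theorem PreOperad.elUId_congr (P : PreOperad (Colored O C) V) {c c' : Comp O} (h : c = c') {i : C} :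
    HEq (P.elUId c i : El X _) (P.elUId c' i : El X _) := by
  subst h
  rfl

theorem Operad.elContra_id (P : Operad (Colored O C) V) {T : O} {a : Fin (card T) → C} {i : C}
    (p : El X (P.obj (colObj T a i))) :
    P.elContra (fun k => P.elUId (src T k) (a k)) p = p := by
  rw [PreOperad.elContra_eq]
  exact P.unit_elMul (colObj T a i) p

theorem Operad.elCo_id (P : Operad (Colored O C) V) {T : O} {a : Fin (card T) → C} {i : C}
    (p : El X (P.obj (colObj T a i))) : P.elCo p (P.elUId (π₀ T) i) = p := by
  rw [PreOperad.elCo_eq]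
  exact P.elMul_unit (colObj T a i) p

theorem Operad.colMul_assoc (P : Operad (Colored O C) V) {T S R : O} (f : T ⟶ S) (g : S ⟶ R)
    (b : Fin (card T) → C) (a : Fin (card S) → C) (c : Fin (card R) → C) (i : C)
    (x : ∀ k, El X (P.obj (colObj (fib f k) (b ∘ emb f k) (a k))))
    (y : ∀ k, El X (P.obj (colObj (fib g k) (a ∘ emb g k) (c k))))
    (z : El X (P.obj (colObj R c i))) :
    P.colMul f b a i x (P.colMul g a c i y z) =
      P.colMul (f ≫ g) b c i (fun k => P.colMul (fibMap f g k) (b ∘ emb (f ≫ g) k) (a ∘ emb g k)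
        (c k) (fun l => P.elCast (colObj_fib_fibMap f g b a k l).symm (x (emb g k l))) (y k)) z :=
  P.elMul_assoc (colHom f b a i) (colHom g a c i) x y z

/-- Composites along equal but not definitionally equal maps have different types. This congruence
reduces their comparison to that of each argument; positions are matched by their values, since the
index types differ as well. -/
theorem PreOperad.colMul_congr (P : PreOperad (Colored O C) V) {T T' S S' : O} (hT : T = T')
    (hS : S = S') {f : T ⟶ S} {f' : T' ⟶ S'} (hf : HEq f f') {b : Fin (card T) → C}
    {b' : Fin (card T') → C} (hb : ∀ k k', k.1 = k'.1 → b k = b' k') {a : Fin (card S) → C}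
    {a' : Fin (card S') → C} (ha : ∀ k k', k.1 = k'.1 → a k = a' k') {i i' : C} (hi : i = i')
    {x : ∀ k, El X (P.obj (colObj (fib f k) (b ∘ emb f k) (a k)))}
    {x' : ∀ k, El X (P.obj (colObj (fib f' k) (b' ∘ emb f' k) (a' k)))}
    (hx : ∀ k k', k.1 = k'.1 → HEq (x k) (x' k')) {y : El X (P.obj (colObj S a i))}
    {y' : El X (P.obj (colObj S' a' i'))} (hy : HEq y y') :
    HEq (P.colMul f b a i x y) (P.colMul f' b' a' i' x' y') := by
  subst hT hS hi
  obtain rfl := eq_of_heq hf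
  obtain rfl : b = b' := funext fun k => hb k k rfl
  obtain rfl : a = a' := funext fun k => ha k k rfl
  obtain rfl := eq_of_heq hy
  obtain rfl : x = x' := funext fun i => eq_of_heq (hx i i rfl)
  rfl

theorem emb_val_congr {T S T' S' : O} (hT : T = T') (hS : S = S') {f : T ⟶ S} {f' : T' ⟶ S'}
    (hf : HEq f f') {i : Fin (card S)} {i' : Fin (card S')} (hi : i.1 = i'.1)
    {k : Fin (card (fib f i))} {k' : Fin (card (fib f' i'))} (hk : k.1 = k'.1) :
    (emb f i k).1 = (emb f' i' k').1 := by
  subst hT hS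
  obtain rfl := eq_of_heq hf
  obtain rfl := Fin.ext hi
  rw [Fin.ext hk]

theorem emb_val_of_U {T : O} {c : Comp O} (f : T ⟶ U c) (i : Fin (card (U c)))
    (k : Fin (card (fib f i))) : (emb f i k).1 = k.1 := by
  have h := heq_comp_emb_U f i (fun j => j.1)
  have e : ∀ {n m : ℕ} (_ : n = m) (g : Fin n → ℕ) (_ : HEq g (fun j : Fin m => j.1)) (k : Fin n),
      g k = k.1 := by
    rintro n m rfl g hg k
    rw [eq_of_heq hg]
  exact e (congrArg card (fib_U f i)) _ h k

theorem emb_fibMap_val {T S R : O} (f : T ⟶ S) (g : S ⟶ R) (i : Fin (card R))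
    (k : Fin (card (fib g i))) (l : Fin (card (fib (fibMap f g i) k)))
    (l' : Fin (card (fib f (emb g i k)))) (hl : l.1 = l'.1) :
    emb (f ≫ g) i (emb (fibMap f g i) k l) = emb f (emb g i k) l' := by
  have h := heq_comp_emb_fibMap f g i k id
  have e : ∀ {n m : ℕ} {α : Type} (_ : n = m) (g : Fin n → α) (g' : Fin m → α) (_ : HEq g g')
      (k : Fin n) (k' : Fin m) (_ : k.1 = k'.1), g k = g' k' := by
    rintro n m α rfl g g' hg k k' hk
    rw [eq_of_heq hg, Fin.ext hk]
  exact e (congrArg card (fib_fibMap f g i k)) _ _ h l l' hl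

end

end

/-! ### The two actions of the underlying category and multiplication -/

noncomputable section

open OperadicData OperadicCategory El

section OperadIdentities

variable {V : Type u} [Category.{v} V] [MonoidalCategory V] [SymmetricCategory V]
  {ι : Type} {X : ι → V} {O : Type uo} [Category.{vo} O] [OperadicCategory.{w} O] {C : Type v}

theorem heq_apply {n : ℕ} {A : Fin n → Type*} (x : ∀ i, A i) {i j : Fin n} (h : i = j) :
    HEq (x i) (x j) := by
  subst h
  rfl

variable (P : Operad (Colored O C) V)

/-- Associativity for `𝟙 T` followed by `toU T`: the composite is again the map to the terminal
object, whose fibre functor leaves `𝟙 T` unchanged. -/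
theorem Operad.elCo_contra {T : O} {a b : Fin (card T) → C} {i j : C}
    (u : ∀ k, El X (uHom P.toPreOperad (src T k) (a k) (b k))) (p : El X (P.obj (colObj T b i)))
    (v : El X (uHom P.toPreOperad (π₀ T) i j)) :
    P.elCo (P.elContra u p) v = P.elContra u (P.elCo p v) := by
  simp only [PreOperad.elContra_eq, PreOperad.elCo_eq]
  rw [P.colMul_assoc]
  refine (eq_of_heq (P.colMul_congr rfl rfl (heq_of_eq (toU_unique _ _)) ?_ ?_ rfl
    (fun k k' _ => ?_) HEq.rfl)).symm
  · exact fun k k' h => congrArg a (Fin.ext h)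
  · exact fun _ _ _ => rfl
  refine HEq.trans ?_ (P.heq_elCast _ _).symm
  refine P.colMul_congr (fib_U _ k) (fib_U _ k) (heq_fibMap_of_U _ _ _) (fun l l' h => ?_)
    (fun l l' h => ?_) rfl (fun l l' h => ?_) (P.heq_elCast _ _)
  · exact congrArg a (Fin.ext ((emb_val_of_U _ _ _).trans h))
  · exact congrArg b (Fin.ext ((emb_val_of_U _ _ _).trans h))
  · exact ((P.heq_elCast _ _).trans (P.heq_elCast _ _)).trans <| (heq_apply u (Fin.ext ((emb_val_of_U _ _ _).trans h))).trans (P.heq_elCast _ _).symm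

/-- Associativity for `𝟙 T` followed by `f`, where the induced maps of fibres are identities. It
makes the multitensor well defined on the inner coends. -/
theorem Operad.colMul_contra {T S : O} (f : T ⟶ S) {b b' : Fin (card T) → C}
    {a : Fin (card S) → C} {i : C}
    (u : ∀ l, El X (uHom P.toPreOperad (src T l) (b l) (b' l)))
    (p : ∀ k, El X (P.obj (colObj (fib f k) (b' ∘ emb f k) (a k))))
    (q : El X (P.obj (colObj S a i))) :
    P.colMul f b a i (fun k => P.elContra (a := b ∘ emb f k)
        (fun l => P.castU (src_fib f k l).symm (u (emb f k l))) (p k)) q =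
      P.elContra u (P.colMul f b' a i p q) := by
  simp only [PreOperad.elContra_eq]
  rw [P.colMul_assoc]
  have hf : HEq f (𝟙 T ≫ f) := heq_of_eq (Category.id_comp f).symm
  have hfib : ∀ k, fib f k = fib (𝟙 T ≫ f) k := fun k => by rw [Category.id_comp]
  refine eq_of_heq (P.colMul_congr rfl rfl hf ?_ ?_ rfl (fun k k' h => ?_) HEq.rfl)
  · exact fun k k' h => congrArg b (Fin.ext h)
  · exact fun k k' h => congrArg a (Fin.ext h)
  obtain rfl := Fin.ext h
  refine P.colMul_congr (hfib k) rfl (heq_fibMap_id f k).symm (fun l l' h => ?_) (fun l l' h => ?_)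
    rfl (fun l l' h => ?_) HEq.rfl
  · exact congrArg b (Fin.ext (emb_val_congr rfl rfl hf rfl h))
  · exact congrArg (fun l => b' (emb f k l)) (Fin.ext h)
  · obtain rfl := Fin.ext h
    exact ((P.heq_elCast _ _).trans (P.heq_castU _ _)).trans
      ((P.heq_elCast _ _).trans (P.heq_elCast _ _)).symm

/-- Associativity for `f` followed by `𝟙 S`, where the induced maps of fibres go to chosen terminal
objects. It is the balancing over the intermediate colours that the outer coend requires. -/
theorem Operad.colMul_co {T S : O} (f : T ⟶ S) {b : Fin (card T) → C} {a a' : Fin (card S) → C}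
    {i : C} (p : ∀ k, El X (P.obj (colObj (fib f k) (b ∘ emb f k) (a k))))
    (u : ∀ k, El X (uHom P.toPreOperad (src S k) (a k) (a' k)))
    (q : El X (P.obj (colObj S a' i))) :
    P.colMul f b a' i (fun k => P.elCo (p k) (P.castU (π₀_fib f k).symm (u k))) q =
      P.colMul f b a i p (P.elContra u q) := by
  simp only [PreOperad.elContra_eq, PreOperad.elCo_eq]
  rw [P.colMul_assoc]
  have hf : HEq f (f ≫ 𝟙 S) := heq_of_eq (Category.comp_id f).symm
  have hfib : ∀ k, fib f k = fib (f ≫ 𝟙 S) k := fun k => by rw [Category.comp_id]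
  refine eq_of_heq (P.colMul_congr rfl rfl hf ?_ ?_ rfl (fun k k' h => ?_) HEq.rfl)
  · exact fun k k' h => congrArg b (Fin.ext h)
  · exact fun k k' h => congrArg a' (Fin.ext h)
  obtain rfl := Fin.ext h
  have hU : U (π₀ (fib f k)) = fib (𝟙 S) k := by rw [fib_id, π₀_fib]
  refine P.colMul_congr (hfib k) hU (heq_toU' (hfib k).symm (fib_id S k) _).symm (fun l l' h => ?_)
    (fun l l' h => congrArg a (emb_id k l').symm) rfl (fun l l' h => ?_) ?_
  · exact congrArg b (Fin.ext (emb_val_congr rfl rfl hf rfl h))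
  · refine (P.heq_elCast _ _).trans ?_
    exact (heq_apply p (emb_id k l').symm).trans (P.heq_elCast _ _).symm
  · exact (P.heq_castU _ _).trans (P.heq_elCast _ _).symm

/-- Associativity for `f` followed by `toU S`; it gives naturality in the root colour. -/
theorem Operad.elCo_colMul {T S : O} (f : T ⟶ S) {b : Fin (card T) → C} {a : Fin (card S) → C}
    {i j : C} (p : ∀ k, El X (P.obj (colObj (fib f k) (b ∘ emb f k) (a k))))
    (q : El X (P.obj (colObj S a i))) (u : El X (uHom P.toPreOperad (π₀ S) i j)) :
    P.elCo (P.colMul f b a i p q) (P.castU (π₀_eq f).symm u) =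
      P.colMul f b a j p (P.elCo q u) := by
  simp only [PreOperad.elCo_eq]
  rw [P.colMul_assoc]
  refine eq_of_heq (P.colMul_congr rfl (congrArg U (π₀_eq f)) (heq_toU' rfl rfl _).symm ?_ ?_ rfl
    (fun k k' h => ?_) (P.heq_castU _ _))
  · exact fun k k' h => congrArg b (Fin.ext h)
  · exact fun _ _ _ => rfl
  refine (P.heq_elCast _ _).trans ?_
  refine P.colMul_congr (fib_U _ _).symm (fib_U _ _).symm (heq_fibMap_of_U _ _ _).symm
    (fun l l' h => ?_) (fun l l' h => ?_) rfl (fun l l' h => ?_) (P.heq_elCast _ _).symm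
  · exact congrArg b (Fin.ext (h.trans (emb_val_of_U _ _ _).symm))
  · exact congrArg a (Fin.ext (h.trans (emb_val_of_U _ _ _).symm))
  · exact (heq_apply p (Fin.ext (h.trans (emb_val_of_U _ _ _).symm))).trans
      (P.heq_elCast _ _).symm

end OperadIdentities

end

/-! ### Convolution products and their elements -/

noncomputable section

open OperadicData OperadicCategory El

section ConvolutionElements

variable {V : Type u} [Category.{v} V] [MonoidalCategory V] [SymmetricCategory V]
  [MonoidalClosed V] {ι : Type} {X : ι → V}
  {O : Type uo} [Category.{vo} O] [OperadicCategory.{w} O] {C : Type v}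

section

variable {P : PreOperad (Colored O C) V} (δ : UFunctor P V)

/-- The action of the underlying category on elements. -/
def UFunctor.elAct {c : Comp O} {i j : C} (d : El X (δ.obj c i)) (u : El X (uHom P c i j)) :
    El X (δ.obj c j) :=
  δ.act c i j ⊳ d ⊠ u

theorem UFunctor.elAct_id {c : Comp O} {i : C} (d : El X (δ.obj c i)) :
    δ.elAct d (P.elUId c i) = d := by
  have h : δ.obj c i ◁ (uId P c i ≫ δ.map c i i) ≫ (ihom.ev (δ.obj c i)).app (δ.obj c i) =
      (ρ_ (δ.obj c i)).hom := by
    rw [δ.map_id]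
    change δ.obj c i ◁ MonoidalClosed.id (δ.obj c i) ≫ _ = _
    rw [← uncurry_eq, MonoidalClosed.id_eq, uncurry_curry]
  have e := congrArg (· ⊳ d ⊠ (one : El X _)) h
  simp only [El.map_comp, map_whiskerLeft] at e
  rw [elAct, UFunctor.act, El.map_comp, map_whiskerLeft]
  exact e.trans (map_rightUnitor_hom d)

/-- Transport of elements of `δ` along an equality of components. -/
def UFunctor.elCast {c c' : Comp O} (h : c = c') {i : C} (d : El X (δ.obj c i)) :
    El X (δ.obj c' i) :=
  eqToHom (congrArg (δ.obj · i) h) ⊳ d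

theorem UFunctor.heq_elCast {c c' : Comp O} (h : c = c') {i : C} (d : El X (δ.obj c i)) :
    HEq (δ.elCast h d) d :=
  heq_map_eqToHom _ _

theorem UFunctor.elCast_elCast {c c' c'' : Comp O} (h : c = c') (h' : c' = c'') {i : C}
    (d : El X (δ.obj c i)) : δ.elCast h' (δ.elCast h d) = δ.elCast (h.trans h') d := by
  subst h h'
  simp [elCast]

theorem UFunctor.elCast_rfl {c : Comp O} {i : C} (d : El X (δ.obj c i)) : δ.elCast rfl d = d := by
  simp [elCast]

theorem UFunctor.elAct_castU {c c' : Comp O} (h : c = c') {i j : C} (d : El X (δ.obj c i))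
    (u : El X (uHom P c i j)) :
    δ.elAct (δ.elCast h d) (P.castU h u) = δ.elCast h (δ.elAct d u) := by
  subst h
  simp [elCast, PreOperad.castU]

variable (T : O)

/-- The contravariant action on the terms of the convolution product. -/
def convLeft (i : C) (a b : Fin (card T) → C) :
    ((tens fun k => uHom P (src T k) (a k) (b k)) ⊗ P.obj (colObj T b i)) ⊗
      (tens fun k => δ.obj (src T k) (a k)) ⟶
    P.obj (colObj T a i) ⊗ tens fun k => δ.obj (src T k) (a k) :=
  contraAct P T a b i ▷ _

/-- The covariant action on the terms of the convolution product. -/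
def convRight (i : C) (a b : Fin (card T) → C) :
    ((tens fun k => uHom P (src T k) (a k) (b k)) ⊗ P.obj (colObj T b i)) ⊗
      (tens fun k => δ.obj (src T k) (a k)) ⟶
    P.obj (colObj T b i) ⊗ tens fun k => δ.obj (src T k) (b k) :=
  (β_ (tens fun k => uHom P (src T k) (a k) (b k)) (P.obj (colObj T b i))).hom ▷ _ ≫
    (α_ _ _ _).hom ≫
    P.obj (colObj T b i) ◁
      ((β_ (tens fun k => uHom P (src T k) (a k) (b k))
          (tens fun k => δ.obj (src T k) (a k))).hom ≫
        tensZip (fun k => δ.obj (src T k) (a k)) (fun k => uHom P (src T k) (a k) (b k)) ≫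
        tensMap fun k => δ.act (src T k) (a k) (b k))

variable {T}

theorem map_convLeft {i : C} {a b : Fin (card T) → C}
    (u : ∀ k, El X (uHom P (src T k) (a k) (b k))) (p : El X (P.obj (colObj T b i)))
    (d : ∀ k, El X (δ.obj (src T k) (a k))) :
    convLeft δ T i a b ⊳ (tprod u ⊠ p) ⊠ tprod d = P.elContra u p ⊠ tprod d :=
  map_whiskerRight _ _ _

theorem map_convRight {i : C} {a b : Fin (card T) → C}
    (u : ∀ k, El X (uHom P (src T k) (a k) (b k))) (p : El X (P.obj (colObj T b i)))
    (d : ∀ k, El X (δ.obj (src T k) (a k))) :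
    convRight δ T i a b ⊳ (tprod u ⊠ p) ⊠ tprod d =
      p ⊠ tprod fun k => δ.elAct (d k) (u k) := by
  simp only [convRight, El.map_comp, map_whiskerRight, map_braiding_hom, map_associator_hom,
    map_whiskerLeft, map_tensZip, map_tensMap, UFunctor.elAct]

namespace Convolution

variable {δ} (E : Convolution δ T)

theorem isCoend (i : C) : IsCoend (convLeft δ T i) (convRight δ T i) (fun a => E.ι a i) where
  wedge a b := by
    have h := E.wedge a b i
    simpa only [convLeft, convRight, Category.assoc] using h
  existsUnique_desc W x hx := E.existsUnique_desc i W x fun a b => by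
    have h := hx a b
    simpa only [convLeft, convRight, Category.assoc] using h

/-- The elements of the convolution product given by its terms. -/
def el (a : Fin (card T) → C) (i : C) (p : El X (P.obj (colObj T a i)))
    (d : ∀ k, El X (δ.obj (src T k) (a k))) : El X (E.obj i) :=
  E.ι a i ⊳ p ⊠ tprod d

theorem el_contra {a b : Fin (card T) → C} {i : C}
    (u : ∀ k, El X (uHom P (src T k) (a k) (b k))) (p : El X (P.obj (colObj T b i)))
    (d : ∀ k, El X (δ.obj (src T k) (a k))) :
    E.el a i (P.elContra u p) d = E.el b i p fun k => δ.elAct (d k) (u k) := by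
  have h := congrArg (· ⊳ (tprod u ⊠ p) ⊠ tprod d) ((E.isCoend i).wedge a b)
  simp only [El.map_comp, map_convLeft, map_convRight] at h
  exact h

theorem act_el {a : Fin (card T) → C} {i j : C} (p : El X (P.obj (colObj T a i)))
    (d : ∀ k, El X (δ.obj (src T k) (a k))) (u : El X (uHom P (π₀ T) i j)) :
    E.act i j ⊳ E.el a i p d ⊠ u = E.el a j (P.elCo p u) d := by
  have h := congrArg (· ⊳ (p ⊠ tprod d) ⊠ u) (E.ι_act a i j)
  simp only [El.map_comp, map_whiskerRight, map_braiding_hom, map_associator_hom,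
    map_associator_inv, map_whiskerLeft] at h
  exact h

/-- Tensoring preserves the coend, so its terms determine the map, and on the terms the test by
elements applies. General elements of a convolution product are not classes of terms, but for
equality of morphisms such classes suffice. -/
theorem hom_ext_left (s : Shape V) {i : C} {W : V} {F G : s.eval ⊗ E.obj i ⟶ W}
    (h : ∀ (ι : Type) (X : ι → V) (z : s.Fam X) (a : Fin (card T) → C)
      (p : El X (P.obj (colObj T a i))) (d : ∀ k, El X (δ.obj (src T k) (a k))),
      F ⊳ s.total z ⊠ E.el a i p d = G ⊳ s.total z ⊠ E.el a i p d) : F = G := by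
  refine ((E.isCoend i).whiskerLeft s.eval).hom_ext fun a => ?_
  refine Shape.hom_ext (.mul s (.mul (.leaf (P.obj (colObj T a i)))
    (.tens _ fun k => .leaf (δ.obj (src T k) (a k))))) fun ι X x => ?_
  exact (El.map_comp _ _ _).trans ((congrArg (F ⊳ ·) (map_whiskerLeft _ _ _)).trans
    ((h ι X x.1 a x.2.1 x.2.2).trans ((El.map_comp _ _ _).trans
      (congrArg (G ⊳ ·) (map_whiskerLeft _ _ _))).symm))

theorem hom_ext_right {Z : V} {i : C} {W : V} {F G : E.obj i ⊗ Z ⟶ W}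
    (h : ∀ (ι : Type) (X : ι → V) (z : El X Z) (a : Fin (card T) → C)
      (p : El X (P.obj (colObj T a i))) (d : ∀ k, El X (δ.obj (src T k) (a k))),
      F ⊳ E.el a i p d ⊠ z = G ⊳ E.el a i p d ⊠ z) : F = G := by
  rw [← cancel_epi (β_ Z (E.obj i)).hom]
  refine E.hom_ext_left (.leaf Z) fun ι X z a p d => ?_
  exact (El.map_comp _ _ _).trans ((congrArg (F ⊳ ·) (map_braiding_hom _ _)).trans
    ((h ι X z a p d).trans ((El.map_comp _ _ _).trans
      (congrArg (G ⊳ ·) (map_braiding_hom _ _))).symm))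

theorem hom_ext_el {i : C} {W : V} {F G : E.obj i ⟶ W}
    (h : ∀ (ι : Type) (X : ι → V) (a : Fin (card T) → C)
      (p : El X (P.obj (colObj T a i))) (d : ∀ k, El X (δ.obj (src T k) (a k))),
      F ⊳ E.el a i p d = G ⊳ E.el a i p d) : F = G := by
  refine (E.isCoend i).hom_ext fun a => ?_
  refine Shape.hom_ext (.mul (.leaf (P.obj (colObj T a i)))
    (.tens _ fun k => .leaf (δ.obj (src T k) (a k)))) fun ι X x => ?_
  exact (El.map_comp _ _ _).trans ((h ι X a x.1 x.2).trans (El.map_comp _ _ _).symm)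

end Convolution

end

variable {P : Operad (Colored O C) V} (δ : UFunctor P.toPreOperad V)

/-- The identities of U(P) give a common section of both legs, by the unit laws of `P` and `δ`. Thus
the coends are reflexive, as the tensor product of coends requires. -/
theorem exists_convSection (T : O) (i : C) (a : Fin (card T) → C) :
    ∃ s, s ≫ convLeft δ T i a a = 𝟙 _ ∧ s ≫ convRight δ T i a a = 𝟙 _ := by
  refine ⟨((λ_ _).inv ≫ (tensUnit (card T) ≫
    tensMap fun k => uId P.toPreOperad (src T k) (a k)) ▷ _) ▷ _, ?_, ?_⟩
  all_goals
    refine hom_ext_tmul_tprod fun ι X p d => ?_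
    simp only [El.map_comp, map_whiskerRight, map_leftUnitor_inv, map_tensUnit, map_tensMap,
      El.map_id]
  · refine (map_convLeft δ (fun k => P.elUId (src T k) (a k)) p d).trans ?_
    rw [P.elContra_id]
  · refine (map_convRight δ (fun k => P.elUId (src T k) (a k)) p d).trans ?_
    simp only [UFunctor.elAct_id]

/-- The covariant action descends to the coend because it commutes with the contravariant one
(`Operad.elCo_contra`) and tensoring preserves the coend. -/
theorem nonempty_convolution [HasColimits V] (T : O) : Nonempty (Convolution δ T) := by
  choose E e hE using fun i => exists_isCoend (convLeft δ T i) (convRight δ T i)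
  have h : ∀ i j, ∃ y : E i ⊗ uHom P.toPreOperad (π₀ T) i j ⟶ E j, ∀ a,
      e i a ▷ uHom P.toPreOperad (π₀ T) i j ≫ y =
        (α_ _ _ _).hom ≫ P.obj (colObj T a i) ◁ (β_ _ _).hom ≫ (α_ _ _ _).inv ≫
          coAct P.toPreOperad T a i j ▷ (tens fun k => δ.obj (src T k) (a k)) ≫ e j a := by
    intro i j
    refine (((hE i).whiskerRight (uHom P.toPreOperad (π₀ T) i j)).existsUnique_desc (E j) _
      fun a b => ?_).exists
    refine hom_ext_relation fun ι X u p d v => ?_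
    simp only [El.map_comp, map_whiskerRight, map_convLeft, map_convRight, map_associator_hom,
      map_whiskerLeft, map_braiding_hom, map_associator_inv]
    have h₁ := congrArg (· ⊳ (tprod u ⊠ P.elCo p v) ⊠ tprod d) ((hE j).wedge a b)
    simp only [El.map_comp, map_convLeft, map_convRight] at h₁
    rw [← P.elCo_contra] at h₁
    simp only [PreOperad.elCo] at h₁
    exact h₁
  choose y hy using h
  exact ⟨{
    obj := E
    ι := fun a i => e i a
    wedge := fun a b i => by
      have h := (hE i).wedge a b
      simpa only [convLeft, convRight, Category.assoc] using h
    existsUnique_desc := fun i W x hx => (hE i).existsUnique_desc W x fun a b => by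
      have h := hx a b
      simpa only [convLeft, convRight, Category.assoc] using h
    act := y
    ι_act := fun a i j => hy i j a }⟩

/-- Morphisms out of tensor products of convolution products agree if they agree on the terms. -/
theorem tens_convolution_hom_ext (s : Shape V) {n : ℕ} {T : Fin n → O}
    (E : ∀ k, Convolution δ (T k)) (i : Fin n → C) {W : V}
    {F G : s.eval ⊗ (tens fun k => (E k).obj (i k)) ⟶ W}
    (h : ∀ (ι : Type) (X : ι → V) (z : s.Fam X) (a : ∀ k, Fin (card (T k)) → C)
      (p : ∀ k, El X (P.obj (colObj (T k) (a k) (i k))))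
      (d : ∀ k l, El X (δ.obj (src (T k) l) (a k l))),
      (F ⊳ s.total z ⊠ tprod fun k => (E k).el (a k) (i k) (p k) (d k)) =
        G ⊳ s.total z ⊠ tprod fun k => (E k).el (a k) (i k) (p k) (d k)) : F = G := by
  refine ((isCoend_tens (fun k => (E k).isCoend (i k)) fun k a =>
    exists_convSection δ (T k) (i k) a).1.whiskerLeft s.eval).hom_ext fun a => ?_
  refine Shape.hom_ext (.mul s (.tens _ fun k => .mul (.leaf (P.obj (colObj (T k) (a k) (i k))))
    (.tens _ fun l => .leaf (δ.obj (src (T k) l) (a k l))))) fun ι X x => ?_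
  have e : ∀ H : s.eval ⊗ (tens fun k => (E k).obj (i k)) ⟶ W,
      H ⊳ (s.eval ◁ tensMap fun k => (E k).ι (a k) (i k)) ⊳
        s.total x.1 ⊠ (tprod fun k => (x.2 k).1 ⊠ tprod (x.2 k).2) =
      H ⊳ s.total x.1 ⊠ tprod fun k => (E k).el (a k) (i k) (x.2 k).1 (x.2 k).2 := fun H => by
    rw [map_whiskerLeft, map_tensMap]
    rfl
  exact (El.map_comp _ _ _).trans ((e F).trans ((h ι X x.1 a (fun k => (x.2 k).1)
    fun k => (x.2 k).2).trans ((e G).symm.trans (El.map_comp _ _ _).symm)))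

end ConvolutionElements

end

/-! ### Invertibility of the regrouping maps -/

noncomputable section

open OperadicData OperadicCategory El

section Isos

variable {V : Type u} [Category.{v} V] [MonoidalCategory V]

theorem isIso_tensMap {n : ℕ} {Y Z : Fin n → V} (f : ∀ i, Y i ⟶ Z i) (h : ∀ i, IsIso (f i)) :
    IsIso (tensMap f) := by
  induction n with
  | zero => exact inferInstanceAs (IsIso (𝟙 _))
  | succ n ih =>
    have := ih (fun i => f i.succ) fun i => h _
    have := h 0
    exact inferInstanceAs (IsIso (f 0 ⊗ₘ tensMap fun i => f i.succ))

theorem isIso_tensUnit (n : ℕ) : IsIso (tensUnit n : 𝟙_ V ⟶ _) := by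
  induction n with
  | zero => exact inferInstanceAs (IsIso (𝟙 _))
  | succ n ih => exact inferInstanceAs (IsIso ((λ_ (𝟙_ V)).inv ≫ 𝟙_ V ◁ tensUnit n))

theorem isIso_tensCounit (n : ℕ) : IsIso (tensCounit n : _ ⟶ 𝟙_ V) := by
  induction n with
  | zero => exact inferInstanceAs (IsIso (𝟙 _))
  | succ n ih => exact inferInstanceAs (IsIso (𝟙_ V ◁ tensCounit n ≫ (λ_ (𝟙_ V)).hom))

theorem isIso_spread {A : V} {n : ℕ} (p : Fin n) (Y : Fin n → V) (a : A ⟶ Y p)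
    (b : ∀ i, i ≠ p → (𝟙_ V ⟶ Y i)) (ha : IsIso a) (hb : ∀ i h, IsIso (b i h)) :
    IsIso (spread p Y a b) := by
  induction n with
  | zero => exact p.elim0
  | succ n ih =>
    induction p using Fin.cases with
    | zero =>
      have := isIso_tensMap (fun i : Fin n => b i.succ (Fin.succ_ne_zero i)) fun i => hb _ _
      have := isIso_tensUnit (V := V) n
      exact inferInstanceAs (IsIso ((ρ_ A).inv ≫
        (a ⊗ₘ (tensUnit n ≫ tensMap fun i => b i.succ (Fin.succ_ne_zero i)))))
    | succ q =>
      have := ih q (fun i => Y i.succ) a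
        (fun i hi => b i.succ fun h => hi (Fin.succ_injective _ h)) ha fun i h => hb _ _
      have := hb 0 (Fin.succ_ne_zero q).symm
      exact inferInstanceAs (IsIso ((λ_ A).inv ≫ (b 0 (Fin.succ_ne_zero q).symm ⊗ₘ
        spread q (fun i => Y i.succ) a fun i hi => b i.succ fun h => hi (Fin.succ_injective _ h))))

theorem isIso_collapse {A : V} {n : ℕ} (p : Fin n) (Y : Fin n → V) (a : Y p ⟶ A)
    (b : ∀ i, i ≠ p → (Y i ⟶ 𝟙_ V)) (ha : IsIso a) (hb : ∀ i h, IsIso (b i h)) :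
    IsIso (collapse p Y a b) := by
  induction n with
  | zero => exact p.elim0
  | succ n ih =>
    induction p using Fin.cases with
    | zero =>
      have := isIso_tensMap (fun i : Fin n => b i.succ (Fin.succ_ne_zero i)) fun i => hb _ _
      have := isIso_tensCounit (V := V) n
      exact inferInstanceAs (IsIso ((a ⊗ₘ ((tensMap fun i : Fin n =>
        b i.succ (Fin.succ_ne_zero i)) ≫ tensCounit n)) ≫ (ρ_ A).hom))
    | succ q =>
      have := ih q (fun i => Y i.succ) a
        (fun i hi => b i.succ fun h => hi (Fin.succ_injective _ h)) ha fun i h => hb _ _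
      have := hb 0 (Fin.succ_ne_zero q).symm
      exact inferInstanceAs (IsIso ((b 0 (Fin.succ_ne_zero q).symm ⊗ₘ
        collapse q (fun i => Y i.succ) a fun i hi => b i.succ fun h => hi (Fin.succ_injective _ h))
          ≫ (λ_ A).hom))

variable [BraidedCategory V]

theorem isIso_tensZip {n : ℕ} (Y Z : Fin n → V) : IsIso (tensZip Y Z) := by
  induction n with
  | zero => exact inferInstanceAs (IsIso (λ_ (𝟙_ V)).hom)
  | succ n ih =>
    have := ih (fun i => Y i.succ) fun i => Z i.succ
    have : IsIso (tensorμ (Y 0) (tens fun i => Y i.succ) (Z 0) (tens fun i => Z i.succ)) := by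
      unfold tensorμ
      infer_instance
    exact inferInstanceAs (IsIso
      (tensorμ (Y 0) (tens fun i => Y i.succ) (Z 0) (tens fun i => Z i.succ) ≫
        (Y 0 ⊗ Z 0) ◁ tensZip (fun i => Y i.succ) (fun i => Z i.succ)))

theorem isIso_tensSwap {m n : ℕ} (Y : Fin m → Fin n → V) : IsIso (tensSwap Y) := by
  induction m with
  | zero => exact isIso_tensUnit n
  | succ m ih =>
    have := ih fun j => Y j.succ
    have := isIso_tensZip (fun i => Y 0 i) (fun i => tens fun j => Y j.succ i)
    exact inferInstanceAs (IsIso ((tens fun i => Y 0 i) ◁ tensSwap (fun j => Y j.succ) ≫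
      tensZip (fun i => Y 0 i) (fun i => tens fun j => Y j.succ i)))

/-- The multitensor is prescribed only after its terms have been regrouped. Inverting the regrouping
turns the prescription into maps out of the terms of a coend. -/
theorem isIso_tensRegroup {m n : ℕ} {c : Fin n → ℕ} (e : (Σ i : Fin n, Fin (c i)) ≃ Fin m)
    (Y : Fin m → V) : IsIso (tensRegroup e Y) := by
  unfold tensRegroup
  dsimp only
  refine @IsIso.comp_isIso _ _ _ _ _ _ _ (isIso_tensMap _ fun j => ?_)
    (@IsIso.comp_isIso _ _ _ _ _ _ _ (isIso_tensSwap _) (isIso_tensMap _ fun i =>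
      @IsIso.comp_isIso _ _ _ _ _ _ _ (isIso_tensSwap _) (isIso_tensMap _ fun k => ?_)))
  · refine isIso_spread _ _ _ _ (isIso_spread _ _ _ _ inferInstance fun k h => inferInstance)
      fun i h => ?_
    exact @IsIso.comp_isIso _ _ _ _ _ _ _ (isIso_tensUnit _)
      (isIso_tensMap _ fun k => inferInstance)
  · exact isIso_collapse _ _ _ _ inferInstance fun j h => inferInstance

/-- Distribute the factors of two tensor products over the parts of a partition `e` of the index
set of the second. -/
def tensDistrib {m n : ℕ} {c : Fin n → ℕ} (e : (Σ i : Fin n, Fin (c i)) ≃ Fin m) {A : Fin n → V}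
    {B : V} {Y : Fin m → V} {Z : ∀ k, Fin (c k) → V} (h : ∀ k l, Y (e ⟨k, l⟩) ⟶ Z k l) :
    (tens A ⊗ B) ⊗ tens Y ⟶ B ⊗ tens fun k => A k ⊗ tens (Z k) :=
  (β_ _ _).hom ▷ _ ≫ (α_ _ _ _).hom ≫
    B ◁ (tens A ◁ (tensRegroup e Y ≫ tensMap fun k => tensMap (h k)) ≫
      tensZip A (fun k => tens (Z k)))

theorem isIso_tensDistrib {m n : ℕ} {c : Fin n → ℕ} (e : (Σ i : Fin n, Fin (c i)) ≃ Fin m)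
    {A : Fin n → V} {B : V} {Y : Fin m → V} {Z : ∀ k, Fin (c k) → V}
    (h : ∀ k l, Y (e ⟨k, l⟩) ⟶ Z k l) (hh : ∀ k l, IsIso (h k l)) :
    IsIso (tensDistrib (A := A) (B := B) e h) := by
  have := isIso_tensRegroup e Y
  have := isIso_tensMap (fun k => tensMap (h k)) fun k => isIso_tensMap _ (hh k)
  have := isIso_tensZip A (fun k => tens (Z k))
  unfold tensDistrib
  infer_instance

/-- Distribute the factors of two tensor products over the parts of a partition `e` of the index
set of the first. -/
def tensDistrib' {m n : ℕ} {c : Fin n → ℕ} (e : (Σ i : Fin n, Fin (c i)) ≃ Fin m) {A : Fin n → V}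
    {B : V} {Y : Fin m → V} {Z : ∀ k, Fin (c k) → V} (h : ∀ k l, Y (e ⟨k, l⟩) ⟶ Z k l) :
    (tens Y ⊗ B) ⊗ tens A ⟶ B ⊗ tens fun k => tens (Z k) ⊗ A k :=
  (β_ _ _).hom ▷ _ ≫ (α_ _ _ _).hom ≫
    B ◁ ((tensRegroup e Y ≫ tensMap fun k => tensMap (h k)) ▷ tens A ≫
      tensZip (fun k => tens (Z k)) A)

/-- Used to index the iterated coend by colourings of |T| instead of families of colourings of the
fibres. -/
theorem IsCoend.reindex {V : Type u} [Category.{v} V] {A B : Type v} {G : A → V} {R : A → A → V}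
    {l : ∀ a b, R a b ⟶ G a} {r : ∀ a b, R a b ⟶ G b} {E : V} {p : ∀ a, G a ⟶ E}
    (h : IsCoend l r p) (e : B ≃ A) :
    IsCoend (G := fun b => G (e b)) (R := fun b b' => R (e b) (e b')) (fun b b' => l (e b) (e b'))
      (fun b b' => r (e b) (e b')) (fun b => p (e b)) where
  wedge a b := h.wedge _ _
  existsUnique_desc W x hx := by
    obtain ⟨x, rfl⟩ : ∃ x' : ∀ a, G a ⟶ W, x = fun b => x' (e b) :=
      ⟨Equiv.piCongrLeft (fun a => G a ⟶ W) e x,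
        funext fun b => (Equiv.piCongrLeft_apply_apply (fun a => G a ⟶ W) e x b).symm⟩
    obtain ⟨y, hy, hy'⟩ := h.existsUnique_desc W x (e.surjective.forall₂.2 hx)
    exact ⟨y, fun b => hy _, fun z hz => hy' z (e.surjective.forall.2 hz)⟩

end Isos

section

variable {V : Type u} [Category.{v} V] [MonoidalCategory V] [SymmetricCategory V]
  {ι : Type} {X : ι → V} {m n : ℕ} {c : Fin n → ℕ} (e : (Σ i : Fin n, Fin (c i)) ≃ Fin m)
  {A : Fin n → V} {B : V} {Y : Fin m → V} {Z : ∀ k, Fin (c k) → V}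
  (h : ∀ k l, Y (e ⟨k, l⟩) ⟶ Z k l)

theorem map_regroup (y : ∀ j, El X (Y j)) :
    (tensRegroup e Y ≫ tensMap fun k => tensMap (h k)) ⊳ El.tprod y =
      El.tprod fun k => El.tprod fun l => h k l ⊳ y (e ⟨k, l⟩) := by
  rw [El.map_comp, map_tensRegroup]
  exact (map_tensMap _ _).trans (congrArg El.tprod (funext fun k => map_tensMap _ _))

theorem map_tensDistrib (a : ∀ k, El X (A k)) (b : El X B) (y : ∀ j, El X (Y j)) :
    tensDistrib e h ⊳ (El.tprod a ⊠ b) ⊠ El.tprod y =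
      b ⊠ El.tprod fun k => a k ⊠ El.tprod fun l => h k l ⊳ y (e ⟨k, l⟩) := by
  simp only [tensDistrib, El.map_comp (f := (β_ _ _).hom ▷ _), El.map_comp (f := (α_ _ _ _).hom),
    map_whiskerRight, map_braiding_hom, map_associator_hom, map_whiskerLeft]
  rw [El.map_comp, map_whiskerLeft, map_regroup, map_tensZip]

theorem map_tensDistrib' (a : ∀ k, El X (A k)) (b : El X B) (y : ∀ j, El X (Y j)) :
    tensDistrib' e h ⊳ (El.tprod y ⊠ b) ⊠ El.tprod a =
      b ⊠ El.tprod fun k => (El.tprod fun l => h k l ⊳ y (e ⟨k, l⟩)) ⊠ a k := by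
  simp only [tensDistrib', El.map_comp (f := (β_ _ _).hom ▷ _), El.map_comp (f := (α_ _ _ _).hom),
    map_whiskerRight, map_braiding_hom, map_associator_hom, map_whiskerLeft]
  rw [El.map_comp, map_whiskerRight, map_regroup, map_tensZip]

end

/-! ### Families indexed by the fibres of a map -/

section FibreFamilies

variable {O : Type uo} [Category.{vo} O] [OperadicCategory.{w} O]

/-- The fibres partition |T|, and the component attached to a position does not depend on whether it
is computed in the fibre or in `T` (`src_fib`). -/
theorem exists_fibre_family {T S : O} (f : T ⟶ S) {A : Comp O → Fin (card T) → Type*}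
    (x : ∀ k l, A (src (fib f k) l) (emb f k l)) :
    ∃ y : ∀ j, A (src T j) j, ∀ k l, HEq (x k l) (y (emb f k l)) := by
  have h : ∀ j, ∃ y : A (src T j) j, ∀ k l, emb f k l = j → HEq (x k l) y := by
    intro j
    obtain ⟨⟨k, l⟩, rfl⟩ := (embEquiv f).surjective j
    refine ⟨cast (congrArg (A · _) (src_fib f k l)) (x k l), fun k' l' h => ?_⟩
    have h' : (⟨k', l'⟩ : Σ i : Fin (card S), Fin (card (fib f i))) = ⟨k, l⟩ :=
      (embEquiv f).injective h
    cases h'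
    exact (cast_heq _ _).symm
  choose y hy using h
  exact ⟨y, fun k l => hy _ k l rfl⟩

/-- Families indexed by `|T|` are families indexed by the fibres of a map out of `T`. -/
def fibreFamilies {T S : O} (f : T ⟶ S) (C : Type v) :
    (Fin (card T) → C) ≃ (∀ k, Fin (card (fib f k)) → C) :=
  Equiv.ofBijective (fun b k => b ∘ emb f k) (by
    constructor
    · intro b b' h
      funext j
      obtain ⟨⟨k, l⟩, rfl⟩ := (embEquiv f).surjective j
      exact congrFun (congrFun h k) l
    · intro b
      obtain ⟨y, hy⟩ := exists_fibre_family f (A := fun _ _ => C) b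
      exact ⟨y, funext fun k => funext fun l => (eq_of_heq (hy k l)).symm⟩)

end FibreFamilies

section

variable {V : Type u} [Category.{v} V] [MonoidalCategory V] [SymmetricCategory V]
  {ι : Type} {X : ι → V} {O : Type uo} [Category.{vo} O] [OperadicCategory.{w} O] {C : Type v}

theorem PreOperad.exists_fibre_family (P : PreOperad (Colored O C) V) {T S : O} (f : T ⟶ S)
    {b b' : Fin (card T) → C}
    (u : ∀ k l, El X (uHom P (src (fib f k) l) (b (emb f k l)) (b' (emb f k l)))) :
    ∃ u' : ∀ j, El X (uHom P (src T j) (b j) (b' j)),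
      u = fun k l => P.castU (src_fib f k l).symm (u' (emb f k l)) := by
  obtain ⟨y, hy⟩ := OpCond.exists_fibre_family f (A := fun c j => El X (uHom P c (b j) (b' j))) u
  exact ⟨y, funext fun k => funext fun l =>
    eq_of_heq ((hy k l).trans (P.heq_castU _ _).symm)⟩

/-- The multiplication along a map of `O` between coloured objects. -/
def colMulHom (P : PreOperad (Colored O C) V) {T S : O} (f : T ⟶ S) (b : Fin (card T) → C)
    (a : Fin (card S) → C) (i : C) :
    (tens fun k => P.obj (colObj (fib f k) (b ∘ emb f k) (a k))) ⊗ P.obj (colObj S a i) ⟶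
      P.obj (colObj T b i) :=
  P.mul (colHom f b a i)

theorem map_colMulHom (P : PreOperad (Colored O C) V) {T S : O} (f : T ⟶ S)
    {b : Fin (card T) → C} {a : Fin (card S) → C} {i : C}
    (x : ∀ k, El X (P.obj (colObj (fib f k) (b ∘ emb f k) (a k))))
    (y : El X (P.obj (colObj S a i))) :
    colMulHom P f b a i ⊳ El.tprod x ⊠ y = P.colMul f b a i x y := rfl

end

/-! ### Existence of the multitensor structure -/

section Multitensor

variable {V : Type u} [Category.{v} V] [MonoidalCategory V] [SymmetricCategory V]
  [MonoidalClosed V] {ι : Type} {X : ι → V}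
  {O : Type uo} [Category.{vo} O] [OperadicCategory.{w} O] {C : Type v}
  {P : Operad (Colored O C) V} {δ : UFunctor P.toPreOperad V}

theorem UFunctor.exists_fibre_family (δ : UFunctor P.toPreOperad V) {T S : O} (f : T ⟶ S)
    {b : Fin (card T) → C} (d : ∀ k l, El X (δ.obj (src (fib f k) l) (b (emb f k l)))) :
    ∃ d' : ∀ j, El X (δ.obj (src T j) (b j)),
      d = fun k l => δ.elCast (src_fib f k l).symm (d' (emb f k l)) := by
  obtain ⟨y, hy⟩ := OpCond.exists_fibre_family f (A := fun c j => El X (δ.obj c (b j))) d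
  exact ⟨y, funext fun k => funext fun l =>
    eq_of_heq ((hy k l).trans (δ.heq_elCast _ _).symm)⟩

/-- The restriction of a family of elements of `δ` to the fibres of a map. -/
def UFunctor.elRes (δ : UFunctor P.toPreOperad V) {T S : O} (f : T ⟶ S) {b : Fin (card T) → C}
    (d : ∀ j, El X (δ.obj (src T j) (b j))) (k : Fin (card S)) (l : Fin (card (fib f k))) :
    El X (δ.obj (src (fib f k) l) ((b ∘ emb f k) l)) :=
  δ.elCast (src_fib f k l).symm (d (emb f k l))

variable (E : ∀ T, Convolution δ T)

/-- Morphisms out of the convolution products of the fibres of a map agree if they agree on the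
terms. -/
theorem fibre_hom_ext (s : Shape V) {T S : O} (f : T ⟶ S) (a : Fin (card S) → C) {W : V}
    {F G : s.eval ⊗ (tens fun k => (E (fib f k)).obj (a k)) ⟶ W}
    (h : ∀ (ι : Type) (X : ι → V) (z : s.Fam X) (b : Fin (card T) → C)
      (p : ∀ k, El X (P.obj (colObj (fib f k) (b ∘ emb f k) (a k))))
      (d : ∀ j, El X (δ.obj (src T j) (b j))),
      (F ⊳ s.total z ⊠ tprod fun k => (E (fib f k)).el (b ∘ emb f k) (a k) (p k)
        (δ.elRes f d k)) =
      G ⊳ s.total z ⊠ tprod fun k => (E (fib f k)).el (b ∘ emb f k) (a k) (p k)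
        (δ.elRes f d k)) : F = G := by
  refine tens_convolution_hom_ext δ s (fun k => E (fib f k)) a fun ι X z b p d => ?_
  obtain ⟨b, rfl⟩ := (fibreFamilies f C).surjective b
  obtain ⟨d, rfl⟩ := δ.exists_fibre_family f d
  exact h ι X z b p d

/-- Regrouping the terms of an iterated convolution product along the fibres of a map. -/
def termRegroup (P : PreOperad (Colored O C) V) (δ : UFunctor P V) {T S : O} (f : T ⟶ S)
    (b : Fin (card T) → C) (a : Fin (card S) → C) (i : C) :
    ((tens fun k => P.obj (colObj (fib f k) (b ∘ emb f k) (a k))) ⊗ P.obj (colObj S a i)) ⊗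
        (tens fun l => δ.obj (src T l) (b l)) ⟶
      P.obj (colObj S a i) ⊗ tens fun k => P.obj (colObj (fib f k) (b ∘ emb f k) (a k)) ⊗
        tens fun l => δ.obj (src (fib f k) l) ((b ∘ emb f k) l) :=
  tensDistrib (embEquiv f) fun k l =>
    eqToHom (congrArg (δ.obj · (b (emb f k l))) (src_fib f k l).symm)

theorem isIso_termRegroup {T S : O} (f : T ⟶ S) (b : Fin (card T) → C) (a : Fin (card S) → C)
    (i : C) : IsIso (termRegroup P.toPreOperad δ f b a i) :=
  isIso_tensDistrib _ _ fun k l => inferInstanceAs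
    (IsIso (eqToHom (congrArg (δ.obj · (b (emb f k l))) (src_fib f k l).symm)))

theorem map_termRegroup {T S : O} (f : T ⟶ S) {b : Fin (card T) → C} {a : Fin (card S) → C}
    {i : C} (p : ∀ k, El X (P.obj (colObj (fib f k) (b ∘ emb f k) (a k))))
    (q : El X (P.obj (colObj S a i))) (d : ∀ j, El X (δ.obj (src T j) (b j))) :
    termRegroup P.toPreOperad δ f b a i ⊳ (El.tprod p ⊠ q) ⊠ El.tprod d =
      q ⊠ El.tprod fun k => p k ⊠ El.tprod (δ.elRes f d k) :=
  map_tensDistrib _ _ p q d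

/-- The multiplication of the operad on the terms of an iterated convolution product. -/
def termMul {T S : O} (f : T ⟶ S) (b : Fin (card T) → C) (a : Fin (card S) → C) (i : C) :
    ((tens fun k => P.obj (colObj (fib f k) (b ∘ emb f k) (a k))) ⊗ P.obj (colObj S a i)) ⊗
        (tens fun l => δ.obj (src T l) (b l)) ⟶ (E T).obj i :=
  P.mul (colHom f b a i) ▷ (tens fun l => δ.obj (src T l) (b l)) ≫ (E T).ι b i

theorem map_termMul {T S : O} (f : T ⟶ S) {b : Fin (card T) → C} {a : Fin (card S) → C}
    {i : C} (p : ∀ k, El X (P.obj (colObj (fib f k) (b ∘ emb f k) (a k))))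
    (q : El X (P.obj (colObj S a i))) (d : ∀ j, El X (δ.obj (src T j) (b j))) :
    termMul E f b a i ⊳ (tprod p ⊠ q) ⊠ tprod d = (E T).el b i (P.colMul f b a i p q) d :=
  (El.map_comp _ _ _).trans (congrArg ((E T).ι b i ⊳ ·) (map_whiskerRight _ _ _))

/-- The tensor product of the convolution products of the fibres is a coend over all colourings of
|T|, by `isCoend_tens` and `IsCoend.reindex`. A map out of it is therefore given on terms, where it
multiplies in `P`; the coend relations are respected by `Operad.colMul_contra`. -/
theorem exists_multitensor {T S : O} (f : T ⟶ S) (a : Fin (card S) → C) (i : C) :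
    ∃ μ : P.obj (colObj S a i) ⊗ (tens fun k => (E (fib f k)).obj (a k)) ⟶ (E T).obj i,
      ∀ b : Fin (card T) → C, termMul E f b a i = termRegroup P.toPreOperad δ f b a i ≫
        P.obj (colObj S a i) ◁ (tensMap fun k => (E (fib f k)).ι (b ∘ emb f k) (a k)) ≫ μ := by
  have H := ((isCoend_tens (fun k => (E (fib f k)).isCoend (a k)) fun k b =>
    exists_convSection δ (fib f k) (a k) b).1.whiskerLeft (P.obj (colObj S a i))).reindex
      (fibreFamilies f C)
  have hiso := fun b => isIso_termRegroup (P := P) (δ := δ) f b a i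
  let x : ∀ b : Fin (card T) → C, (P.obj (colObj S a i) ⊗ tens fun k =>
      P.obj (colObj (fib f k) (b ∘ emb f k) (a k)) ⊗
        tens fun l => δ.obj (src (fib f k) l) ((b ∘ emb f k) l)) ⟶ (E T).obj i :=
    fun b => @inv _ _ _ _ _ (hiso b) ≫ termMul E f b a i
  have hx : ∀ b, termRegroup P.toPreOperad δ f b a i ≫ x b = termMul E f b a i :=
    fun b => @IsIso.hom_inv_id_assoc _ _ _ _ _ (hiso b) _ _
  have key : ∀ {ι : Type} {X : ι → V} (b : Fin (card T) → C)
      (q : El X (P.obj (colObj S a i)))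
      (p : ∀ k, El X (P.obj (colObj (fib f k) (b ∘ emb f k) (a k))))
      (d : ∀ j, El X (δ.obj (src T j) (b j))),
      x b ⊳ (q ⊠ tprod fun k => p k ⊠ tprod (δ.elRes f d k)) =
        (E T).el b i (P.colMul f b a i p q) d := by
    intro ι X b q p d
    rw [← map_termRegroup, ← El.map_comp, hx, map_termMul]
  obtain ⟨μ, hμ, -⟩ := H.existsUnique_desc ((E T).obj i) x (by
    intro b b'
    refine Shape.hom_ext (.mul (.leaf (P.obj (colObj S a i))) (.tens _ fun k => .mul (.mul
      (.tens _ fun l => .leaf (uHom P.toPreOperad (src (fib f k) l) (b (emb f k l))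
        (b' (emb f k l)))) (.leaf (P.obj (colObj (fib f k) (b' ∘ emb f k) (a k)))))
      (.tens _ fun l => .leaf (δ.obj (src (fib f k) l) (b (emb f k l))))))
      fun ι X ⟨q, y⟩ => ?_
    obtain ⟨u, hu⟩ := P.exists_fibre_family f fun k => (y k).1.1
    obtain ⟨d, hd⟩ := δ.exists_fibre_family f fun k => (y k).2
    obtain ⟨p, hp⟩ : ∃ p : ∀ k, El X (P.obj (colObj (fib f k) (b' ∘ emb f k) (a k))),
      (fun k => (y k).1.2) = p := ⟨_, rfl⟩
    have e : y = fun k => ((fun l => P.castU (src_fib f k l).symm (u (emb f k l)), p k),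
        δ.elRes f d k) :=
      funext fun k => Prod.ext (Prod.ext (congrFun hu k) (congrFun hp k)) (congrFun hd k)
    subst e
    have e₁ := key b q (fun k => P.elContra (a := b ∘ emb f k)
      (fun l => P.castU (src_fib f k l).symm (u (emb f k l))) (p k)) d
    have e₂ := key b' q p fun j => δ.elAct (d j) (u j)
    -- The contravariant action on the inner factors is pulled out of the multiplication, and the
    -- coend relation of `E T` then transfers it to the elements of `δ`.
    replace e₁ := e₁.trans ((congrArg (fun t => (E T).el b i t d) (P.colMul_contra f u p q)).trans
      (((E T).el_contra u _ d).trans e₂.symm))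
    have e₃ : ∀ k l, δ.elRes f (fun j => δ.elAct (d j) (u j)) k l =
        δ.elAct (δ.elRes f d k l) (P.castU (src_fib f k l).symm (u (emb f k l))) :=
      fun k l => (δ.elAct_castU _ _ _).symm
    have h₁ := fun k => map_convLeft δ (a := b ∘ emb f k) (b := b' ∘ emb f k)
      (fun l => P.castU (src_fib f k l).symm (u (emb f k l))) (p k) (δ.elRes f d k)
    have h₂ := fun k => map_convRight δ (a := b ∘ emb f k) (b := b' ∘ emb f k)
      (fun l => P.castU (src_fib f k l).symm (u (emb f k l))) (p k) (δ.elRes f d k)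
    refine (El.map_comp _ _ _).trans ((congrArg (x b ⊳ ·) ((map_whiskerLeft _ _ _).trans
      (congrArg (q ⊠ ·) ((map_tensMap _ _).trans (congrArg El.tprod (funext h₁)))))).trans
        (e₁.trans (Eq.symm ?_)))
    refine (El.map_comp _ _ _).trans (congrArg (x b' ⊳ ·) ((map_whiskerLeft _ _ _).trans
      (congrArg (q ⊠ ·) ((map_tensMap _ _).trans (congrArg El.tprod (funext fun k =>
        (h₂ k).trans (congrArg (fun t => p k ⊠ tprod t) (funext fun l => (e₃ k l).symm))))))))
      )
  exact ⟨μ, fun b => (hx b).symm.trans (congrArg _ (hμ b).symm)⟩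

end Multitensor

end

/-! ### Naturality, associativity and unit of the multitensor -/

noncomputable section

open OperadicData OperadicCategory El

section MultitensorElements

variable {V : Type u} [Category.{v} V] [MonoidalCategory V] [SymmetricCategory V]
  [MonoidalClosed V] {ι : Type} {X : ι → V}
  {O : Type uo} [Category.{vo} O] [OperadicCategory.{w} O] {C : Type v}
  {P : Operad (Colored O C) V} {δ : UFunctor P.toPreOperad V}

/-- The action of the underlying category on elements of a convolution product. -/
def Convolution.elAct {T : O} (E : Convolution δ T) {i j : C} (e : El X (E.obj i))
    (u : El X (uHom P.toPreOperad (π₀ T) i j)) : El X (E.obj j) :=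
  E.act i j ⊳ e ⊠ u

theorem Convolution.elAct_el {T : O} (E : Convolution δ T) {a : Fin (card T) → C} {i j : C}
    (p : El X (P.obj (colObj T a i))) (d : ∀ k, El X (δ.obj (src T k) (a k)))
    (u : El X (uHom P.toPreOperad (π₀ T) i j)) :
    E.elAct (E.el a i p d) u = E.el a j (P.elCo p u) d :=
  E.act_el p d u

variable (E : ∀ T, Convolution δ T)

/-- Transport of elements of convolution products. -/
def convCast {T T' : O} (h : T = T') {i : C} (e : El X ((E T).obj i)) : El X ((E T').obj i) :=
  eqToHom (congrArg (fun T => (E T).obj i) h) ⊳ e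

theorem heq_convCast {T T' : O} (h : T = T') {i : C} (e : El X ((E T).obj i)) :
    HEq (convCast E h e) e :=
  heq_map_eqToHom _ _

theorem conv_el_congr {T T' : O} (h : T = T') {a : Fin (card T) → C} {a' : Fin (card T') → C}
    (ha : ∀ k k', k.1 = k'.1 → a k = a' k') {i i' : C} (hi : i = i')
    {p : El X (P.obj (colObj T a i))} {p' : El X (P.obj (colObj T' a' i'))} (hp : HEq p p')
    {d : ∀ k, El X (δ.obj (src T k) (a k))} {d' : ∀ k, El X (δ.obj (src T' k) (a' k))}
    (hd : ∀ k k', k.1 = k'.1 → HEq (d k) (d' k')) :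
    HEq ((E T).el a i p d) ((E T').el a' i' p' d') := by
  subst h hi
  obtain rfl : a = a' := funext fun k => ha k k rfl
  obtain rfl := eq_of_heq hp
  obtain rfl : d = d' := funext fun k => eq_of_heq (hd k k rfl)
  rfl

theorem fibre_hom_ext_tmul {T S : O} (f : T ⟶ S) (a : Fin (card S) → C) {A B W : V}
    {F G : (A ⊗ B) ⊗ (tens fun k => (E (fib f k)).obj (a k)) ⟶ W}
    (h : ∀ (ι : Type) (X : ι → V) (x : El X A) (y : El X B) (b : Fin (card T) → C)
      (p : ∀ k, El X (P.obj (colObj (fib f k) (b ∘ emb f k) (a k))))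
      (d : ∀ j, El X (δ.obj (src T j) (b j))),
      (F ⊳ (x ⊠ y) ⊠ tprod fun k => (E (fib f k)).el (b ∘ emb f k) (a k) (p k) (δ.elRes f d k)) =
        G ⊳ (x ⊠ y) ⊠ tprod fun k => (E (fib f k)).el (b ∘ emb f k) (a k) (p k)
          (δ.elRes f d k)) : F = G :=
  fibre_hom_ext E (.mul (.leaf A) (.leaf B)) f a fun ι X z b p d => h ι X z.1 z.2 b p d

theorem fibre_hom_ext_tprod_tmul {T S : O} (f : T ⟶ S) (a : Fin (card S) → C) {n : ℕ}
    {A : Fin n → V} {B W : V}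
    {F G : (tens A ⊗ B) ⊗ (tens fun k => (E (fib f k)).obj (a k)) ⟶ W}
    (h : ∀ (ι : Type) (X : ι → V) (x : ∀ k, El X (A k)) (y : El X B) (b : Fin (card T) → C)
      (p : ∀ k, El X (P.obj (colObj (fib f k) (b ∘ emb f k) (a k))))
      (d : ∀ j, El X (δ.obj (src T j) (b j))),
      (F ⊳ (tprod x ⊠ y) ⊠ tprod fun k => (E (fib f k)).el (b ∘ emb f k) (a k) (p k)
          (δ.elRes f d k)) =
        G ⊳ (tprod x ⊠ y) ⊠ tprod fun k => (E (fib f k)).el (b ∘ emb f k) (a k) (p k)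
          (δ.elRes f d k)) : F = G :=
  fibre_hom_ext E (.mul (.tens _ fun k => .leaf (A k)) (.leaf B)) f a
    fun ι X z b p d => h ι X z.1 z.2 b p d

/-- The structure map of the multitensor of convolution products, on the terms of the outer
coend. -/
def multi {T S : O} (f : T ⟶ S) (a : Fin (card S) → C) (i : C) :
    P.obj (colObj S a i) ⊗ (tens fun k => (E (fib f k)).obj (a k)) ⟶ (E T).obj i :=
  (exists_multitensor E f a i).choose

theorem termMul_eq {T S : O} (f : T ⟶ S) (b : Fin (card T) → C) (a : Fin (card S) → C) (i : C) :
    termMul E f b a i = termRegroup P.toPreOperad δ f b a i ≫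
      P.obj (colObj S a i) ◁ (tensMap fun k => (E (fib f k)).ι (b ∘ emb f k) (a k)) ≫
        multi E f a i :=
  (exists_multitensor E f a i).choose_spec b

/-- The structure map of the multitensor on elements. -/
def elMulti {T S : O} (f : T ⟶ S) (a : Fin (card S) → C) (i : C) (p : El X (P.obj (colObj S a i)))
    (e : ∀ k, El X ((E (fib f k)).obj (a k))) : El X ((E T).obj i) :=
  multi E f a i ⊳ p ⊠ tprod e

theorem elMulti_el {T S : O} (f : T ⟶ S) (b : Fin (card T) → C) (a : Fin (card S) → C) (i : C)
    (q : El X (P.obj (colObj S a i)))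
    (p : ∀ k, El X (P.obj (colObj (fib f k) (b ∘ emb f k) (a k))))
    (d : ∀ j, El X (δ.obj (src T j) (b j))) :
    (elMulti E f a i q fun k => (E (fib f k)).el (b ∘ emb f k) (a k) (p k) (δ.elRes f d k)) =
      (E T).el b i (P.colMul f b a i p q) d := by
  rw [← map_termMul, termMul_eq, El.map_comp, map_termRegroup, El.map_comp, map_whiskerLeft,
    map_tensMap]
  rfl

/-- On classes of terms this is `Operad.colMul_co`; it is the relation needed to extend maps over
the outer coend. -/
theorem elMulti_contra {T S : O} (f : T ⟶ S) {a a' : Fin (card S) → C} {i : C}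
    (u : ∀ k, El X (uHom P.toPreOperad (src S k) (a k) (a' k)))
    (q : El X (P.obj (colObj S a' i))) (e : ∀ k, El X ((E (fib f k)).obj (a k))) :
    elMulti E f a i (P.elContra u q) e =
      elMulti E f a' i q fun k => (E (fib f k)).elAct (e k) (P.castU (π₀_fib f k).symm (u k)) := by
  -- An arbitrary element of a convolution product need not be the class of a term. The identity is
  -- therefore proved for morphisms, where classes of terms suffice, and then evaluated on arbitrary
  -- elements. The same device recurs below.
  have h : contraAct P.toPreOperad S a a' i ▷ (tens fun k => (E (fib f k)).obj (a k)) ≫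
      multi E f a i =
      (β_ _ _).hom ▷ _ ≫ (α_ _ _ _).hom ≫ P.obj (colObj S a' i) ◁ ((β_ _ _).hom ≫
        tensZip (fun k => (E (fib f k)).obj (a k))
          (fun k => uHom P.toPreOperad (src S k) (a k) (a' k)) ≫
        tensMap fun k => (E (fib f k)).obj (a k) ◁
          eqToHom (congrArg (fun c => uHom P.toPreOperad c (a k) (a' k)) (π₀_fib f k).symm) ≫
            (E (fib f k)).act (a k) (a' k)) ≫ multi E f a' i := by
    refine fibre_hom_ext_tprod_tmul E f a fun ι X u q b p d => ?_
    refine (El.map_comp _ _ _).trans ((congrArg (multi E f a i ⊳ ·)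
      (map_whiskerRight _ _ _)).trans ((elMulti_el E f b a i (P.elContra u q) p d).trans ?_))
    rw [← P.colMul_co f p u q, ← elMulti_el E]
    symm
    simp only [El.map_comp, map_whiskerRight, map_braiding_hom, map_associator_hom,
      map_whiskerLeft, map_tensZip, map_tensMap]
    refine congrArg (fun t => multi E f a' i ⊳ q ⊠ tprod t) (funext fun k => ?_)
    exact (E (fib f k)).elAct_el (p k) (δ.elRes f d k) (P.castU (π₀_fib f k).symm (u k))
  have h' := congrArg (· ⊳ (tprod u ⊠ q) ⊠ tprod e) h
  simp only [El.map_comp, map_whiskerRight, map_braiding_hom, map_associator_hom,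
      map_whiskerLeft, map_tensZip, map_tensMap] at h'
  exact h'

/-- On classes of terms this is `Operad.elCo_colMul`. -/
theorem elMulti_co {T S : O} (f : T ⟶ S) {a : Fin (card S) → C} {i j : C}
    (q : El X (P.obj (colObj S a i))) (u : El X (uHom P.toPreOperad (π₀ S) i j))
    (e : ∀ k, El X ((E (fib f k)).obj (a k))) :
    elMulti E f a j (P.elCo q u) e =
      (E T).elAct (elMulti E f a i q e) (P.castU (π₀_eq f).symm u) := by
  have h : coAct P.toPreOperad S a i j ▷ (tens fun k => (E (fib f k)).obj (a k)) ≫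
      multi E f a j =
      (α_ _ _ _).hom ≫ P.obj (colObj S a i) ◁ (β_ _ _).hom ≫ (α_ _ _ _).inv ≫
        multi E f a i ▷ _ ≫ (E T).obj i ◁
          eqToHom (congrArg (fun c => uHom P.toPreOperad c i j) (π₀_eq f).symm) ≫
            (E T).act i j := by
    refine fibre_hom_ext_tmul E f a fun ι X q u b p d => ?_
    refine (El.map_comp _ _ _).trans ((congrArg (multi E f a j ⊳ ·)
      (map_whiskerRight _ _ _)).trans ((elMulti_el E f b a j (P.elCo q u) p d).trans ?_))
    rw [← P.elCo_colMul f p q u, ← (E T).elAct_el, ← elMulti_el E]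
    symm
    simp only [El.map_comp, map_whiskerRight, map_braiding_hom, map_associator_hom,
      map_whiskerLeft, map_associator_inv]
    rfl
  have h' := congrArg (· ⊳ (q ⊠ u) ⊠ tprod e) h
  simp only [El.map_comp, map_whiskerRight, map_braiding_hom, map_associator_hom,
      map_whiskerLeft, map_associator_inv] at h'
  exact h'

/-- On classes of terms both sides multiply in `P`, so this is the associativity
`Operad.colMul_assoc`. The remaining work is to identify the fibres of the maps of fibres with the
fibres of `f`, including their positions in |T|. -/
theorem elMulti_assoc {T S R : O} (f : T ⟶ S) (g : S ⟶ R) (a : Fin (card S) → C)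
    (c : Fin (card R) → C) (i : C)
    (p : ∀ k, El X (P.obj (colObj (fib g k) (a ∘ emb g k) (c k))))
    (q : El X (P.obj (colObj R c i))) (e : ∀ j, El X ((E (fib f j)).obj (a j))) :
    elMulti E f a i (P.colMul g a c i p q) e =
      elMulti E (f ≫ g) c i q fun k => elMulti E (fibMap f g k) (a ∘ emb g k) (c k) (p k)
        fun l => convCast E (fib_fibMap f g k l).symm (e (emb g k l)) := by
  have h : colMulHom P.toPreOperad g a c i ▷ (tens fun k => (E (fib f k)).obj (a k)) ≫
      multi E f a i =
      tensDistrib (Z := fun k l => (E (fib (fibMap f g k) l)).obj ((a ∘ emb g k) l)) (embEquiv g)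
        (fun k l => eqToHom (congrArg (fun T => (E T).obj (a (emb g k l)))
          (fib_fibMap f g k l).symm)) ≫
        P.obj (colObj R c i) ◁ (tensMap fun k => multi E (fibMap f g k) (a ∘ emb g k) (c k)) ≫
          multi E (f ≫ g) c i := by
    refine fibre_hom_ext_tprod_tmul E f a fun ι X p q b r d => ?_
    refine (El.map_comp _ _ _).trans ((congrArg (multi E f a i ⊳ ·)
      (map_whiskerRight _ _ _)).trans ((elMulti_el E f b a i (P.colMul g a c i p q) r d).trans ?_))
    rw [P.colMul_assoc f g, ← elMulti_el E (f ≫ g)]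
    refine Eq.trans ?_ ((El.map_comp _ _ _).trans (congrArg (El.map _)
      (map_tensDistrib _ _ _ _ _))).symm
    refine Eq.trans ?_ ((El.map_comp _ _ _).trans (congrArg (El.map _)
      ((map_whiskerLeft _ _ _).trans (congrArg (q ⊠ ·) (map_tensMap _ _))))).symm
    refine congrArg (fun t => multi E (f ≫ g) c i ⊳ q ⊠ tprod t) (funext fun k => ?_)
    rw [← elMulti_el E (fibMap f g k)]
    refine congrArg (fun t => multi E (fibMap f g k) (a ∘ emb g k) (c k) ⊳ p k ⊠ tprod t)
      (funext fun l => eq_of_heq ?_)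
    refine HEq.trans ?_ (heq_convCast E (fib_fibMap f g k l).symm _).symm
    refine conv_el_congr E (fib_fibMap f g k l) (fun m m' hm => ?_) rfl (P.heq_elCast _ _)
      (fun m m' hm => ?_)
    · exact congrArg b (emb_fibMap_val f g k l m m' hm)
    · refine ((δ.heq_elCast _ _).trans (δ.heq_elCast _ _)).trans (HEq.trans ?_
        (δ.heq_elCast _ _).symm)
      exact heq_apply d (emb_fibMap_val f g k l m m' hm)
  have h' := congrArg (· ⊳ (tprod p ⊠ q) ⊠ tprod e) h
  simp only [El.map_comp, map_whiskerRight, map_colMulHom] at h'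
  refine h'.trans ?_
  rw [map_tensDistrib]
  exact congrArg (El.map _) ((map_whiskerLeft _ _ _).trans (congrArg (q ⊠ ·) (map_tensMap _ _)))

/-- On classes of terms the root is multiplied by an identity of U(P), which is removed by
`Operad.elCo_id`. -/
theorem elMulti_toU {T : O} {i : C} (e : El X ((E T).obj i)) :
    (elMulti E (toU T) (fun _ => i) i (P.elLin (P.elUId (π₀ T) i)) fun k =>
      convCast E (fib_U (toU T) k).symm e) = e := by
  obtain ⟨F, hF⟩ : ∃ F : (E T).obj i ⟶ (E T).obj i, ∀ {ι : Type} {X : ι → V}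
      (e : El X ((E T).obj i)), F ⊳ e = elMulti E (toU T) (fun _ => i) i
        (P.elLin (P.elUId (π₀ T) i)) fun k => convCast E (fib_U (toU T) k).symm e := by
    refine ⟨(λ_ _).inv ≫ (uId P.toPreOperad (π₀ T) i ⊗ₘ
      tensOne (card_U (π₀ T)) (fun k => (E (fib (toU T) k)).obj i) fun k =>
        eqToHom (congrArg (fun T => (E T).obj i) (fib_U (toU T) k).symm)) ≫
      multi E (toU T) (fun _ => i) i, fun {ι X} e => ?_⟩
    rw [El.map_comp, map_leftUnitor_inv]
    refine (El.map_comp _ _ _).trans (congrArg (multi E (toU T) (fun _ => i) i ⊳ ·) ?_)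
    exact (map_tensorHom _ _ _ _).trans (congrArg ((P.elUId (π₀ T) i) ⊠ ·) (map_tensOne _ _ _ _))
  have h : F = 𝟙 _ := by
    refine (E T).hom_ext_el fun ι X a p d => ?_
    rw [El.map_id, hF]
    have e := elMulti_el E (toU T) a (fun _ => i) i (P.elLin (P.elUId (π₀ T) i))
      (fun k => P.elCast (colObj_fib_toU T a i k).symm p) d
    replace e := e.trans (congrArg (fun t => (E T).el a i t d)
      ((P.elCo_eq _ _).symm.trans (P.elCo_id p)))
    refine Eq.trans (congrArg (elMulti E (toU T) (fun _ => i) i (P.elLin (P.elUId (π₀ T) i)))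
      (funext fun k => eq_of_heq ?_)) e
    refine (heq_convCast E (fib_U (toU T) k).symm _).trans ?_
    refine conv_el_congr E (fib_U (toU T) k).symm (fun m m' hm => ?_) rfl (P.heq_elCast _ _).symm
      (fun m m' hm => ?_)
    · exact congrArg a (Fin.ext (hm.trans (emb_val_of_U _ _ _).symm))
    · exact (heq_apply d (Fin.ext (hm.trans (emb_val_of_U _ _ _).symm))).trans
        (δ.heq_elCast _ _).symm
  rw [← hF, h, El.map_id]

end MultitensorElements

end

/-! ### The ends underlying the condensation -/

noncomputable section

open OperadicData OperadicCategory El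

section Ends

variable {V : Type u} [Category.{v} V] [MonoidalCategory V] [SymmetricCategory V]
  [MonoidalClosed V] {ι : Type} {X : ι → V}
  {O : Type uo} [Category.{vo} O] [OperadicCategory.{w} O] {C : Type v}
  {P : Operad (Colored O C) V} {δ : UFunctor P.toPreOperad V}

/-- The end `∫ᵢ V(δ(i), E(i))` in adjoint form. -/
structure ConvolutionEnd {T : O} (E : Convolution δ T) where
  obj : V
  ev (i : C) : obj ⊗ δ.obj (π₀ T) i ⟶ E.obj i
  wedge (i j : C) : obj ◁ δ.act (π₀ T) i j ≫ ev j =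
    (α_ _ _ _).inv ≫ ev i ▷ uHom P.toPreOperad (π₀ T) i j ≫ E.act i j
  existsUnique_lift (W : V) (x : ∀ i, W ⊗ δ.obj (π₀ T) i ⟶ E.obj i)
    (hx : ∀ i j, W ◁ δ.act (π₀ T) i j ≫ x j =
      (α_ _ _ _).inv ≫ x i ▷ uHom P.toPreOperad (π₀ T) i j ≫ E.act i j) :
    ∃! y : W ⟶ obj, ∀ i, y ▷ δ.obj (π₀ T) i ≫ ev i = x i

/-- The end is an equalizer between products of internal homs; its universal property is translated
into adjoint form by currying. -/
theorem nonempty_convolutionEnd [HasLimits V] {T : O} (E : Convolution δ T) :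
    Nonempty (ConvolutionEnd E) := by
  let F : C → V := fun i => (ihom (δ.obj (π₀ T) i)).obj (E.obj i)
  let L : ∀ i j, (δ.obj (π₀ T) i ⊗ uHom P.toPreOperad (π₀ T) i j) ⊗ F i ⟶ E.obj j := fun i j =>
    (α_ _ _ _).hom ≫ δ.obj (π₀ T) i ◁ (β_ _ _).hom ≫ (α_ _ _ _).inv ≫
      (ihom.ev (δ.obj (π₀ T) i)).app (E.obj i) ▷ _ ≫ E.act i j
  let R : ∀ i j, (δ.obj (π₀ T) i ⊗ uHom P.toPreOperad (π₀ T) i j) ⊗ F j ⟶ E.obj j := fun i j =>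
    δ.act (π₀ T) i j ▷ _ ≫ (ihom.ev (δ.obj (π₀ T) j)).app (E.obj j)
  obtain ⟨Q, p, hp, hQ⟩ := exists_end (fun i j => curry (L i j)) fun i j => curry (R i j)
  let e : ∀ {W : V} (x : ∀ i, W ⟶ F i) (i : C), W ⊗ δ.obj (π₀ T) i ⟶ E.obj i := fun x i =>
    (β_ _ _).hom ≫ uncurry (x i)
  have he : ∀ {W : V} (x : ∀ i, W ⟶ F i) (i : C) {ι : Type} {X : ι → V} (w : El X W)
      (d : El X (δ.obj (π₀ T) i)),
      e x i ⊳ w ⊠ d = (ihom.ev (δ.obj (π₀ T) i)).app (E.obj i) ⊳ d ⊠ (x i ⊳ w) := by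
    intro W x i ι X w d
    simp only [e, uncurry_eq, El.map_comp, map_braiding_hom, map_whiskerLeft]
  -- Equalizing the curried maps is the wedge condition on the adjoint maps. The braiding is needed
  -- because the internal hom is evaluated with δ on the left, while the wedge has δ on the right.
  have key : ∀ {W : V} (x : ∀ i, W ⟶ F i) (i j : C),
      x i ≫ curry (L i j) = x j ≫ curry (R i j) ↔
        W ◁ δ.act (π₀ T) i j ≫ e x j =
          (α_ _ _ _).inv ≫ e x i ▷ uHom P.toPreOperad (π₀ T) i j ≫ E.act i j := by
    intro W x i j
    rw [← curry_natural_left, ← curry_natural_left, (curry_injective).eq_iff,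
      ← cancel_epi (β_ W (δ.obj (π₀ T) i ⊗ uHom P.toPreOperad (π₀ T) i j)).hom]
    have e₁ : (β_ W _).hom ≫ (δ.obj (π₀ T) i ⊗ uHom P.toPreOperad (π₀ T) i j) ◁ x i ≫ L i j =
        (α_ _ _ _).inv ≫ e x i ▷ uHom P.toPreOperad (π₀ T) i j ≫ E.act i j :=
      hom_ext_tmul_tmul fun ι X w d u => by
        simp only [L, El.map_comp, map_braiding_hom, map_whiskerLeft,
          map_associator_hom, map_associator_inv, map_whiskerRight, he]
    have e₂ : (β_ W _).hom ≫ (δ.obj (π₀ T) i ⊗ uHom P.toPreOperad (π₀ T) i j) ◁ x j ≫ R i j =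
        W ◁ δ.act (π₀ T) i j ≫ e x j :=
      hom_ext_tmul_tmul fun ι X w d u => by
        simp only [R, El.map_comp, map_braiding_hom, map_whiskerLeft,
          map_whiskerRight, he]
    rw [e₁, e₂, eq_comm]
  refine ⟨⟨Q, e p, fun i j => (key p i j).1 (hp i j), fun W x hx => ?_⟩⟩
  have ex : e (fun i => curry ((β_ _ _).hom ≫ x i)) = x := by
    funext i
    simp only [e, uncurry_curry, SymmetricCategory.symmetry_assoc]
  obtain ⟨y, hy, hy'⟩ := hQ W (fun i => curry ((β_ _ _).hom ≫ x i)) fun i j =>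
    (key _ i j).2 (by rw [ex]; exact hx i j)
  have ey : ∀ (y : W ⟶ Q) (i : C), y ▷ δ.obj (π₀ T) i ≫ e p i = e (fun i => y ≫ p i) i := by
    intro y i
    simp only [e, uncurry_natural_left, BraidedCategory.braiding_naturality_left_assoc]
  refine ⟨y, fun i => ?_, fun z hz => hy' z fun i => ?_⟩
  · rw [ey, ← congrFun ex i]
    exact congrArg (fun x => e x i) (funext hy)
  · have h := (ey z i).symm.trans (hz i)
    simp only [e] at h
    rw [← h, SymmetricCategory.symmetry_assoc, curry_uncurry]

namespace ConvolutionEnd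

variable {T : O} {E : Convolution δ T} (Q : ConvolutionEnd E)

/-- The evaluation of the end on elements. -/
def elEv {i : C} (q : El X Q.obj) (d : El X (δ.obj (π₀ T) i)) : El X (E.obj i) :=
  Q.ev i ⊳ q ⊠ d

theorem elEv_act {i j : C} (q : El X Q.obj) (d : El X (δ.obj (π₀ T) i))
    (u : El X (uHom P.toPreOperad (π₀ T) i j)) :
    Q.elEv q (δ.elAct d u) = E.elAct (Q.elEv q d) u := by
  have h := congrArg (· ⊳ q ⊠ d ⊠ u) (Q.wedge i j)
  simp only [El.map_comp, map_whiskerLeft, map_associator_inv, map_whiskerRight] at h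
  exact h

theorem hom_ext (s : Shape V) {F G : s.eval ⟶ Q.obj}
    (h : ∀ (i : C) (ι : Type) (X : ι → V) (x : s.Fam X) (d : El X (δ.obj (π₀ T) i)),
      Q.elEv (F ⊳ s.total x) d = Q.elEv (G ⊳ s.total x) d) : F = G := by
  refine (Q.existsUnique_lift s.eval (fun i => G ▷ _ ≫ Q.ev i) fun i j => ?_).unique
    (fun i => ?_) fun i => rfl
  · rw [whisker_exchange_assoc, Q.wedge, associator_inv_naturality_left_assoc,
      comp_whiskerRight, Category.assoc]
  · refine Shape.hom_ext (.mul s (.leaf _)) fun ι X x => ?_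
    have e : ∀ H : s.eval ⟶ Q.obj, H ▷ δ.obj (π₀ T) i ≫ Q.ev i ⊳ s.total x.1 ⊠ x.2 =
        Q.elEv (H ⊳ s.total x.1) x.2 := fun H =>
      (El.map_comp _ _ _).trans (congrArg (Q.ev i ⊳ ·) (map_whiskerRight _ _ _))
    exact (e F).trans ((h i ι X x.1 x.2).trans (e G).symm)

end ConvolutionEnd

end Ends

end

/-! ### Operads from identities between elements -/

noncomputable section

open OperadicData OperadicCategory El

section OperadsFromElements

variable {V : Type u} [Category.{v} V] [MonoidalCategory V] [SymmetricCategory V]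
  {O : Type uo} [Category.{vo} O] [OperadicCategory.{w} O] (P : PreOperad O V)

/-- The multiplications along the maps of fibres. -/
def PreOperad.fibreMul {T S R : O} (f : T ⟶ S) (g : S ⟶ R) :
    (tens fun j => P.obj (fib f j)) ⊗ (tens fun i => P.obj (fib g i)) ⟶
      tens fun i => P.obj (fib (f ≫ g) i) :=
  (tensRegroup (embEquiv g) (fun j => P.obj (fib f j)) ≫
    tensMap fun i => tensMap fun k =>
      eqToHom (congrArg P.obj (fib_fibMap f g i k).symm)) ▷ (tens fun i => P.obj (fib g i)) ≫
    tensZip (fun i => tens fun k => P.obj (fib (fibMap f g i) k)) (fun i => P.obj (fib g i)) ≫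
    tensMap fun i => P.mul (fibMap f g i)

theorem PreOperad.map_fibreMul {ι : Type} {X : ι → V} {T S R : O} (f : T ⟶ S) (g : S ⟶ R)
    (x : ∀ j, El X (P.obj (fib f j))) (y : ∀ i, El X (P.obj (fib g i))) :
    P.fibreMul f g ⊳ tprod x ⊠ tprod y = tprod fun i => P.elMul (fibMap f g i)
      (fun k => eqToHom (congrArg P.obj (fib_fibMap f g i k).symm) ⊳ x (emb g i k)) (y i) := by
  refine (El.map_comp _ _ _).trans ((congrArg (El.map _) ((map_whiskerRight _ _ _).trans
    (congrArg (· ⊠ tprod y) (map_regroup _ _ _)))).trans ?_)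
  refine (El.map_comp _ _ _).trans ((congrArg (El.map _) (map_tensZip _ _)).trans ?_)
  exact map_tensMap _ _

theorem PreOperad.map_unit_mul {ι : Type} {X : ι → V} (T : O) (x : El X (P.obj T)) :
    (λ_ (P.obj T)).inv ≫ (tensUnit (card T) ≫ tensMap fun i =>
      P.unit (src T i) ≫ eqToHom (congrArg P.obj (fib_id T i).symm)) ▷ P.obj T ≫
        P.mul (𝟙 T) ⊳ x = P.elMul (𝟙 T)
      (fun i => eqToHom (congrArg P.obj (fib_id T i).symm) ⊳ P.elUnit (src T i)) x := by
  simp only [El.map_comp, map_leftUnitor_inv, map_whiskerRight, map_tensUnit, map_tensMap]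
  rfl

theorem PreOperad.map_mul_unit {ι : Type} {X : ι → V} (T : O) (x : El X (P.obj T)) :
    (ρ_ (P.obj T)).inv ≫ (tensOne (card_U (π₀ T)) (fun i => P.obj (fib (toU T) i))
      (fun i => eqToHom (congrArg P.obj (fib_U (toU T) i).symm)) ⊗ₘ P.unit (π₀ T)) ≫
        P.mul (toU T) ⊳ x = P.elMul (toU T)
      (fun i => eqToHom (congrArg P.obj (fib_U (toU T) i).symm) ⊳ x) (P.elUnit (π₀ T)) := by
  simp only [El.map_comp, map_rightUnitor_inv, map_tensorHom, map_tensOne]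
  rfl

/-- Operads from identities between elements. -/
def Operad.ofElements
    (assoc : ∀ {ι : Type} {X : ι → V} {T S R : O} (f : T ⟶ S) (g : S ⟶ R)
      (x : ∀ j, El X (P.obj (fib f j))) (y : ∀ i, El X (P.obj (fib g i))) (z : El X (P.obj R)),
      P.elMul f x (P.elMul g y z) = P.elMul (f ≫ g) (fun i => P.elMul (fibMap f g i)
        (fun k => eqToHom (congrArg P.obj (fib_fibMap f g i k).symm) ⊳ x (emb g i k)) (y i)) z)
    (unit_mul : ∀ {ι : Type} {X : ι → V} (T : O) (x : El X (P.obj T)),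
      P.elMul (𝟙 T) (fun i => eqToHom (congrArg P.obj (fib_id T i).symm) ⊳ P.elUnit (src T i)) x =
        x)
    (mul_unit : ∀ {ι : Type} {X : ι → V} (T : O) (x : El X (P.obj T)),
      P.elMul (toU T) (fun i => eqToHom (congrArg P.obj (fib_U (toU T) i).symm) ⊳ x)
        (P.elUnit (π₀ T)) = x) : Operad O V where
  toPreOperad := P
  assoc {T S R} f g := by
    refine Shape.hom_ext (.mul (.tens _ fun j => .leaf (P.obj (fib f j)))
      (.mul (.tens _ fun i => .leaf (P.obj (fib g i))) (.leaf (P.obj R)))) fun ι X x => ?_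
    suffices H : ∀ (x : ∀ j, El X (P.obj (fib f j))) (y : ∀ i, El X (P.obj (fib g i)))
        (z : El X (P.obj R)), _ ⊳ tprod x ⊠ (tprod y ⊠ z) = _ ⊳ tprod x ⊠ (tprod y ⊠ z) from
      H x.1 x.2.1 x.2.2
    intro x y z
    refine ((El.map_comp _ _ _).trans (congrArg (El.map _) (map_whiskerLeft _ _ _))).trans
      ((assoc f g x y z).trans (Eq.symm ?_))
    refine ((El.map_comp _ _ _).trans (congrArg (El.map _) (map_associator_inv _ _ _))).trans ?_
    refine ((El.map_comp _ _ _).trans (congrArg (El.map _) (map_whiskerRight _ _ _))).trans ?_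
    exact congrArg (fun t => P.mul (f ≫ g) ⊳ t ⊠ z) (P.map_fibreMul f g x y)
  unit_mul T := by
    refine hom_ext_el fun ι X x => ?_
    rw [P.map_unit_mul, El.map_id, unit_mul]
  mul_unit T := by
    refine hom_ext_el fun ι X x => ?_
    rw [P.map_mul_unit, El.map_id, mul_unit]

end OperadsFromElements

/-! ### The coendomorphism operad -/

section CondensationStructure

variable {V : Type u} [Category.{v} V] [MonoidalCategory V] [SymmetricCategory V]
  [MonoidalClosed V] {ι : Type} {X : ι → V}
  {O : Type uo} [Category.{vo} O] [OperadicCategory.{w} O] {C : Type v}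
  {P : Operad (Colored O C) V} {δ : UFunctor P.toPreOperad V}
  {E : ∀ T, Convolution δ T} (Q : ∀ T, ConvolutionEnd (E T))

/-- Transport of elements of the condensation. -/
def endCast {T T' : O} (h : T = T') (q : El X (Q T).obj) : El X (Q T').obj :=
  eqToHom (congrArg (fun T => (Q T).obj) h) ⊳ q

theorem heq_endCast {T T' : O} (h : T = T') (q : El X (Q T).obj) : HEq (endCast Q h q) q :=
  heq_map_eqToHom _ _

theorem elEv_congr {T T' : O} (h : T = T') {i i' : C} (hi : i = i') {q : El X (Q T).obj}
    {q' : El X (Q T').obj} (hq : HEq q q') {d : El X (δ.obj (π₀ T) i)}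
    {d' : El X (δ.obj (π₀ T') i')} (hd : HEq d d') :
    HEq ((Q T).elEv q d) ((Q T').elEv q' d') := by
  subst h hi
  rw [eq_of_heq hq, eq_of_heq hd]

/-- The structure map for the composition with the multitensor, on the terms of the coend. -/
def nuTerm {T S : O} (f : T ⟶ S) (a : Fin (card S) → C) (i : C) :
    (tens fun k => (Q (fib f k)).obj) ⊗
      (P.obj (colObj S a i) ⊗ tens fun k => δ.obj (src S k) (a k)) ⟶ (E T).obj i :=
  (α_ _ _ _).inv ≫ (β_ _ _).hom ▷ _ ≫ (α_ _ _ _).hom ≫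
    P.obj (colObj S a i) ◁
      (tensZip (fun k => (Q (fib f k)).obj) (fun k => δ.obj (src S k) (a k)) ≫
        tensMap fun k => (Q (fib f k)).obj ◁
          eqToHom (congrArg (δ.obj · (a k)) (π₀_fib f k).symm) ≫ (Q (fib f k)).ev (a k)) ≫
    multi E f a i

theorem map_nuTerm {T S : O} (f : T ⟶ S) {a : Fin (card S) → C} {i : C}
    (q : ∀ k, El X (Q (fib f k)).obj) (p : El X (P.obj (colObj S a i)))
    (d : ∀ k, El X (δ.obj (src S k) (a k))) :
    nuTerm Q f a i ⊳ tprod q ⊠ p ⊠ tprod d = elMulti E f a i p fun k =>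
      (Q (fib f k)).elEv (q k) (δ.elCast (π₀_fib f k).symm (d k)) := by
  simp only [nuTerm, El.map_comp, map_associator_inv, map_whiskerRight, map_braiding_hom,
    map_associator_hom, map_whiskerLeft, map_tensZip, map_tensMap]
  rfl

/-- The coend relation of `E S` is respected: `elMulti_contra` moves the action of U(P) to the inner
convolution products, and the wedge condition of the ends moves it from there to `δ`. -/
theorem exists_nu {T S : O} (f : T ⟶ S) (i : C) :
    ∃ ν : (tens fun k => (Q (fib f k)).obj) ⊗ (E S).obj i ⟶ (E T).obj i,
      ∀ a, (tens fun k => (Q (fib f k)).obj) ◁ (E S).ι a i ≫ ν = nuTerm Q f a i := by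
  refine ((((E S).isCoend i).whiskerLeft (tens fun k => (Q (fib f k)).obj)).existsUnique_desc
    ((E T).obj i) (fun a => nuTerm Q f a i) fun a b => ?_).exists
  refine Shape.hom_ext (.mul (.tens _ fun k => .leaf (Q (fib f k)).obj)
    (.mul (.mul (.tens _ fun k => .leaf (uHom P.toPreOperad (src S k) (a k) (b k)))
      (.leaf (P.obj (colObj S b i)))) (.tens _ fun k => .leaf (δ.obj (src S k) (a k)))))
    fun ι X x => ?_
  obtain ⟨q, hq⟩ : ∃ q : ∀ k, El X (Q (fib f k)).obj, q = x.1 := ⟨_, rfl⟩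
  obtain ⟨u, hu⟩ : ∃ u : ∀ k, El X (uHom P.toPreOperad (src S k) (a k) (b k)), u = x.2.1.1 :=
    ⟨_, rfl⟩
  obtain ⟨p, hp⟩ : ∃ p : El X (P.obj (colObj S b i)), p = x.2.1.2 := ⟨_, rfl⟩
  obtain ⟨d, hd⟩ : ∃ d : ∀ k, El X (δ.obj (src S k) (a k)), d = x.2.2 := ⟨_, rfl⟩
  have e : (tens fun k => (Q (fib f k)).obj) ◁ convLeft δ S i a b ≫ nuTerm Q f a i ⊳
      tprod q ⊠ ((tprod u ⊠ p) ⊠ tprod d) =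
      (tens fun k => (Q (fib f k)).obj) ◁ convRight δ S i a b ≫ nuTerm Q f b i ⊳
      tprod q ⊠ ((tprod u ⊠ p) ⊠ tprod d) := by
    rw [El.map_comp, map_whiskerLeft, map_convLeft, map_nuTerm, El.map_comp, map_whiskerLeft,
      map_convRight, map_nuTerm, elMulti_contra]
    refine congrArg (elMulti E f b i p) (funext fun k => ?_)
    rw [← (Q (fib f k)).elEv_act, δ.elAct_castU]
  subst hq hu hp hd
  exact e

/-- The composition of natural transformations with the multitensor. -/
def nu {T S : O} (f : T ⟶ S) (i : C) :
    (tens fun k => (Q (fib f k)).obj) ⊗ (E S).obj i ⟶ (E T).obj i :=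
  (exists_nu Q f i).choose

theorem ι_nu {T S : O} (f : T ⟶ S) (a : Fin (card S) → C) (i : C) :
    (tens fun k => (Q (fib f k)).obj) ◁ (E S).ι a i ≫ nu Q f i = nuTerm Q f a i :=
  (exists_nu Q f i).choose_spec a

/-- The composition of natural transformations with the multitensor on elements. -/
def elNu {T S : O} (f : T ⟶ S) {i : C} (q : ∀ k, El X (Q (fib f k)).obj) (e : El X ((E S).obj i)) :
    El X ((E T).obj i) :=
  nu Q f i ⊳ tprod q ⊠ e

theorem elNu_el {T S : O} (f : T ⟶ S) {a : Fin (card S) → C} {i : C}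
    (q : ∀ k, El X (Q (fib f k)).obj) (p : El X (P.obj (colObj S a i)))
    (d : ∀ k, El X (δ.obj (src S k) (a k))) :
    elNu Q f q ((E S).el a i p d) = elMulti E f a i p fun k =>
      (Q (fib f k)).elEv (q k) (δ.elCast (π₀_fib f k).symm (d k)) := by
  rw [← map_nuTerm, ← ι_nu, El.map_comp, map_whiskerLeft]
  rfl

theorem conv_hom_ext_tprod {S : O} {i : C} {n : ℕ} {A : Fin n → V} {W : V}
    {F G : tens A ⊗ (E S).obj i ⟶ W}
    (h : ∀ (ι : Type) (X : ι → V) (x : ∀ k, El X (A k)) (a : Fin (card S) → C)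
      (p : El X (P.obj (colObj S a i))) (d : ∀ k, El X (δ.obj (src S k) (a k))),
      F ⊳ tprod x ⊠ (E S).el a i p d = G ⊳ tprod x ⊠ (E S).el a i p d) : F = G :=
  (E S).hom_ext_left (.tens n fun k => .leaf (A k)) h

theorem conv_hom_ext_tprod_tmul {S : O} {i : C} {n : ℕ} {A : Fin n → V} {B W : V}
    {F G : (tens A ⊗ B) ⊗ (E S).obj i ⟶ W}
    (h : ∀ (ι : Type) (X : ι → V) (x : ∀ k, El X (A k)) (y : El X B) (a : Fin (card S) → C)
      (p : El X (P.obj (colObj S a i))) (d : ∀ k, El X (δ.obj (src S k) (a k))),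
      F ⊳ (tprod x ⊠ y) ⊠ (E S).el a i p d = G ⊳ (tprod x ⊠ y) ⊠ (E S).el a i p d) : F = G :=
  (E S).hom_ext_left (.mul (.tens n fun k => .leaf (A k)) (.leaf B))
    fun ι X z a p d => h ι X z.1 z.2 a p d

theorem conv_hom_ext_tprod_tprod {S : O} {i : C} {n m : ℕ} {A : Fin n → V} {B : Fin m → V} {W : V}
    {F G : (tens A ⊗ tens B) ⊗ (E S).obj i ⟶ W}
    (h : ∀ (ι : Type) (X : ι → V) (x : ∀ k, El X (A k)) (y : ∀ k, El X (B k))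
      (a : Fin (card S) → C)
      (p : El X (P.obj (colObj S a i))) (d : ∀ k, El X (δ.obj (src S k) (a k))),
      F ⊳ (tprod x ⊠ tprod y) ⊠ (E S).el a i p d = G ⊳ (tprod x ⊠ tprod y) ⊠ (E S).el a i p d) :
    F = G :=
  (E S).hom_ext_left (.mul (.tens n fun k => .leaf (A k)) (.tens m fun k => .leaf (B k)))
    fun ι X z a p d => h ι X z.1 z.2 a p d

/-- Naturality in the root colour, inherited from `elMulti_co`. It ensures that a composite of
natural transformations is natural. -/
theorem elNu_act {T S : O} (f : T ⟶ S) {i j : C} (q : ∀ k, El X (Q (fib f k)).obj)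
    (e : El X ((E S).obj i)) (u : El X (uHom P.toPreOperad (π₀ S) i j)) :
    elNu Q f q ((E S).elAct e u) = (E T).elAct (elNu Q f q e) (P.castU (π₀_eq f).symm u) := by
  have h : (α_ _ _ _).hom ≫ (tens fun k => (Q (fib f k)).obj) ◁ ((β_ _ _).hom ≫ (E S).act i j) ≫
      nu Q f j =
      (α_ _ _ _).hom ≫ _ ◁ (β_ _ _).hom ≫ (α_ _ _ _).inv ≫ nu Q f i ▷ _ ≫ (E T).obj i ◁
        eqToHom (congrArg (fun c => uHom P.toPreOperad c i j) (π₀_eq f).symm) ≫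
          (E T).act i j := by
    refine conv_hom_ext_tprod_tmul fun ι X q u a p d => ?_
    simp only [El.map_comp, map_associator_hom, map_whiskerLeft, map_braiding_hom,
      map_associator_inv, map_whiskerRight]
    refine (congrArg (elNu Q f q) ((E S).elAct_el p d u)).trans ?_
    rw [elNu_el, elMulti_co, ← elNu_el]
    rfl
  have h' := congrArg (· ⊳ (tprod q ⊠ u) ⊠ e) h
  simp only [El.map_comp, map_associator_hom, map_whiskerLeft, map_braiding_hom,
      map_associator_inv, map_whiskerRight] at h'
  exact h'

/-- The composite satisfies the wedge condition of the end at `T`: the action passes through the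
evaluation at `S` by its own wedge condition and through `nu` by `elNu_act`. -/
theorem exists_endMul {T S : O} (f : T ⟶ S) :
    ∃ m : (tens fun k => (Q (fib f k)).obj) ⊗ (Q S).obj ⟶ (Q T).obj, ∀ i,
      m ▷ δ.obj (π₀ T) i ≫ (Q T).ev i = (α_ _ _ _).hom ≫ (tens fun k => (Q (fib f k)).obj) ◁
        ((Q S).obj ◁ eqToHom (congrArg (δ.obj · i) (π₀_eq f)) ≫ (Q S).ev i) ≫ nu Q f i := by
  refine ((Q T).existsUnique_lift _ _ fun i j => ?_).exists
  refine Shape.hom_ext (.mul (.mul (.tens _ fun k => .leaf (Q (fib f k)).obj) (.leaf (Q S).obj))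
    (.mul (.leaf (δ.obj (π₀ T) i)) (.leaf (uHom P.toPreOperad (π₀ T) i j)))) fun ι X x => ?_
  suffices H : ∀ (q : ∀ k, El X (Q (fib f k)).obj) (r : El X (Q S).obj)
      (d : El X (δ.obj (π₀ T) i)) (u : El X (uHom P.toPreOperad (π₀ T) i j)), _ ⊳
        (tprod q ⊠ r) ⊠ (d ⊠ u) = _ ⊳ (tprod q ⊠ r) ⊠ (d ⊠ u) from H x.1.1 x.1.2 x.2.1 x.2.2
  intro q r d u
  simp only [El.map_comp, map_associator_hom, map_whiskerLeft, map_associator_inv,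
    map_whiskerRight]
  have e : elNu Q f q ((Q S).elEv r (δ.elCast (π₀_eq f) (δ.elAct d u))) =
      (E T).elAct (elNu Q f q ((Q S).elEv r (δ.elCast (π₀_eq f) d))) u := by
    rw [← δ.elAct_castU (π₀_eq f), (Q S).elEv_act, elNu_act]
    exact congrArg _ (eq_of_heq ((P.heq_castU _ _).trans (P.heq_castU _ _)))
  exact e

/-- Naturality of δ → E_U(δ): the coend relation turns the action on `d` into precomposition of an
identity of U(P) with `u`, and the root action is postcomposition of an identity with `u`. Both give
`u`. -/
theorem unit_wedge {c : Comp O} {i j : C} (d : El X (δ.obj (π₀ (U c)) i))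
    (u : El X (uHom P.toPreOperad (π₀ (U c)) i j)) :
    (E (U c)).el (fun _ => j) j (P.elLin (P.elUId c j)) (fun k =>
        δ.elCast ((π₀_U c).trans (src_U c k).symm) (δ.elAct d u)) =
      (E (U c)).elAct ((E (U c)).el (fun _ => i) i (P.elLin (P.elUId c i)) fun k =>
        δ.elCast ((π₀_U c).trans (src_U c k).symm) d) u := by
  rw [(E (U c)).elAct_el]
  simp only [← δ.elAct_castU]
  refine ((E (U c)).el_contra (a := fun _ => i) (b := fun _ => j) _ _ _).symm.trans ?_
  refine congrArg (fun t => (E (U c)).el (fun _ => i) j t _) ?_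
  rw [P.elCo_eq, P.elContra_eq]
  have hc : π₀ (U c) = c := π₀_U c
  -- On a chosen terminal object `toU` is the identity. Hence the covariant unit law evaluates the
  -- contravariant action of `u` on an identity, and the contravariant unit law evaluates the
  -- covariant action.
  have h₁ := P.elCo_id (T := U c) (a := fun _ => i) (i := j) (P.elLin (P.castU hc u))
  have h₂ := P.elContra_id (T := U c) (a := fun _ => i) (i := j) (P.elLin (P.castU hc u))
  rw [P.elCo_eq] at h₁
  rw [P.elContra_eq] at h₂
  refine Eq.trans ?_ ((h₁.trans h₂.symm).trans ?_)
  · refine eq_of_heq (P.colMul_congr rfl (congrArg U hc).symm (heq_toU rfl _) (fun _ _ _ => rfl)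
      (fun _ _ _ => rfl) rfl (fun k k' hk => ?_) (P.elUId_congr hc.symm))
    exact ((P.heq_elCast _ _).trans (P.heq_castU _ _)).trans
      ((P.heq_elCast _ _).trans (P.heq_castU _ _)).symm
  · refine eq_of_heq (P.colMul_congr rfl (congrArg U hc).symm (heq_toU rfl _) (fun _ _ _ => rfl)
      (fun _ _ _ => rfl) rfl (fun k k' hk => ?_) (P.heq_castU _ _))
    exact ((P.heq_elCast _ _).trans (P.elUId_congr (src_U c k))).trans (P.heq_elCast _ _).symm

theorem exists_endUnit (c : Comp O) : ∃ m : 𝟙_ V ⟶ (Q (U c)).obj, ∀ i,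
    m ▷ δ.obj (π₀ (U c)) i ≫ (Q (U c)).ev i =
      (uId P.toPreOperad c i ⊗ₘ tensOne (card_U c) (fun k => δ.obj (src (U c) k) i)
        fun k => eqToHom (congrArg (δ.obj · i) ((π₀_U c).trans (src_U c k).symm))) ≫
      (E (U c)).ι (fun _ => i) i := by
  have key : ∀ (i : C) {ι : Type} {X : ι → V} (d : El X (δ.obj (π₀ (U c)) i)),
      (uId P.toPreOperad c i ⊗ₘ tensOne (card_U c) (fun k => δ.obj (src (U c) k) i)
        fun k => eqToHom (congrArg (δ.obj · i) ((π₀_U c).trans (src_U c k).symm))) ≫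
      (E (U c)).ι (fun _ => i) i ⊳ (El.one ⊠ d) =
      (E (U c)).el (fun _ => i) i (P.elLin (P.elUId c i)) fun k =>
        δ.elCast ((π₀_U c).trans (src_U c k).symm) d := fun i ι X d =>
    (El.map_comp _ _ _).trans (congrArg ((E (U c)).ι (fun _ => i) i ⊳ ·)
      ((map_tensorHom _ _ _ _).trans (congrArg (P.elUId c i ⊠ ·) (map_tensOne _ _ _ _))))
  refine ((Q (U c)).existsUnique_lift _ _ fun i j => ?_).exists
  rw [← cancel_epi (λ_ _).inv]
  refine hom_ext_tmul fun ι X d u => ?_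
  refine ((El.map_comp _ _ _).trans (congrArg (El.map _) (map_leftUnitor_inv _))).trans
    (Eq.trans ?_ ((El.map_comp _ _ _).trans (congrArg (El.map _) (map_leftUnitor_inv _))).symm)
  refine ((El.map_comp _ _ _).trans (congrArg (El.map _) (map_whiskerLeft _ _ _))).trans
    ((key j _).trans ?_)
  refine Eq.trans (unit_wedge d u) (Eq.symm ?_)
  refine ((El.map_comp _ _ _).trans (congrArg (El.map _) (map_associator_inv _ _ _))).trans ?_
  refine ((El.map_comp _ _ _).trans (congrArg (El.map _) (map_whiskerRight _ _ _))).trans ?_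
  rw [key]
  rfl

/-- The structure maps of the condensation. -/
def condPreOperad : PreOperad O V where
  obj T := (Q T).obj
  unit c := (exists_endUnit Q c).choose
  mul f := (exists_endMul Q f).choose

theorem elEv_elMul {T S : O} (f : T ⟶ S) (q : ∀ k, El X (Q (fib f k)).obj) (r : El X (Q S).obj)
    {i : C} (d : El X (δ.obj (π₀ T) i)) :
    (Q T).elEv ((condPreOperad Q).elMul f q r) d =
      elNu Q f q ((Q S).elEv r (δ.elCast (π₀_eq f) d)) := by
  have h := congrArg (· ⊳ (tprod q ⊠ r) ⊠ d) ((exists_endMul Q f).choose_spec i)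
  simp only [El.map_comp, map_associator_hom, map_whiskerLeft, map_whiskerRight] at h
  exact h

theorem elEv_elUnit {c : Comp O} {i : C} (d : El X (δ.obj (π₀ (U c)) i)) :
    (Q (U c)).elEv ((condPreOperad Q).elUnit c) d =
      (E (U c)).el (fun _ => i) i (P.elLin (P.elUId c i)) fun k =>
        δ.elCast ((π₀_U c).trans (src_U c k).symm) d := by
  have h := congrArg (· ⊳ El.one ⊠ d) ((exists_endUnit Q c).choose_spec i)
  refine Eq.trans ?_ (h.trans ?_)
  · exact ((El.map_comp _ _ _).trans (congrArg (El.map _) (map_whiskerRight _ _ _))).symm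
  · exact (El.map_comp _ _ _).trans (congrArg ((E (U c)).ι (fun _ => i) i ⊳ ·)
      ((map_tensorHom _ _ _ _).trans (congrArg (P.elUId c i ⊠ ·) (map_tensOne _ _ _ _))))

/-- Acting by natural transformations after the multitensor along `g` can be distributed over the
fibres of `g`: on classes of terms this is `elMulti_assoc`. -/
theorem elNu_elMulti {T S R : O} (f : T ⟶ S) (g : S ⟶ R) (c : Fin (card R) → C) (i : C)
    (x : ∀ j, El X (Q (fib f j)).obj) (p : El X (P.obj (colObj R c i)))
    (e : ∀ k, El X ((E (fib g k)).obj (c k))) :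
    elNu Q f x (elMulti E g c i p e) = elMulti E (f ≫ g) c i p fun k =>
      elNu Q (fibMap f g k) (fun l => endCast Q (fib_fibMap f g k l).symm (x (emb g k l))) (e k) := by
  have h : (α_ _ _ _).hom ≫ (tens fun j => (Q (fib f j)).obj) ◁ multi E g c i ≫ nu Q f i =
      tensDistrib' (Z := fun k l => (Q (fib (fibMap f g k) l)).obj) (embEquiv g)
        (fun k l => eqToHom (congrArg (fun T => (Q T).obj) (fib_fibMap f g k l).symm)) ≫
        P.obj (colObj R c i) ◁ (tensMap fun k => nu Q (fibMap f g k) (c k)) ≫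
          multi E (f ≫ g) c i := by
    refine fibre_hom_ext_tprod_tmul E g c fun ι X x p a r d => ?_
    rw [El.map_comp, map_associator_hom, El.map_comp, map_whiskerLeft]
    refine (congrArg (elNu Q f x) (elMulti_el E g a c i p r d)).trans ?_
    rw [elNu_el, elMulti_assoc]
    refine Eq.trans ?_ ((El.map_comp _ _ _).trans (congrArg (El.map _)
      (map_tensDistrib' _ _ _ _ _))).symm
    refine Eq.trans ?_ ((El.map_comp _ _ _).trans (congrArg (El.map _)
      ((map_whiskerLeft _ _ _).trans (congrArg (p ⊠ ·) (map_tensMap _ _))))).symm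
    refine congrArg (elMulti E (f ≫ g) c i p) (funext fun k => ?_)
    refine Eq.trans ?_ (elNu_el Q (fibMap f g k) _ (r k) (δ.elRes g d k)).symm
    refine congrArg (elMulti E (fibMap f g k) (a ∘ emb g k) (c k) (r k))
      (funext fun l => eq_of_heq ?_)
    refine (heq_convCast E _ _).trans (elEv_congr Q (fib_fibMap f g k l).symm rfl
      (heq_endCast Q (fib_fibMap f g k l).symm _).symm ?_)
    exact (δ.heq_elCast _ _).trans ((δ.heq_elCast _ _).trans (δ.heq_elCast _ _)).symm
  have h' := congrArg (· ⊳ (tprod x ⊠ p) ⊠ tprod e) h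
  rw [El.map_comp, map_associator_hom, El.map_comp, map_whiskerLeft] at h'
  refine h'.trans ?_
  rw [El.map_comp, map_tensDistrib', El.map_comp, map_whiskerLeft]
  exact congrArg (El.map _) (congrArg (p ⊠ ·) (map_tensMap _ _))

/-- Associativity of composition, seen on convolution products. On a class of terms it follows from
`elNu_elMulti`, since evaluating a product of natural transformations is `elNu` applied to an
evaluation (`elEv_elMul`). -/
theorem elNu_elNu {T S R : O} (f : T ⟶ S) (g : S ⟶ R) {i : C}
    (x : ∀ j, El X (Q (fib f j)).obj) (y : ∀ k, El X (Q (fib g k)).obj) (e : El X ((E R).obj i)) :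
    elNu Q f x (elNu Q g y e) = elNu Q (f ≫ g) (fun k => (condPreOperad Q).elMul (fibMap f g k)
      (fun l => endCast Q (fib_fibMap f g k l).symm (x (emb g k l))) (y k)) e := by
  have h : (α_ _ _ _).hom ≫ (tens fun j => (Q (fib f j)).obj) ◁ nu Q g i ≫ nu Q f i =
      (condPreOperad Q).fibreMul f g ▷ _ ≫ nu Q (f ≫ g) i := by
    refine conv_hom_ext_tprod_tprod fun ι X x y c p d => ?_
    rw [El.map_comp, map_associator_hom, El.map_comp, map_whiskerLeft]
    refine (congrArg (elNu Q f x) (elNu_el Q g y p d)).trans ?_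
    rw [elNu_elMulti]
    symm
    refine ((El.map_comp _ _ _).trans (congrArg (El.map _) ((map_whiskerRight _ _ _).trans
      (congrArg (· ⊠ (E R).el c i p d) ((condPreOperad Q).map_fibreMul f g x y))))).trans ?_
    refine (elNu_el Q (f ≫ g) _ p d).trans ?_
    refine congrArg (elMulti E (f ≫ g) c i p) (funext fun k => ?_)
    refine (elEv_elMul Q (fibMap f g k) _ (y k) _).trans ?_
    rw [δ.elCast_elCast]
    rfl
  have h' := congrArg (· ⊳ (tprod x ⊠ tprod y) ⊠ e) h
  rw [El.map_comp, map_associator_hom, El.map_comp, map_whiskerLeft] at h'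
  refine h'.trans ?_
  exact (El.map_comp _ _ _).trans (congrArg (El.map _) ((map_whiskerRight _ _ _).trans
    (congrArg (· ⊠ e) ((condPreOperad Q).map_fibreMul f g x y))))

/-- The operad units evaluate to classes of identities of U(P); on classes of terms these are
absorbed by `Operad.elContra_id`. -/
theorem elNu_id {T : O} {i : C} (e : El X ((E T).obj i)) :
    elNu Q (𝟙 T) (fun k => endCast Q (fib_id T k).symm ((condPreOperad Q).elUnit (src T k))) e =
      e := by
  have h : (λ_ _).inv ≫ (tensUnit (card T) ≫ tensMap fun k =>
      (condPreOperad Q).unit (src T k) ≫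
        eqToHom (congrArg (fun T => (Q T).obj) (fib_id T k).symm)) ▷ _ ≫ nu Q (𝟙 T) i =
      𝟙 ((E T).obj i) := by
    refine (E T).hom_ext_el fun ι X a p d => ?_
    rw [El.map_comp, map_leftUnitor_inv, El.map_comp, map_whiskerRight, El.map_comp, map_tensUnit,
      map_tensMap, El.map_id]
    simp only [El.map_comp]
    refine (elNu_el Q (𝟙 T) _ p d).trans ?_
    have e := elMulti_el E (𝟙 T) a a i p (fun k => P.elCast (colObj_fib_id T a a k).symm
      (P.elLin (P.elUId (src T k) (a k)))) d
    replace e := e.trans (congrArg (fun t => (E T).el a i t d)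
      ((P.elContra_eq _ _).symm.trans (P.elContra_id p)))
    refine Eq.trans (congrArg (elMulti E (𝟙 T) a i p) (funext fun k => eq_of_heq ?_)) e
    refine (elEv_congr Q (fib_id T k) rfl (heq_endCast Q (fib_id T k).symm _)
      (d' := δ.elCast (π₀_U (src T k)).symm (d k)) ?_).trans ?_
    · exact (δ.heq_elCast _ _).trans (δ.heq_elCast _ _).symm
    refine (heq_of_eq (elEv_elUnit Q _)).trans ?_
    refine conv_el_congr E (fib_id T k).symm (fun m m' _ => (congrArg a (emb_id k m')).symm) rfl
      (P.heq_elCast _ _).symm (fun m m' _ => ?_)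
    refine ((δ.heq_elCast _ _).trans (δ.heq_elCast _ _)).trans (HEq.trans ?_
      (δ.heq_elCast _ _).symm)
    exact heq_apply d (emb_id k m').symm
  have h' := congrArg (· ⊳ e) h
  rw [El.map_comp, map_leftUnitor_inv, El.map_comp, map_whiskerRight, El.map_comp, map_tensUnit,
      map_tensMap, El.map_id] at h'
  simp only [El.map_comp] at h'
  exact h'

theorem elEv_ext {T : O} {Z : V} {F G : Z ⟶ (Q T).obj} (h : ∀ (i : C) (ι : Type) (X : ι → V)
    (x : El X Z) (d : El X (δ.obj (π₀ T) i)),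
    (Q T).elEv (F ⊳ x) d = (Q T).elEv (G ⊳ x) d) : F = G :=
  (Q T).hom_ext (.leaf Z) h

/-- Maps into an end are determined by their evaluations, where both bracketings become iterated
`elNu` and agree by `elNu_elNu`. -/
theorem condPreOperad_assoc {T S R : O} (f : T ⟶ S) (g : S ⟶ R)
    (x : ∀ j, El X (Q (fib f j)).obj) (y : ∀ i, El X (Q (fib g i)).obj) (z : El X (Q R).obj) :
    (condPreOperad Q).elMul f x ((condPreOperad Q).elMul g y z) =
      (condPreOperad Q).elMul (f ≫ g) (fun i => (condPreOperad Q).elMul (fibMap f g i)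
        (fun k => endCast Q (fib_fibMap f g i k).symm (x (emb g i k))) (y i)) z := by
  have h : (α_ _ _ _).hom ≫ (tens fun j => (Q (fib f j)).obj) ◁ (condPreOperad Q).mul g ≫
      (condPreOperad Q).mul f =
      (condPreOperad Q).fibreMul f g ▷ (Q R).obj ≫ (condPreOperad Q).mul (f ≫ g) := by
    refine (Q T).hom_ext (.mul (.mul (.tens _ fun j => .leaf (Q (fib f j)).obj)
      (.tens _ fun i => .leaf (Q (fib g i)).obj)) (.leaf (Q R).obj)) fun i ι X x d => ?_
    suffices H : ∀ (x : ∀ j, El X (Q (fib f j)).obj) (y : ∀ i, El X (Q (fib g i)).obj)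
        (z : El X (Q R).obj), (Q T).elEv (_ ⊳ (tprod x ⊠ tprod y) ⊠ z) d =
          (Q T).elEv (_ ⊳ (tprod x ⊠ tprod y) ⊠ z) d from H x.1.1 x.1.2 x.2
    intro x y z
    have e₁ := elEv_elMul Q f x ((condPreOperad Q).elMul g y z) d
    have e₂ := elEv_elMul Q (f ≫ g) (fun i => (condPreOperad Q).elMul (fibMap f g i)
        (fun k => endCast Q (fib_fibMap f g i k).symm (x (emb g i k))) (y i)) z d
    refine Eq.trans (congrArg (fun t => (Q T).elEv t d) ?_) (e₁.trans (Eq.trans ?_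
      (e₂.symm.trans (congrArg (fun t => (Q T).elEv t d) ?_))))
    · refine (El.map_comp _ _ _).trans ((congrArg (El.map _) (map_associator_hom _ _ _)).trans ?_)
      exact (El.map_comp _ _ _).trans (congrArg (El.map _) (map_whiskerLeft _ _ _))
    · refine (congrArg (elNu Q f x) (elEv_elMul Q g y z _)).trans ?_
      rw [elNu_elNu, δ.elCast_elCast]
    · exact ((El.map_comp _ _ _).trans (congrArg (El.map _) ((map_whiskerRight _ _ _).trans
        (congrArg (· ⊠ z) ((condPreOperad Q).map_fibreMul f g x y))))).symm
  have h' := congrArg (· ⊳ (tprod x ⊠ tprod y) ⊠ z) h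
  refine Eq.trans ?_ (h'.trans ?_)
  · refine Eq.symm ((El.map_comp _ _ _).trans ((congrArg (El.map _)
      (map_associator_hom _ _ _)).trans ?_))
    exact (El.map_comp _ _ _).trans (congrArg (El.map _) (map_whiskerLeft _ _ _))
  · exact ((El.map_comp _ _ _).trans (congrArg (El.map _) ((map_whiskerRight _ _ _).trans
        (congrArg (· ⊠ z) ((condPreOperad Q).map_fibreMul f g x y)))))

theorem condPreOperad_unit_mul (T : O) (x : El X (Q T).obj) :
    (condPreOperad Q).elMul (𝟙 T) (fun k => endCast Q (fib_id T k).symm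
      ((condPreOperad Q).elUnit (src T k))) x = x := by
  obtain ⟨F, hF⟩ : ∃ F : (Q T).obj ⟶ (Q T).obj, ∀ {ι : Type} {X : ι → V} (x : El X (Q T).obj),
      F ⊳ x = (condPreOperad Q).elMul (𝟙 T) (fun k => endCast Q (fib_id T k).symm
        ((condPreOperad Q).elUnit (src T k))) x :=
    ⟨_, fun x => (condPreOperad Q).map_unit_mul T x⟩
  have h : F = 𝟙 _ := elEv_ext Q fun i ι X x d => by
    rw [hF, El.map_id]
    refine (elEv_elMul Q (𝟙 T) _ _ d).trans ((elNu_id Q _).trans ?_)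
    rw [UFunctor.elCast_rfl]
  rw [← hF, h, El.map_id]

theorem condPreOperad_mul_unit (T : O) (x : El X (Q T).obj) :
    (condPreOperad Q).elMul (toU T) (fun k => endCast Q (fib_U (toU T) k).symm x)
      ((condPreOperad Q).elUnit (π₀ T)) = x := by
  obtain ⟨F, hF⟩ : ∃ F : (Q T).obj ⟶ (Q T).obj, ∀ {ι : Type} {X : ι → V} (x : El X (Q T).obj),
      F ⊳ x = (condPreOperad Q).elMul (toU T) (fun k => endCast Q (fib_U (toU T) k).symm x)
        ((condPreOperad Q).elUnit (π₀ T)) :=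
    ⟨_, fun x => (condPreOperad Q).map_mul_unit T x⟩
  have h : F = 𝟙 _ := elEv_ext Q fun i ι X x d => by
    rw [hF, El.map_id]
    refine (elEv_elMul Q (toU T) _ _ d).trans ((congrArg (elNu Q (toU T) _)
      (elEv_elUnit Q _)).trans ((elNu_el Q (toU T) _ _ _).trans ?_))
    refine Eq.trans (congrArg (elMulti E (toU T) (fun _ => i) i (P.elLin (P.elUId (π₀ T) i)))
      (funext fun k => eq_of_heq ?_)) (elMulti_toU E ((Q T).elEv x d))
    refine HEq.trans ?_ (heq_convCast E (fib_U (toU T) k).symm _).symm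
    refine elEv_congr Q (fib_U (toU T) k) rfl (heq_endCast Q (fib_U (toU T) k).symm _) ?_
    exact (δ.heq_elCast _ _).trans ((δ.heq_elCast _ _).trans (δ.heq_elCast _ _))
  rw [← hF, h, El.map_id]

/-- The condensation operad. -/
def condOperad : Operad O V :=
  Operad.ofElements (condPreOperad Q) (fun f g x y z => condPreOperad_assoc Q f g x y z)
    (fun T x => condPreOperad_unit_mul Q T x) fun T x => condPreOperad_mul_unit Q T x

/-- The condensation. -/
def condensation : Condensation δ where
  conv := E
  operad := condOperad Q
  ev T i := (Q T).ev i
  wedge T := (Q T).wedge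
  existsUnique_lift T := (Q T).existsUnique_lift
  unit_ev c := (exists_endUnit Q c).choose_spec
  μ := multi E
  ι_μ f b a i := by
    have h := termMul_eq E f b a i
    simp only [termMul, termRegroup, tensDistrib, Category.assoc,
      MonoidalCategory.whiskerLeft_comp] at h ⊢
    exact h
  ν := nu Q
  ι_ν := ι_nu Q
  mul_ev f := (exists_endMul Q f).choose_spec

theorem nonempty_condensation [HasLimits V] [HasColimits V] (δ : UFunctor P.toPreOperad V) :
    Nonempty (Condensation δ) :=
  have E := fun T => (nonempty_convolution δ T).some
  ⟨condensation fun T => (nonempty_convolutionEnd (E T)).some⟩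

end CondensationStructure

end

/-! ### Existence of totalizations -/

noncomputable section

open OperadicData OperadicCategory El

section Totalizations

variable {V : Type u} [Category.{v} V] [MonoidalCategory V]
  {K : Type uk} [Category.{vk} K] [EnrichedOrdinaryCategory V K]

/-- The end is written as a multiequalizer. Conical limits are preserved by the enriched
representables `eCoyoneda V X`, so the universal property holds for maps from an arbitrary `W` into
hom-objects. -/
theorem exists_conicalEnd (hK : Enriched.HasConicalLimitsOfSize.{v, v} V K) {A : Type v}
    {F : A → K} {H : A → A → K} (l : ∀ a b, F a ⟶ H a b) (r : ∀ a b, F b ⟶ H a b) :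
    ∃ (L : K) (p : ∀ a, L ⟶ F a), (∀ a b, p a ≫ l a b = p b ≫ r a b) ∧
      ∀ (X : K) (W : V) (x : ∀ a, W ⟶ (X ⟶[V] F a)),
        (∀ a b, x a ≫ eHomWhiskerLeft V X (l a b) = x b ≫ eHomWhiskerLeft V X (r a b)) →
        ∃! y : W ⟶ (X ⟶[V] L), ∀ a, y ≫ eHomWhiskerLeft V X (p a) = x a := by
  let I : MulticospanIndex (MulticospanShape.prod A) K :=
    { left := F
      right := fun q => H q.1 q.2
      fst := fun q => l q.1 q.2
      snd := fun q => r q.1 q.2 }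
  have hI : Enriched.HasConicalLimit V I.multicospan := inferInstance
  have : HasMultiequalizer I := hI.toHasLimit
  refine ⟨multiequalizer I, Multiequalizer.ι I, fun a b => Multiequalizer.condition I (a, b),
    fun X W x hx => ?_⟩
  have hlim := isLimitOfPreserves (eCoyoneda V X) (limit.isLimit I.multicospan)
  let c : Cone (I.multicospan ⋙ eCoyoneda V X) :=
    { pt := W
      π :=
        { app := fun j => match j with
            | .left a => x a
            | .right q => x q.1 ≫ eHomWhiskerLeft V X (l q.1 q.2)
          naturality := by
            rintro _ _ (_ | q | q)
            · refine (Category.id_comp _).trans ?_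
              rw [WalkingMulticospan.Hom.id_eq_id, CategoryTheory.Functor.map_id]
              exact (Category.comp_id _).symm
            · exact Category.id_comp _
            · exact (Category.id_comp _).trans (hx q.1 q.2) } }
  refine ⟨hlim.lift c, fun a => hlim.fac c (.left a), fun y hy => ?_⟩
  refine hlim.hom_ext fun j => ?_
  rw [hlim.fac]
  rcases j with a | q
  · exact hy a
  · have e₁ := ((eCoyoneda V X).mapCone (limit.cone I.multicospan)).w (WalkingMulticospan.Hom.fst q)
    have e₂ := c.w (WalkingMulticospan.Hom.fst q)
    rw [← e₁, ← e₂]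
    exact (Category.assoc _ _ _).symm.trans (congrArg (· ≫ eHomWhiskerLeft V X (l q.1 q.2))
      (hy q.1))

variable [SymmetricCategory V]

/-- The universal property of cotensors, on elements. -/
theorem exists_cotensor (hK : IsVComplete V K) (B : V) (Y : K) :
    ∃ (Z : K) (e : B ⟶ (Z ⟶[V] Y)),
      (∀ (A : K) (W : V) (x : W ⊗ B ⟶ (A ⟶[V] Y)), ∃ y : W ⟶ (A ⟶[V] Z),
        ∀ {ι : Type} {X : ι → V} (w : El X W) (b : El X B), (y ⊳ w) ⊙ (e ⊳ b) = x ⊳ w ⊠ b) ∧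
      ∀ (A : K) (W : V) (y y' : W ⟶ (A ⟶[V] Z)), (∀ (ι : Type) (X : ι → V) (w : El X W)
        (b : El X B), (y ⊳ w) ⊙ (e ⊳ b) = (y' ⊳ w) ⊙ (e ⊳ b)) → y = y' := by
  obtain ⟨Z, e, h⟩ := hK.cotensor B Y
  refine ⟨Z, e, fun A W x => ?_, fun A W y y' hy => (h A W _).unique rfl ?_⟩
  · obtain ⟨y, hy, -⟩ := h A W x
    refine ⟨y, fun w b => ?_⟩
    rw [← hy, El.map_comp, map_tensorHom]
    rfl
  · refine hom_ext_tmul fun ι X w b => ?_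
    rw [El.map_comp, map_tensorHom, El.map_comp, map_tensorHom]
    exact (hy ι X w b).symm

variable [MonoidalClosed V] {O : Type uo} [Category.{vo} O] [OperadicCategory.{w} O] {C : Type v}
  {P : PreOperad (Colored O C) V} (δ : UFunctor P V)

/-- An end of cotensors is the conical limit cut out of the cotensors of B(c, i) by δ(c, i) by two
maps into the cotensor of B(c, j) by δ(c, i) ⊗ U(P)(i, j): `l` uses the action on `B`, and `r` the
action on `δ`. -/
theorem nonempty_totalization (hK : IsVComplete V K) (B : UDiagram P K) (c : Comp O) :
    Nonempty (Totalization δ B c) := by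
  choose Z e he he' using fun i => exists_cotensor hK (δ.obj c i) (B.obj c i)
  choose M e₂ he₂ he₂' using fun i j =>
    exists_cotensor hK (δ.obj c i ⊗ uHom P c i j) (B.obj c j)
  have hl : ∀ i j, ∃ l : Z i ⟶ M i j, ∀ {ι : Type} {X : ι → V} (d : El X (δ.obj c i))
      (u : El X (uHom P c i j)),
      ofHom l ⊙ (e₂ i j ⊳ d ⊠ u) = (e i ⊳ d) ⊙ (B.map c i j ⊳ u) := by
    intro i j
    -- Morphisms of `K` correspond to maps out of the unit into hom-objects, so the cotensor
    -- property is applied with `W` the unit.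
    obtain ⟨y, hy⟩ := he₂ i j (Z i) (𝟙_ V) ((λ_ _).hom ≫ (e i ⊗ₘ B.map c i j) ≫ eComp V _ _ _)
    refine ⟨(eHomEquiv V).symm y, fun d u => ?_⟩
    rw [eHomEquiv_symm_ofHom, hy, El.map_comp, map_leftUnitor_hom, El.map_comp, map_tensorHom]
    rfl
  have hr : ∀ i j, ∃ r : Z j ⟶ M i j, ∀ {ι : Type} {X : ι → V} (d : El X (δ.obj c i))
      (u : El X (uHom P c i j)),
      ofHom r ⊙ (e₂ i j ⊳ d ⊠ u) = e j ⊳ δ.elAct d u := by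
    intro i j
    obtain ⟨y, hy⟩ := he₂ i j (Z j) (𝟙_ V) ((λ_ _).hom ≫ δ.act c i j ≫ e j)
    refine ⟨(eHomEquiv V).symm y, fun d u => ?_⟩
    rw [eHomEquiv_symm_ofHom, hy, El.map_comp, map_leftUnitor_hom, El.map_comp]
    rfl
  choose l hl using hl
  choose r hr using hr
  obtain ⟨L, p, hp, hL⟩ := exists_conicalEnd hK.conical l r
  refine ⟨⟨L, fun i => e i ≫ eHomWhiskerRight V (p i) (B.obj c i), fun i j => ?_,
    fun A W x hx => ?_⟩⟩
  · refine hom_ext_tmul fun ι X d u => ?_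
    rw [El.map_comp, El.map_comp, map_eHomWhiskerRight, El.map_comp, map_tensorHom, El.map_comp,
      map_eHomWhiskerRight, map_eComp, El.comp_assoc, ← hl, ofHom_comp_assoc, hp,
      ← ofHom_comp_assoc, hr]
    rfl
  · choose y hy using fun i => he i A W (x i)
    have hev : ∀ (z : W ⟶ (A ⟶[V] L)) (i : C), (∀ (ι : Type) (X : ι → V) (w : El X W)
        (d : El X (δ.obj c i)), (z ⊗ₘ (e i ≫ eHomWhiskerRight V (p i) (B.obj c i))) ≫
          eComp V A L (B.obj c i) ⊳ w ⊠ d =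
          (z ≫ eHomWhiskerLeft V A (p i) ⊳ w) ⊙ (e i ⊳ d)) := by
      intro z i ι X w d
      rw [El.map_comp, map_tensorHom, El.map_comp, map_eHomWhiskerRight, map_eComp, El.map_comp,
        map_eHomWhiskerLeft, El.comp_assoc]
    obtain ⟨z, hz, hz'⟩ := hL A W y fun i j => he₂' i j A W _ _ fun ι X w b => by
      have h : (y i ≫ eHomWhiskerLeft V A (l i j) ⊗ₘ e₂ i j) ≫ eComp V _ _ _ =
          (y j ≫ eHomWhiskerLeft V A (r i j) ⊗ₘ e₂ i j) ≫ eComp V _ _ _ := by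
        refine hom_ext_tmul_tmul fun ι X w d u => ?_
        have hx' := congrArg (· ⊳ w ⊠ d ⊠ u) (hx i j)
        simp only [El.map_comp, map_whiskerLeft, map_associator_inv, map_tensorHom,
          map_eComp] at hx'
        simp only [El.map_comp, map_tensorHom, map_eHomWhiskerLeft, map_eComp, El.comp_assoc, hl,
          hr]
        rw [← El.comp_assoc, hy, hy]
        exact hx'.symm
      have h' := congrArg (· ⊳ w ⊠ b) h
      simp only [El.map_comp, map_tensorHom, map_eComp] at h'
      simpa only [El.map_comp] using h'
    refine ⟨z, fun i => hom_ext_tmul fun ι X w d => ?_, fun z' h => hz' z' fun i =>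
      he' i A W _ _ fun ι X w d => ?_⟩
    · rw [hev, hz, hy]
    · rw [← hev, h, hy]

end Totalizations

end

/-! ### Composition with the comultiplication of a multicotensor -/

noncomputable section

open OperadicData OperadicCategory El

section Mix

variable {V : Type u} [Category.{v} V] [MonoidalCategory V] [SymmetricCategory V]
  {ι : Type} {X : ι → V} {K : Type uk} [Category.{vk} K] [EnrichedOrdinaryCategory V K]

namespace El

theorem comp_congr {A B C A' B' C' : K} (hA : A = A') (hB : B = B') (hC : C = C')
    {x : El X (A ⟶[V] B)} {x' : El X (A' ⟶[V] B')} (hx : HEq x x')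
    {y : El X (B ⟶[V] C)} {y' : El X (B' ⟶[V] C')} (hy : HEq y y') : HEq (x ⊙ y) (x' ⊙ y') := by
  subst hA hB hC
  rw [eq_of_heq hx, eq_of_heq hy]

theorem heq_ofHom_eqToHom_comp {A B C : K} (h : A = B) (x : El X (B ⟶[V] C)) :
    HEq (ofHom (eqToHom h) ⊙ x) x := by
  subst h
  rw [eqToHom_refl, ofHom_id_comp]

theorem heq_comp_ofHom_eqToHom {A B C : K} (h : B = C) (x : El X (A ⟶[V] B)) :
    HEq (x ⊙ ofHom (eqToHom h)) x := by
  subst h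
  rw [eqToHom_refl, comp_ofHom_id]

end El

variable {O : Type uo} [Category.{vo} O] [OperadicCategory.{w} O]

namespace Multicotensor

variable (D : Multicotensor O V K)

theorem ofHom_counit_congr {c : Comp O} {Y Y' : Fin (card (U c)) → K} (hY : Y = Y')
    (k : Fin (card (U c))) :
    HEq (ofHom (D.counit c Y k) : El X _) (ofHom (D.counit c Y' k) : El X _) := by
  subst hY
  rfl

/-- Composition with the comultiplication. -/
def mix {T S : O} (f : T ⟶ S) {Y : Fin (card T) → K} {Y' : ∀ k, Fin (card (fib f k)) → K}
    (h : ∀ k l, Y (emb f k l) = Y' k l) {G : Fin (card S) → K} {H : K}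
    (z : ∀ k, El X ((D.D (fib f k)).obj (Y' k) ⟶[V] G k)) (y : El X ((D.D S).obj G ⟶[V] H)) :
    El X ((D.D T).obj Y ⟶[V] H) :=
  ofHom (D.comul f Y ≫ eqToHom (congrArg (D.D S).obj (funext fun k =>
    congrArg (D.D (fib f k)).obj (funext fun l => h k l)))) ⊙ (D.D S).elMap z ⊙ y

theorem mix_comp_right {T S : O} (f : T ⟶ S) {Y : Fin (card T) → K}
    {Y' : ∀ k, Fin (card (fib f k)) → K} (h : ∀ k l, Y (emb f k l) = Y' k l)
    {G : Fin (card S) → K} {H H' : K} (z : ∀ k, El X ((D.D (fib f k)).obj (Y' k) ⟶[V] G k))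
    (y : El X ((D.D S).obj G ⟶[V] H)) (x : El X (H ⟶[V] H')) :
    D.mix f h z y ⊙ x = D.mix f h z (y ⊙ x) := by
  simp only [mix, El.comp_assoc]

theorem mix_comp_elMap {T S : O} (f : T ⟶ S) {Y : Fin (card T) → K}
    {Y' : ∀ k, Fin (card (fib f k)) → K} (h : ∀ k l, Y (emb f k l) = Y' k l)
    {G G' : Fin (card S) → K} {H : K} (z : ∀ k, El X ((D.D (fib f k)).obj (Y' k) ⟶[V] G k))
    (g : ∀ k, El X (G k ⟶[V] G' k)) (y : El X ((D.D S).obj G' ⟶[V] H)) :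
    D.mix f h (fun k => z k ⊙ g k) y = D.mix f h z ((D.D S).elMap g ⊙ y) := by
  simp only [mix]
  rw [← MultiFunctor.elMap_comp, El.comp_assoc]

/-- By `V`-naturality of the comultiplication, a family acting on |T| acts instead on each fibre. -/
theorem elMap_mix {T S : O} (f : T ⟶ S) {Y₁ Y₂ : Fin (card T) → K}
    {Y₁' Y₂' : ∀ k, Fin (card (fib f k)) → K} (h₁ : ∀ k l, Y₁ (emb f k l) = Y₁' k l)
    (h₂ : ∀ k l, Y₂ (emb f k l) = Y₂' k l) {G : Fin (card S) → K} {H : K}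
    (x : ∀ j, El X (Y₁ j ⟶[V] Y₂ j)) (x' : ∀ k l, El X (Y₁' k l ⟶[V] Y₂' k l))
    (hx : ∀ k l, HEq (x (emb f k l)) (x' k l))
    (z : ∀ k, El X ((D.D (fib f k)).obj (Y₂' k) ⟶[V] G k)) (y : El X ((D.D S).obj G ⟶[V] H)) :
    (D.D T).elMap x ⊙ D.mix f h₂ z y =
      D.mix f h₁ (fun k => (D.D (fib f k)).elMap (x' k) ⊙ z k) y := by
  obtain rfl : (fun k l => Y₁ (emb f k l)) = Y₁' := funext fun k => funext fun l => h₁ k l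
  obtain rfl : (fun k l => Y₂ (emb f k l)) = Y₂' := funext fun k => funext fun l => h₂ k l
  obtain rfl : (fun k l => x (emb f k l)) = x' :=
    funext fun k => funext fun l => eq_of_heq (hx k l)
  simp only [mix, eqToHom_refl, Category.comp_id]
  rw [← El.comp_assoc, elMap_comul, El.comp_assoc, ← MultiFunctor.elMap_comp, El.comp_assoc]

/-- The fibres of an identity are chosen terminal objects, and their counits undo the
comultiplication (`counit_comul`). -/
theorem mix_id {T : O} {Y : Fin (card T) → K} {Y' : ∀ k, Fin (card (fib (𝟙 T) k)) → K}
    (h : ∀ k l, Y (emb (𝟙 T) k l) = Y' k l) {G : Fin (card T) → K} {H : K}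
    (z : ∀ k, El X ((D.D (fib (𝟙 T) k)).obj (Y' k) ⟶[V] G k)) (y : El X ((D.D T).obj G ⟶[V] H))
    (g : ∀ k, El X (Y k ⟶[V] G k))
    (hz : ∀ k, HEq (z k) (ofHom (D.counit (src T k) (fun _ => Y k) (pt rfl)) ⊙ g k)) :
    D.mix (𝟙 T) h z y = (D.D T).elMap g ⊙ y := by
  obtain rfl : (fun k l => Y (emb (𝟙 T) k l)) = Y' := funext fun k => funext fun l => h k l
  have e : z = fun k => ofHom (eqToHom (obj_congr D.D (fib_id T k) (heq_comp_emb_id k Y)) ≫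
      D.counit (src T k) (fun _ => Y k) (pt rfl)) ⊙ g k := by
    funext k
    rw [ofHom_comp, El.comp_assoc]
    exact eq_of_heq ((hz k).trans (heq_ofHom_eqToHom_comp _ _).symm)
  subst e
  have hc := congrArg (fun φ => (ofHom φ : El X _)) (D.counit_comul T Y)
  simp only [ofHom_comp, ← MultiFunctor.elMap_ofHom] at hc
  simp only [mix, eqToHom_refl, Category.comp_id]
  rw [← MultiFunctor.elMap_comp, El.comp_assoc, ← El.comp_assoc]
  simp only [ofHom_comp]
  refine (congrArg (fun t => t ⊙ (D.D T).elMap g ⊙ y) hc).trans ?_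
  rw [ofHom_id_comp]

/-- The counit moves past `z` by its naturality, and then cancels the comultiplication along the map
to the terminal object (`comul_counit`). -/
theorem mix_toU {T : O} {Y : Fin (card T) → K} {Y' : ∀ k, Fin (card (fib (toU T) k)) → K}
    (h : ∀ k l, Y (emb (toU T) k l) = Y' k l) {G : Fin (card (U (π₀ T))) → K} {H : K}
    (z : ∀ k, El X ((D.D (fib (toU T) k)).obj (Y' k) ⟶[V] G k)) (k : Fin (card (U (π₀ T))))
    (y : El X (G k ⟶[V] H)) (x : El X ((D.D T).obj Y ⟶[V] G k)) (hz : HEq (z k) x) :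
    D.mix (toU T) h z (ofHom (D.counit (π₀ T) G k) ⊙ y) = x ⊙ y := by
  obtain rfl : (fun k l => Y (emb (toU T) k l)) = Y' := funext fun k => funext fun l => h k l
  have hc := congrArg (fun φ => (ofHom φ : El X _)) (D.comul_counit T Y k)
  simp only [ofHom_comp] at hc
  simp only [mix, eqToHom_refl, Category.comp_id]
  rw [← El.comp_assoc ((D.D (U (π₀ T))).elMap z), elMap_counit, ← El.comp_assoc, ← El.comp_assoc]
  refine congrArg (· ⊙ y) ?_
  refine (congrArg (· ⊙ z k) hc).trans (eq_of_heq ((heq_ofHom_eqToHom_comp _ _).trans hz))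

end Multicotensor

variable {D : Multicotensor O V K} {P : PreOperad O V} {Y : Comp O → K}

theorem Algebra.app_elMul_eq_mix (A : Algebra D P Y) {T S : O} (f : T ⟶ S)
    (x : ∀ i, El X (P.obj (fib f i))) (y : El X (P.obj S)) :
    A.app T ⊳ P.elMul f x y =
      D.mix f (Y := fun k => Y (src T k)) (Y' := fun k l => Y (src (fib f k) l))
        (G := fun k => Y (src S k)) (fun k l => congrArg Y (src_fib f k l).symm)
        (fun k => (A.app (fib f k) ⊳ x k) ⊙ ofHom (eqToHom (congrArg Y (π₀_fib f k))))
        ((A.app S ⊳ y) ⊙ ofHom (eqToHom (congrArg Y (π₀_eq f).symm))) :=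
  (A.app_elMul f x y).trans (D.mix_comp_right _ _ _ _ _)

theorem Algebra.app_congr (A : Algebra D P Y) {T T' : O} (h : T = T') {x : El X (P.obj T)}
    {x' : El X (P.obj T')} (hx : HEq x x') : HEq (A.app T ⊳ x) (A.app T' ⊳ x') := by
  subst h
  rw [eq_of_heq hx]

end Mix

end

/-! ### Restriction of algebras to the underlying category -/

noncomputable section

open OperadicData OperadicCategory El

section Restriction

variable {V : Type u} [Category.{v} V] [MonoidalCategory V] [SymmetricCategory V]
  {ι : Type} {X : ι → V} {K : Type uk} [Category.{vk} K] [EnrichedOrdinaryCategory V K]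
  {O : Type uo} [Category.{vo} O] [OperadicCategory.{w} O] {C : Type v}

/-- The multiplication of the endomorphism operad on elements. -/
theorem Multicotensor.map_endOperad_mul (D : Multicotensor O V K) (Y : Comp O → K) {T S : O}
    (f : T ⟶ S)
    (x : ∀ k, El X ((D.D (fib f k)).obj (fun l => Y (src (fib f k) l)) ⟶[V] Y (π₀ (fib f k))))
    (y : El X ((D.D S).obj (fun k => Y (src S k)) ⟶[V] Y (π₀ S))) :
    El.map ((D.endOperad Y).mul f) (tprod x ⊠ y) =
      D.mix f (Y := fun k => Y (src T k)) (Y' := fun k l => Y (src (fib f k) l))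
        (G := fun k => Y (src S k)) (fun k l => congrArg Y (src_fib f k l).symm)
        (fun k => x k ⊙ ofHom (eqToHom (congrArg Y (π₀_fib f k))))
        (y ⊙ ofHom (eqToHom (congrArg Y (π₀_eq f).symm))) := by
  refine Eq.trans ?_ (D.mix_comp_right _ _ _ _ _)
  simp only [El.map_comp, map_tensMap, Multicotensor.endOperad, map_whiskerRight,
    map_eHomWhiskerLeft, map_eHomWhiskerRight]
  rfl

/-- Composition with the comultiplication as a morphism. -/
def Multicotensor.mixHom (D : Multicotensor O V K) {T S : O} (f : T ⟶ S) {Y : Fin (card T) → K}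
    {Y' : ∀ k, Fin (card (fib f k)) → K} (h : ∀ k l, Y (emb f k l) = Y' k l)
    (G : Fin (card S) → K) (H : K) :
    (tens fun k => (D.D (fib f k)).obj (Y' k) ⟶[V] G k) ⊗ ((D.D S).obj G ⟶[V] H) ⟶
      ((D.D T).obj Y ⟶[V] H) :=
  (D.D S).map (fun k => (D.D (fib f k)).obj (Y' k)) G ▷ _ ≫ eComp V _ _ _ ≫
    eHomWhiskerRight V (D.comul f Y ≫ eqToHom (congrArg (D.D S).obj (funext fun k =>
      congrArg (D.D (fib f k)).obj (funext fun l => h k l)))) H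

theorem Multicotensor.map_mixHom (D : Multicotensor O V K) {T S : O} (f : T ⟶ S)
    {Y : Fin (card T) → K} {Y' : ∀ k, Fin (card (fib f k)) → K}
    (h : ∀ k l, Y (emb f k l) = Y' k l) {G : Fin (card S) → K} {H : K}
    (z : ∀ k, El X ((D.D (fib f k)).obj (Y' k) ⟶[V] G k)) (y : El X ((D.D S).obj G ⟶[V] H)) :
    D.mixHom f h G H ⊳ tprod z ⊠ y = D.mix f h z y := by
  simp only [mixHom, El.map_comp, map_whiskerRight, map_eHomWhiskerRight]
  rfl

/-- The action of the underlying category on elements. -/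
def UDiagram.elMap {P : PreOperad (Colored O C) V} (B : UDiagram P K) {c : Comp O} {i j : C}
    (u : El X (uHom P c i j)) : El X (B.obj c i ⟶[V] B.obj c j) :=
  B.map c i j ⊳ u

variable {P : PreOperad (Colored O C) V} {D : ColaxMonoidal O V K}
  {Y : Comp (Colored O C) → K} (A : Algebra (D.toMulticotensor.colored C) P Y)

/-- The action of the operad on elements. -/
def algEl {T : O} {a : Fin (card T) → C} {i : C} (p : El X (P.obj (colObj T a i))) :
    El X ((D.D T).obj (fun k => (restrict D A).obj (src T k) (a k)) ⟶[V]
      (restrict D A).obj (π₀ T) i) :=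
  A.app (colObj T a i) ⊳ p

theorem algEl_congr {T T' : O} {a : Fin (card T) → C} {a' : Fin (card T') → C} {i i' : C}
    (h : colObj T a i = colObj T' a' i') {p : El X (P.obj (colObj T a i))}
    {p' : El X (P.obj (colObj T' a' i'))} (hp : HEq p p') : HEq (algEl A p) (algEl A p') :=
  A.app_congr h hp

/-- The restriction is defined through the inverse of the counit, so composing with the counit
recovers the original action of P(U_c(i; j)). -/
theorem heq_counit_elMap {c : Comp O} {i j : C} (u : El X (uHom P c i j)) :
    HEq (ofHom (D.counit c (fun _ => (restrict D A).obj c i) (pt rfl)) ⊙ (restrict D A).elMap u)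
      (algEl A (P.elLin u)) := by
  have := D.isIso_counit c (fun _ => (restrict D A).obj c i) (pt rfl)
  have e : (restrict D A).elMap u = (ofHom (inv (D.counit c (fun _ => (restrict D A).obj c i)
      (pt rfl)) ≫ eqToHom (congrArg (D.D (U c)).obj (funext fun k =>
        congrArg (fun d => (restrict D A).obj d i) (src_U c k).symm))) ⊙
      algEl A (P.elLin u)) ⊙ ofHom (eqToHom (congrArg (fun d => (restrict D A).obj d j)
        (π₀_U c))) := by
    simp only [UDiagram.elMap]
    refine (El.map_comp _ _ _).trans ((El.map_comp _ _ _).trans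
      ((map_eHomWhiskerLeft _ _).trans ?_))
    exact congrArg (fun t => El.comp t _) (map_eHomWhiskerRight _ _)
  rw [e, ← El.comp_assoc, ← El.comp_assoc, ← ofHom_comp, IsIso.hom_inv_id_assoc]
  exact (heq_comp_ofHom_eqToHom _ _).trans (heq_ofHom_eqToHom_comp _ _)

theorem algEl_colMul {T S : O} (f : T ⟶ S) (b : Fin (card T) → C)
    (a : Fin (card S) → C) (i : C) (x : ∀ k, El X (P.obj (colObj (fib f k) (b ∘ emb f k) (a k))))
    (y : El X (P.obj (colObj S a i))) :
    algEl A (P.colMul f b a i x y) =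
      D.mix f (Y := fun l => (restrict D A).obj (src T l) (b l))
        (Y' := fun k l => (restrict D A).obj (src (fib f k) l) (b (emb f k l)))
        (G := fun k => (restrict D A).obj (src S k) (a k))
        (fun k l => congrArg (fun c => (restrict D A).obj c (b (emb f k l))) (src_fib f k l).symm)
        (fun k => algEl A (x k) ⊙
          ofHom (eqToHom (congrArg (fun c => (restrict D A).obj c (a k)) (π₀_fib f k))))
        (algEl A y ⊙ ofHom (eqToHom (congrArg (fun c => (restrict D A).obj c i)
          (π₀_eq f).symm))) :=
  A.app_elMul_eq_mix (colHom f b a i) x y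

/-- The contravariant action is multiplication along `𝟙 T`; by `mix_id` the algebra turns it into
precomposition with `D_T` of the restricted action. This matches the coend relation. -/
theorem algEl_elContra {T : O} {a b : Fin (card T) → C} {i : C}
    (u : ∀ k, El X (uHom P (src T k) (a k) (b k))) (p : El X (P.obj (colObj T b i))) :
    algEl A (P.elContra u p) =
      (D.D T).elMap (fun k => (restrict D A).elMap (u k)) ⊙ algEl A p := by
  rw [P.elContra_eq, algEl_colMul,
    D.mix_id _ _ _ (fun k => (restrict D A).elMap (u k)) fun k => ?_]
  · rw [eqToHom_refl, comp_ofHom_id]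
  · refine (heq_comp_ofHom_eqToHom _ _).trans (HEq.trans ?_ (heq_counit_elMap A (u k)).symm)
    exact algEl_congr A (colObj_fib_id T a b k) (P.heq_elCast _ _)

/-- The covariant action is multiplication along `toU T`; by `mix_toU` the algebra turns it into
postcomposition with the restricted action. -/
theorem algEl_elCo {T : O} {a : Fin (card T) → C} {i j : C} (p : El X (P.obj (colObj T a i)))
    (u : El X (uHom P (π₀ T) i j)) :
    algEl A (P.elCo p u) = algEl A p ⊙ (restrict D A).elMap u := by
  let G : Fin (card (U (π₀ T))) → K := fun k => (restrict D A).obj (src (U (π₀ T)) k) i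
  have hG : ∀ k, G k = (restrict D A).obj (π₀ T) i := fun k =>
    congrArg (fun c => (restrict D A).obj c i) (src_U (π₀ T) k)
  have e : algEl A (P.elLin u) ⊙ ofHom (eqToHom (congrArg (fun c => (restrict D A).obj c j)
      (π₀_eq (toU T)).symm)) = ofHom (D.counit (π₀ T) G (pt rfl)) ⊙
        ofHom (eqToHom (hG (pt rfl))) ⊙ (restrict D A).elMap u := by
    refine eq_of_heq ((heq_comp_ofHom_eqToHom _ _).trans ((heq_counit_elMap A u).symm.trans ?_))
    refine El.comp_congr (congrArg _ (funext fun k => (hG k).symm)) (hG _).symm rfl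
      (D.ofHom_counit_congr (funext fun k => (hG k).symm) _) (heq_ofHom_eqToHom_comp _ _).symm
  rw [P.elCo_eq, algEl_colMul, e, D.mix_toU _ _ (pt rfl) _
    (algEl A p ⊙ ofHom (eqToHom (hG (pt rfl)).symm)) ?_]
  · rw [El.comp_assoc, ← El.comp_assoc (ofHom _), ← ofHom_comp, eqToHom_trans, eqToHom_refl,
      ofHom_id_comp]
  · refine (heq_comp_ofHom_eqToHom _ _).trans (HEq.trans ?_ (heq_comp_ofHom_eqToHom _ _).symm)
    exact algEl_congr A (colObj_fib_toU T a i _) (P.heq_elCast _ _)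

theorem algEl_elUId (c : Comp O) (i : C) :
    algEl A (P.elLin (P.elUId c i : El X (uHom P c i i))) =
      ofHom (D.counit c (fun k => (restrict D A).obj (src (U c) k) i) (pt rfl) ≫
        eqToHom (congrArg (fun c => (restrict D A).obj c i)
          ((src_U c (pt rfl)).trans (π₀_U c).symm))) :=
  A.app_elUnit ((c, i) : Comp O × C)

variable {A} {Z : Comp (Colored O C) → K} {B : Algebra (D.toMulticotensor.colored C) P Z}
  {φ : ∀ c, Y c ⟶ Z c}

/-- The components of a morphism of algebras as morphisms between the restrictions. -/
def restrictHom (A : Algebra (D.toMulticotensor.colored C) P Y)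
    (B : Algebra (D.toMulticotensor.colored C) P Z) (φ : ∀ c, Y c ⟶ Z c) (c : Comp O) (i : C) :
    (restrict D A).obj c i ⟶ (restrict D B).obj c i :=
  φ ((c, i) : Comp O × C)

theorem IsAlgebraHom.algEl_comp (h : IsAlgebraHom A B φ) {T : O} {a : Fin (card T) → C} {i : C}
    (p : El X (P.obj (colObj T a i))) :
    algEl A p ⊙ ofHom (restrictHom A B φ (π₀ T) i) =
      (D.D T).elMap (fun k => ofHom (restrictHom A B φ (src T k) (a k))) ⊙ algEl B p := by
  have h' := congrArg (· ⊳ p) (h (colObj T a i))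
  rw [MultiFunctor.elMap_ofHom]
  exact ((El.map_comp _ _ _).trans (map_eHomWhiskerLeft _ _)).symm.trans
    (h'.trans ((El.map_comp _ _ _).trans (map_eHomWhiskerRight _ _)))

theorem heq_ofHom_restrictHom {c c' : Comp O} (h : c = c') (i : C) :
    HEq (ofHom (restrictHom A B φ c i) : El X _) (ofHom (restrictHom A B φ c' i) : El X _) := by
  subst h
  rfl

theorem heq_elMap_restrictHom {n : ℕ} (F : MultiFunctor V K n) {c c' : Fin n → Comp O}
    (h : c = c') (i : C) :
    HEq (F.elMap fun k => (ofHom (restrictHom A B φ (c k) i) : El X _))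
      (F.elMap fun k => (ofHom (restrictHom A B φ (c' k) i) : El X _)) := by
  subst h
  rfl

/-- A morphism of algebras restricts to a `V`-natural transformation. After composition with the
invertible counit, this is its compatibility with the action of P(U_c(i; j)). -/
theorem IsAlgebraHom.elMap_comp (h : IsAlgebraHom A B φ) {c : Comp O} {i j : C}
    (u : El X (uHom P c i j)) :
    (restrict D A).elMap u ⊙ ofHom (restrictHom A B φ c j) =
      ofHom (restrictHom A B φ c i) ⊙ (restrict D B).elMap u := by
  have := D.isIso_counit c (fun _ => (restrict D A).obj c i) (pt rfl)
  have hs : (fun _ => c) = src (U c) := funext fun k => (src_U c k).symm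
  have hA : (D.D (U c)).obj (fun _ => (restrict D A).obj c i) =
      (D.D (U c)).obj fun k => (restrict D A).obj (src (U c) k) i :=
    congrArg (fun s => (D.D (U c)).obj fun k => (restrict D A).obj (s k) i) hs
  have hB : (D.D (U c)).obj (fun _ => (restrict D B).obj c i) =
      (D.D (U c)).obj fun k => (restrict D B).obj (src (U c) k) i :=
    congrArg (fun s => (D.D (U c)).obj fun k => (restrict D B).obj (s k) i) hs
  have e : ofHom (D.counit c (fun _ => (restrict D A).obj c i) (pt rfl)) ⊙
      (restrict D A).elMap u ⊙ ofHom (restrictHom A B φ c j) =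
      ofHom (D.counit c (fun _ => (restrict D A).obj c i) (pt rfl)) ⊙
      ofHom (restrictHom A B φ c i) ⊙ (restrict D B).elMap u := by
    rw [← El.comp_assoc (ofHom _) ((restrict D A).elMap u),
      ← El.comp_assoc (ofHom _) (ofHom _) ((restrict D B).elMap u),
      ← D.elMap_counit c (fun _ => ofHom (restrictHom A B φ c i)), El.comp_assoc (MultiFunctor.elMap _ _)]
    refine eq_of_heq ((El.comp_congr hA (congrArg (fun d => (restrict D A).obj d j)
      (π₀_U c).symm) (congrArg (fun d => (restrict D B).obj d j) (π₀_U c).symm)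
      (heq_counit_elMap A u) (heq_ofHom_restrictHom (φ := φ) (π₀_U c).symm j)).trans ?_)
    rw [h.algEl_comp]
    refine (El.comp_congr hA hB (congrArg (fun d => (restrict D B).obj d j) (π₀_U c).symm)
      (heq_elMap_restrictHom (φ := φ) (D.D (U c)) hs i) (heq_counit_elMap B u)).symm
  have e' := congrArg (fun x => ofHom (inv (D.counit c (fun _ => (restrict D A).obj c i)
    (pt rfl))) ⊙ x) e
  simpa only [ofHom_comp_assoc, IsIso.inv_hom_id, IsIso.inv_hom_id_assoc, ofHom_id_comp] using e'

end Restriction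

end

/-! ### Evaluating convolution products at totalizations -/

noncomputable section

open OperadicData OperadicCategory El

theorem El.hom_ext_tprod_tmul_tprod {V : Type u} [Category.{v} V] [MonoidalCategory V]
    [SymmetricCategory V] {n m : ℕ} {A : Fin n → V} {A' : Fin m → V} {B W : V}
    {F G : (tens A ⊗ B) ⊗ tens A' ⟶ W}
    (h : ∀ (ι : Type) (X : ι → V) (a : ∀ i, El X (A i)) (b : El X B) (a' : ∀ i, El X (A' i)),
      F ⊳ (tprod a ⊠ b) ⊠ tprod a' = G ⊳ (tprod a ⊠ b) ⊠ tprod a') : F = G :=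
  Shape.hom_ext (.mul (.mul (.tens n fun i => .leaf (A i)) (.leaf B))
    (.tens m fun i => .leaf (A' i))) fun ι X x => h ι X x.1.1 x.1.2 x.2

section TotalizationElements

variable {V : Type u} [Category.{v} V] [MonoidalCategory V] [SymmetricCategory V]
  [MonoidalClosed V] {ι : Type} {X : ι → V} {K : Type uk} [Category.{vk} K]
  [EnrichedOrdinaryCategory V K]
  {O : Type uo} [Category.{vo} O] [OperadicCategory.{w} O] {C : Type v}
  {P : PreOperad (Colored O C) V} {δ : UFunctor P V} {B : UDiagram P K}

namespace Totalization

/-- The evaluations of a totalization on elements. -/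
def elEv {c : Comp O} (t : Totalization δ B c) {i : C} (d : El X (δ.obj c i)) :
    El X (t.pt ⟶[V] B.obj c i) :=
  t.ev i ⊳ d

theorem elEv_act {c : Comp O} (t : Totalization δ B c) {i j : C} (d : El X (δ.obj c i))
    (u : El X (uHom P c i j)) : t.elEv (δ.elAct d u) = t.elEv d ⊙ B.elMap u := by
  have h := congrArg (· ⊳ d ⊠ u) (t.wedge i j)
  simp only [El.map_comp, map_tensorHom] at h
  exact h

theorem hom_ext {c : Comp O} (t : Totalization δ B c) (s : Shape V) {Z : K}
    {F G : s.eval ⟶ (Z ⟶[V] t.pt)}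
    (h : ∀ (i : C) (ι : Type) (X : ι → V) (x : s.Fam X) (d : El X (δ.obj c i)),
      (F ⊳ s.total x) ⊙ t.elEv d = (G ⊳ s.total x) ⊙ t.elEv d) : F = G := by
  refine (t.existsUnique_lift Z s.eval (fun i => (G ⊗ₘ t.ev i) ≫ eComp V _ _ _)
    fun i j => ?_).unique (fun i => ?_) fun i => rfl
  · refine hom_ext_tmul_tmul fun ι X x d u => ?_
    simp only [El.map_comp, map_whiskerLeft, map_tensorHom, map_associator_inv, map_eComp]
    refine Eq.trans (congrArg (fun y => El.comp (G ⊳ x) y) (t.elEv_act d u)) ?_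
    exact (El.comp_assoc _ _ _).symm
  · refine Shape.hom_ext (.mul s (.leaf _)) fun ι X x => ?_
    have e : ∀ H : s.eval ⟶ (Z ⟶[V] t.pt), (H ⊗ₘ t.ev i) ≫ eComp V _ _ _ ⊳
        s.total x.1 ⊠ x.2 = (H ⊳ s.total x.1) ⊙ t.elEv x.2 := fun H =>
      (El.map_comp _ _ _).trans (congrArg (El.map _) (map_tensorHom _ _ _ _))
    exact (e F).trans ((h i ι X x.1 x.2).trans (e G).symm)

theorem heq_elEv (t : ∀ c, Totalization δ B c) {c c' : Comp O} (h : c = c') {i : C}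
    {d : El X (δ.obj c i)} {d' : El X (δ.obj c' i)} (hd : HEq d d') :
    HEq ((t c).elEv d) ((t c').elEv d') := by
  subst h
  rw [eq_of_heq hd]

theorem elEv_elCast (t : ∀ c, Totalization δ B c) {c c' : Comp O} (h : c = c') {i : C}
    (d : El X (δ.obj c i)) :
    ofHom (eqToHom (congrArg (fun c => (t c).pt) h)) ⊙ (t c').elEv (δ.elCast h d) =
      (t c).elEv d ⊙ ofHom (eqToHom (congrArg (fun c => B.obj c i) h)) := by
  subst h
  rw [eqToHom_refl, eqToHom_refl, ofHom_id_comp, comp_ofHom_id, δ.elCast_rfl]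

end Totalization

variable {Y : Comp (Colored O C) → K} {D : ColaxMonoidal O V K}
  (A : Algebra (D.toMulticotensor.colored C) P Y)
  (t : ∀ c, Totalization δ (restrict D A) c)

/-- The map on a term of the convolution product given by the evaluations and the action of the
operad. -/
def convTerm {T : O} (a : Fin (card T) → C) (i : C) :
    (P.obj (colObj T a i) ⊗ tens fun k => δ.obj (src T k) (a k)) ⟶
      ((D.D T).obj (fun k => (t (src T k)).pt) ⟶[V] (restrict D A).obj (π₀ T) i) :=
  (A.app (colObj T a i) ⊗ₘ
    ((tensMap fun k => (t (src T k)).ev (a k)) ≫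
      (D.D T).map (fun k => (t (src T k)).pt)
        (fun k => (restrict D A).obj (src T k) (a k)))) ≫
    (β_ _ _).hom ≫
    eComp V ((D.D T).obj fun k => (t (src T k)).pt)
      ((D.D T).obj fun k => (restrict D A).obj (src T k) (a k))
      ((restrict D A).obj (π₀ T) i)

theorem map_convTerm {T : O} {a : Fin (card T) → C} {i : C} (p : El X (P.obj (colObj T a i)))
    (d : ∀ k, El X (δ.obj (src T k) (a k))) :
    convTerm A t a i ⊳ p ⊠ tprod d =
      (D.D T).elMap (fun k => (t (src T k)).elEv (d k)) ⊙ algEl A p := by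
  refine (El.map_comp _ _ _).trans ((congrArg (El.map _) ((map_tensorHom _ _ _ _).trans
    (congrArg (El.tmul _) ((El.map_comp _ _ _).trans (congrArg (El.map _)
      (map_tensMap _ _)))))).trans ?_)
  exact (El.map_comp _ _ _).trans (congrArg (El.map _) (map_braiding_hom _ _))

/-- The coend relation holds because `algEl_elContra` makes the action of U(P) on p a
precomposition, which the wedge condition of the totalizations absorbs into the evaluations. -/
theorem exists_evalConv {T : O} (E : Convolution δ T) (i : C) :
    ∃ θ : E.obj i ⟶
      ((D.D T).obj (fun k => (t (src T k)).pt) ⟶[V] (restrict D A).obj (π₀ T) i),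
      ∀ a, E.ι a i ≫ θ = convTerm A t a i := by
  refine ((E.isCoend i).existsUnique_desc _ (fun a => convTerm A t a i) fun a b => ?_).exists
  refine El.hom_ext_tprod_tmul_tprod fun ι X u p d => ?_
  rw [El.map_comp, map_convLeft, map_convTerm, El.map_comp, map_convRight, map_convTerm,
    algEl_elContra, ← El.comp_assoc, MultiFunctor.elMap_comp]
  simp only [Totalization.elEv_act]

/-- The map out of the convolution product given by the evaluations and the action of the
operad. -/
def evalConv {T : O} (E : Convolution δ T) (i : C) : E.obj i ⟶
    ((D.D T).obj (fun k => (t (src T k)).pt) ⟶[V] (restrict D A).obj (π₀ T) i) :=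
  (exists_evalConv A t E i).choose

theorem ι_evalConv {T : O} (E : Convolution δ T) (a : Fin (card T) → C) (i : C) :
    E.ι a i ≫ evalConv A t E i = convTerm A t a i :=
  (exists_evalConv A t E i).choose_spec a

/-- The map out of the convolution product on elements. -/
def elEvalConv {T : O} (E : Convolution δ T) {i : C} (e : El X (E.obj i)) :
    El X ((D.D T).obj (fun k => (t (src T k)).pt) ⟶[V] (restrict D A).obj (π₀ T) i) :=
  evalConv A t E i ⊳ e

theorem elEvalConv_el {T : O} (E : Convolution δ T) {a : Fin (card T) → C} {i : C}
    (p : El X (P.obj (colObj T a i))) (d : ∀ k, El X (δ.obj (src T k) (a k))) :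
    elEvalConv A t E (E.el a i p d) =
      (D.D T).elMap (fun k => (t (src T k)).elEv (d k)) ⊙ algEl A p := by
  rw [← map_convTerm, ← ι_evalConv A t E, El.map_comp]
  rfl

/-- Naturality in the root colour, from `algEl_elCo`; it supplies the wedge condition that defines
the action on totalizations. -/
theorem evalConv_act {T : O} (E : Convolution δ T) (i j : C) :
    E.act i j ≫ evalConv A t E j =
      (evalConv A t E i ⊗ₘ (restrict D A).map (π₀ T) i j) ≫ eComp V _ _ _ := by
  refine E.hom_ext_right fun ι X u a p d => ?_
  rw [El.map_comp, E.act_el, El.map_comp, map_tensorHom]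
  refine (elEvalConv_el A t E _ d).trans (Eq.trans ?_
    (congrArg (fun y => El.comp y ((restrict D A).elMap u)) (elEvalConv_el A t E p d)).symm)
  rw [algEl_elCo, El.comp_assoc]

/-- The components of the action on totalizations. -/
theorem exists_action {T : O} (E : Convolution δ T) {Z : V}
    (ev : ∀ i, Z ⊗ δ.obj (π₀ T) i ⟶ E.obj i)
    (hev : ∀ i j, Z ◁ δ.act (π₀ T) i j ≫ ev j =
      (α_ _ _ _).inv ≫ ev i ▷ uHom P (π₀ T) i j ≫ E.act i j) :
    ∃ α : Z ⟶ ((D.D T).obj (fun k => (t (src T k)).pt) ⟶[V] (t (π₀ T)).pt),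
      ∀ i, (α ⊗ₘ (t (π₀ T)).ev i) ≫ eComp V _ _ _ = ev i ≫ evalConv A t E i := by
  refine ((t (π₀ T)).existsUnique_lift _ _ (fun i => ev i ≫ evalConv A t E i)
    fun i j => ?_).exists
  rw [reassoc_of% hev, evalConv_act, MonoidalCategory.tensorHom_def,
    MonoidalCategory.tensorHom_def]
  simp only [comp_whiskerRight, Category.assoc]

end TotalizationElements

end

/-! ### The action of the condensation on totalizations -/

noncomputable section

open OperadicData OperadicCategory El

section CondensationElements

variable {V : Type u} [Category.{v} V] [MonoidalCategory V] [SymmetricCategory V]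
  [MonoidalClosed V] {ι : Type} {X : ι → V}
  {O : Type uo} [Category.{vo} O] [OperadicCategory.{w} O] {C : Type v}
  {P : Operad (Colored O C) V} {δ : UFunctor P.toPreOperad V}

namespace Condensation

variable (Q : Condensation δ)

/-- The evaluations of the condensation on elements. -/
def elEv {T : O} {i : C} (q : El X (Q.operad.obj T)) (d : El X (δ.obj (π₀ T) i)) :
    El X ((Q.conv T).obj i) :=
  Q.ev T i ⊳ q ⊠ d

/-- The multitensor structure on elements. -/
def elMu {T S : O} (f : T ⟶ S) {a : Fin (card S) → C} {i : C} (p : El X (P.obj (colObj S a i)))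
    (e : ∀ k, El X ((Q.conv (fib f k)).obj (a k))) : El X ((Q.conv T).obj i) :=
  Q.μ f a i ⊳ p ⊠ tprod e

/-- The composition with the multitensor structure on elements. -/
def elNu {T S : O} (f : T ⟶ S) {i : C} (q : ∀ k, El X (Q.operad.obj (fib f k)))
    (e : El X ((Q.conv S).obj i)) : El X ((Q.conv T).obj i) :=
  Q.ν f i ⊳ tprod q ⊠ e

theorem elMu_el {T S : O} (f : T ⟶ S) (b : Fin (card T) → C) (a : Fin (card S) → C) (i : C)
    (p : ∀ k, El X (P.obj (colObj (fib f k) (b ∘ emb f k) (a k))))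
    (q : El X (P.obj (colObj S a i))) (d : ∀ j, El X (δ.obj (src T j) (b j))) :
    (Q.elMu f q fun k => (Q.conv (fib f k)).el (b ∘ emb f k) (a k) (p k) (δ.elRes f d k)) =
      (Q.conv T).el b i (P.colMul f b a i p q) d := by
  have h : P.mul (colHom f b a i) ▷ (tens fun l => δ.obj (src T l) (b l)) ≫ (Q.conv T).ι b i =
      termRegroup P.toPreOperad δ f b a i ≫ P.obj (colObj S a i) ◁
        (tensMap fun k => (Q.conv (fib f k)).ι (b ∘ emb f k) (a k)) ≫ Q.μ f a i := by
    refine (Q.ι_μ f b a i).trans ?_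
    simp only [termRegroup, tensDistrib, Category.assoc, MonoidalCategory.whiskerLeft_comp]
    rfl
  have h' := congrArg (· ⊳ (tprod p ⊠ q) ⊠ tprod d) h
  refine Eq.trans ?_ (h'.symm.trans ?_)
  · refine Eq.symm ((El.map_comp _ _ _).trans ((congrArg (El.map _)
      (map_termRegroup f p q d)).trans ((El.map_comp _ _ _).trans (congrArg (El.map _) ?_))))
    exact (map_whiskerLeft _ _ _).trans (congrArg (El.tmul _) (map_tensMap _ _))
  · exact (El.map_comp _ _ _).trans (congrArg (El.map _) (map_whiskerRight _ _ _))

theorem elNu_el {T S : O} (f : T ⟶ S) {a : Fin (card S) → C} {i : C}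
    (q : ∀ k, El X (Q.operad.obj (fib f k))) (p : El X (P.obj (colObj S a i)))
    (d : ∀ k, El X (δ.obj (src S k) (a k))) :
    Q.elNu f q ((Q.conv S).el a i p d) =
      Q.elMu f p fun k => Q.elEv (q k) (δ.elCast (π₀_fib f k).symm (d k)) := by
  have h := congrArg (· ⊳ tprod q ⊠ p ⊠ tprod d) (Q.ι_ν f a i)
  simp only [El.map_comp, map_associator_inv, map_whiskerRight, map_braiding_hom,
    map_associator_hom, map_whiskerLeft, map_tensZip, map_tensMap] at h
  exact h

theorem elEv_elMul {T S : O} (f : T ⟶ S) {i : C} (q : ∀ k, El X (Q.operad.obj (fib f k)))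
    (r : El X (Q.operad.obj S)) (d : El X (δ.obj (π₀ T) i)) :
    Q.elEv (Q.operad.elMul f q r) d = Q.elNu f q (Q.elEv r (δ.elCast (π₀_eq f) d)) := by
  have h := congrArg (· ⊳ (tprod q ⊠ r) ⊠ d) (Q.mul_ev f i)
  simp only [El.map_comp, map_whiskerRight, map_associator_hom, map_whiskerLeft] at h
  exact h

theorem elEv_elUnit {c : Comp O} {i : C} (d : El X (δ.obj (π₀ (U c)) i)) :
    Q.elEv (Q.operad.elUnit c) d = (Q.conv (U c)).el (fun _ => i) i
      (P.elLin (P.elUId c i)) fun k => δ.elCast ((π₀_U c).trans (src_U c k).symm) d := by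
  have h := congrArg (· ⊳ (one : El X (𝟙_ V)) ⊠ d) (Q.unit_ev c i)
  simp only [El.map_comp, map_whiskerRight] at h
  refine h.trans ((El.map_comp _ _ _).trans (congrArg (El.map _) ?_))
  exact (map_tensorHom _ _ _ _).trans (congrArg (El.tmul _) (map_tensOne _ _ _ _))

end Condensation

variable {K : Type uk} [Category.{vk} K] [EnrichedOrdinaryCategory V K]
  {Y : Comp (Colored O C) → K} {D : ColaxMonoidal O V K} (Q : Condensation δ)
  (A : Algebra (D.toMulticotensor.colored C) P.toPreOperad Y)
  (t : ∀ c, Totalization δ (restrict D A) c)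

/-- Evaluation at totalizations takes the multitensor to composition with the comultiplication of
`D`. On classes of terms this is the algebra axiom (`algEl_colMul`) together with naturality of the
comultiplication (`Multicotensor.elMap_mix`). -/
theorem elEvalConv_elMu {T S : O} (f : T ⟶ S) {a : Fin (card S) → C} {i : C}
    (p : El X (P.obj (colObj S a i))) (e : ∀ k, El X ((Q.conv (fib f k)).obj (a k))) :
    elEvalConv A t (Q.conv T) (Q.elMu f p e) =
      D.mix f (Y := fun l => (t (src T l)).pt) (Y' := fun k l => (t (src (fib f k) l)).pt)
        (G := fun k => (restrict D A).obj (src S k) (a k))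
        (fun k l => congrArg (fun c => (t c).pt) (src_fib f k l).symm)
        (fun k => elEvalConv A t (Q.conv (fib f k)) (e k) ⊙
          ofHom (eqToHom (congrArg (fun c => (restrict D A).obj c (a k)) (π₀_fib f k))))
        (algEl A p ⊙ ofHom (eqToHom (congrArg (fun c => (restrict D A).obj c i)
          (π₀_eq f).symm))) := by
  let R := (β_ _ _).hom ≫ ((tensMap fun k => evalConv A t (Q.conv (fib f k)) (a k) ≫
    eHomWhiskerLeft V _ (eqToHom (congrArg (fun c => (restrict D A).obj c (a k))
      (π₀_fib f k)))) ⊗ₘ (A.app (colObj S a i) ≫ eHomWhiskerLeft V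
        ((D.D S).obj (fun k => (restrict D A).obj (src S k) (a k)))
        (eqToHom (congrArg (fun c => (restrict D A).obj c i) (π₀_eq f).symm)))) ≫
      D.mixHom f (Y := fun l => (t (src T l)).pt) (Y' := fun k l => (t (src (fib f k) l)).pt)
        (fun k l => congrArg (fun c => (t c).pt) (src_fib f k l).symm)
        (fun k => (restrict D A).obj (src S k) (a k)) ((restrict D A).obj (π₀ T) i)
  have hR : ∀ {ι : Type} {X : ι → V} (p : El X (P.obj (colObj S a i)))
      (e : ∀ k, El X ((Q.conv (fib f k)).obj (a k))), R ⊳ p ⊠ tprod e =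
      D.mix f (Y := fun l => (t (src T l)).pt) (Y' := fun k l => (t (src (fib f k) l)).pt)
        (G := fun k => (restrict D A).obj (src S k) (a k))
        (fun k l => congrArg (fun c => (t c).pt) (src_fib f k l).symm)
        (fun k => elEvalConv A t (Q.conv (fib f k)) (e k) ⊙
          ofHom (eqToHom (congrArg (fun c => (restrict D A).obj c (a k)) (π₀_fib f k))))
        (algEl A p ⊙ ofHom (eqToHom (congrArg (fun c => (restrict D A).obj c i)
          (π₀_eq f).symm))) := by
    intro ι X p e
    rw [← D.map_mixHom]
    refine (El.map_comp _ _ _).trans ((congrArg (El.map _) (map_braiding_hom _ _)).trans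
      ((El.map_comp _ _ _).trans (congrArg (El.map _) ((map_tensorHom _ _ _ _).trans ?_))))
    refine congrArg₂ El.tmul ((map_tensMap _ _).trans (congrArg El.tprod (funext fun k => ?_)))
      ((El.map_comp _ _ _).trans (map_eHomWhiskerLeft _ _))
    exact (El.map_comp _ _ _).trans (map_eHomWhiskerLeft _ _)
  have h : Q.μ f a i ≫ evalConv A t (Q.conv T) i = R := by
    refine fibre_hom_ext Q.conv (.leaf (P.obj (colObj S a i))) f a fun ι X p b q d => ?_
    obtain ⟨p', hp⟩ : ∃ p' : El X (P.obj (colObj S a i)), p' = p := ⟨p, rfl⟩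
    subst hp
    refine Eq.trans ?_ (hR p' _).symm
    refine (El.map_comp _ _ _).trans ((congrArg (elEvalConv A t (Q.conv T))
      (Q.elMu_el f b a i q p' d)).trans ?_)
    rw [elEvalConv_el, algEl_colMul, D.elMap_mix f
      (fun k l => congrArg (fun c => (t c).pt) (src_fib f k l).symm) _ _
      (fun k l => (t (src (fib f k) l)).elEv (δ.elRes f d k l)) fun k l =>
        Totalization.heq_elEv t (src_fib f k l).symm (δ.heq_elCast _ _).symm]
    refine congrArg (fun z => D.mix f _ z _) (funext fun k => ?_)
    rw [elEvalConv_el, El.comp_assoc]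
  rw [← hR, ← h, El.map_comp]
  rfl

variable {Q A t}

/-- Families of maps out of the condensation that are compatible with the evaluations. -/
def IsAction (α : ∀ T, Q.operad.obj T ⟶
    ((D.D T).obj (fun k => (t (src T k)).pt) ⟶[V] (t (π₀ T)).pt)) : Prop :=
  ∀ (T : O) (i : C), (α T ⊗ₘ (t (π₀ T)).ev i) ≫ eComp V _ _ _ =
    Q.ev T i ≫ evalConv A t (Q.conv T) i

variable {α : ∀ T, Q.operad.obj T ⟶
    ((D.D T).obj (fun k => (t (src T k)).pt) ⟶[V] (t (π₀ T)).pt)}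

theorem IsAction.comp_elEv (h : IsAction α) {T : O} {i : C} (q : El X (Q.operad.obj T))
    (d : El X (δ.obj (π₀ T) i)) :
    (α T ⊳ q) ⊙ (t (π₀ T)).elEv d = elEvalConv A t (Q.conv T) (Q.elEv q d) := by
  have h' := congrArg (· ⊳ q ⊠ d) (h T i)
  simp only [El.map_comp, map_tensorHom] at h'
  exact h'

/-- On classes of terms `elEvalConv_elMu` leaves the evaluations of the elements `q k` on elements
of `δ`. Each one is α applied to `q k` followed by a projection of the totalization, and the
projections are collected again into the evaluation at `S`. -/
theorem IsAction.elEvalConv_elNu (h : IsAction α) {T S : O} (f : T ⟶ S) {i : C}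
    (q : ∀ k, El X (Q.operad.obj (fib f k))) (e : El X ((Q.conv S).obj i)) :
    elEvalConv A t (Q.conv T) (Q.elNu f q e) =
      D.mix f (Y := fun l => (t (src T l)).pt) (Y' := fun k l => (t (src (fib f k) l)).pt)
        (G := fun k => (t (src S k)).pt)
        (fun k l => congrArg (fun c => (t c).pt) (src_fib f k l).symm)
        (fun k => (α (fib f k) ⊳ q k) ⊙
          ofHom (eqToHom (congrArg (fun c => (t c).pt) (π₀_fib f k))))
        (elEvalConv A t (Q.conv S) e ⊙ ofHom (eqToHom (congrArg
          (fun c => (restrict D A).obj c i) (π₀_eq f).symm))) := by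
  let R := ((tensMap fun k => α (fib f k) ≫ eHomWhiskerLeft V _
      (eqToHom (congrArg (fun c => (t c).pt) (π₀_fib f k)))) ⊗ₘ
      (evalConv A t (Q.conv S) i ≫ eHomWhiskerLeft V ((D.D S).obj fun k => (t (src S k)).pt)
        (eqToHom (congrArg (fun c => (restrict D A).obj c i) (π₀_eq f).symm)))) ≫
      D.mixHom f (Y := fun l => (t (src T l)).pt) (Y' := fun k l => (t (src (fib f k) l)).pt)
        (fun k l => congrArg (fun c => (t c).pt) (src_fib f k l).symm)
        (fun k => (t (src S k)).pt) ((restrict D A).obj (π₀ T) i)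
  have hR : ∀ {ι : Type} {X : ι → V} (q : ∀ k, El X (Q.operad.obj (fib f k)))
      (e : El X ((Q.conv S).obj i)), R ⊳ tprod q ⊠ e =
      D.mix f (Y := fun l => (t (src T l)).pt) (Y' := fun k l => (t (src (fib f k) l)).pt)
        (G := fun k => (t (src S k)).pt)
        (fun k l => congrArg (fun c => (t c).pt) (src_fib f k l).symm)
        (fun k => (α (fib f k) ⊳ q k) ⊙
          ofHom (eqToHom (congrArg (fun c => (t c).pt) (π₀_fib f k))))
        (elEvalConv A t (Q.conv S) e ⊙ ofHom (eqToHom (congrArg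
          (fun c => (restrict D A).obj c i) (π₀_eq f).symm))) := by
    intro ι X q e
    rw [← D.map_mixHom]
    refine (El.map_comp _ _ _).trans (congrArg (El.map _) ((map_tensorHom _ _ _ _).trans ?_))
    refine congrArg₂ El.tmul ((map_tensMap _ _).trans (congrArg El.tprod (funext fun k => ?_)))
      ((El.map_comp _ _ _).trans (map_eHomWhiskerLeft _ _))
    exact (El.map_comp _ _ _).trans (map_eHomWhiskerLeft _ _)
  have hνR : Q.ν f i ≫ evalConv A t (Q.conv T) i = R := by
    refine conv_hom_ext_tprod fun ι X q a p d => ?_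
    refine Eq.trans ?_ (hR q _).symm
    refine (El.map_comp _ _ _).trans ((congrArg (elEvalConv A t (Q.conv T))
      (Q.elNu_el f q p d)).trans ?_)
    rw [elEvalConv_elMu, elEvalConv_el, El.comp_assoc, ← D.mix_comp_elMap]
    refine congrArg (fun z => D.mix f _ z _) (funext fun k => ?_)
    rw [← h.comp_elEv, El.comp_assoc, El.comp_assoc]
    refine congrArg (El.comp _) ?_
    rw [← Totalization.elEv_elCast t (π₀_fib f k), δ.elCast_elCast, δ.elCast_rfl]
  rw [← hR, ← hνR, El.map_comp]
  rfl

/-- The action of the condensation on the totalizations. -/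
def IsAction.algebra (h : IsAction α) :
    Algebra D.toMulticotensor Q.operad.toPreOperad fun c => (t c).pt where
  app := α
  unit_app c := by
    -- The empty tensor shape evaluates to the unit object and its only tensor of elements is the
    -- unit element; this tests maps out of the unit object.
    refine (t (π₀ (U c))).hom_ext (.tens 0 Fin.elim0) fun i ι X x d => ?_
    change El.comp (El.map _ (one : El X (𝟙_ V))) ((t (π₀ (U c))).elEv d) =
      El.comp (ofHom _) ((t (π₀ (U c))).elEv d)
    refine (congrArg (fun y => El.comp y ((t (π₀ (U c))).elEv d)) (El.map_comp _ _ _)).trans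
      ((h.comp_elEv (Q.operad.elUnit c) d).trans ?_)
    rw [Q.elEv_elUnit, elEvalConv_el, algEl_elUId, ofHom_comp, ← El.comp_assoc,
      Multicotensor.elMap_counit, El.comp_assoc, ofHom_comp, El.comp_assoc]
    refine congrArg (El.comp _) ?_
    rw [← Totalization.elEv_elCast t ((src_U c (pt rfl)).trans (π₀_U c).symm), δ.elCast_elCast,
      δ.elCast_rfl]
  mul_app {T S} f := by
    refine (t (π₀ T)).hom_ext (.mul (.tens _ fun k => .leaf (Q.operad.obj (fib f k)))
      (.leaf (Q.operad.obj S))) fun i ι X x d => ?_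
    suffices H : ∀ (q : ∀ k, El X (Q.operad.obj (fib f k))) (r : El X (Q.operad.obj S)),
        El.comp (El.map _ (tprod q ⊠ r)) _ = El.comp (El.map _ (tprod q ⊠ r)) _ from H x.1 x.2
    intro q r
    refine (congrArg (fun y => El.comp y ((t (π₀ T)).elEv d)) (El.map_comp _ _ _)).trans
      ((h.comp_elEv (Q.operad.elMul f q r) d).trans (Eq.symm ?_))
    refine (congrArg (fun y => El.comp y ((t (π₀ T)).elEv d)) ((El.map_comp _ _ _).trans
      ((congrArg (El.map _) ((map_tensorHom _ _ _ _).trans (congrArg (· ⊠ (α S ⊳ r))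
        (map_tensMap _ _)))).trans
      (D.map_endOperad_mul (fun c => (t c).pt) f _ _)))).trans ?_
    -- After projection to A(c, i) both sides are composites with the comultiplication along `f` and
    -- the same inner maps; only the action of `r` followed by the projection remains to be
    -- compared.
    rw [Q.elEv_elMul, h.elEvalConv_elNu, D.mix_comp_right]
    refine congrArg (D.mix f _ _) ?_
    rw [← h.comp_elEv, El.comp_assoc, El.comp_assoc]
    refine congrArg (El.comp _) ?_
    rw [← Totalization.elEv_elCast t (π₀_eq f).symm, δ.elCast_elCast, δ.elCast_rfl]

end CondensationElements

end

/-! ### Existence, uniqueness and naturality of the induced action -/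

noncomputable section

open OperadicData OperadicCategory El

section InducedActions

variable {V : Type u} [Category.{v} V] [MonoidalCategory V] [SymmetricCategory V]
  [MonoidalClosed V] {ι : Type} {X : ι → V} {K : Type uk} [Category.{vk} K]
  [EnrichedOrdinaryCategory V K]
  {O : Type uo} [Category.{vo} O] [OperadicCategory.{w} O] {C : Type v}

theorem Totalization.hom_ext_hom {P : PreOperad (Colored O C) V} {δ : UFunctor P V}
    {B : UDiagram P K} {c : Comp O} (t : Totalization δ B c) {Z : K} {F G : Z ⟶ t.pt}
    (h : ∀ (i : C) (ι : Type) (X : ι → V) (d : El X (δ.obj c i)),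
      ofHom F ⊙ t.elEv d = ofHom G ⊙ t.elEv d) : F = G :=
  (eHomEquiv V).injective (t.hom_ext (.tens 0 Fin.elim0) fun i ι X _ d => h i ι X d)

section

variable {P : Operad (Colored O C) V} {δ : UFunctor P.toPreOperad V} {Q : Condensation δ}
  {Y : Comp (Colored O C) → K} {D : ColaxMonoidal O V K}
  {A : Algebra (D.toMulticotensor.colored C) P.toPreOperad Y}
  {t : ∀ c, Totalization δ (restrict D A) c}

/-- The map θ is forced by its values on the terms of the coend, so it can only be `evalConv`. -/
theorem isInducedAction_iff
    (α : Algebra D.toMulticotensor Q.operad.toPreOperad fun c => (t c).pt) :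
    IsInducedAction Q A t α ↔ IsAction (A := A) (t := t) α.app := by
  refine ⟨fun h T i => ?_, fun h T i => ⟨_, ι_evalConv A t (Q.conv T) (i := i), h T i⟩⟩
  obtain ⟨θ, hθ, hα⟩ := h T i
  refine hα.trans (congrArg (fun θ => Q.ev T i ≫ θ) ?_)
  exact ((Q.conv T).isCoend i).hom_ext fun a =>
    (hθ a).trans (ι_evalConv A t (Q.conv T) a i).symm

variable (Q A t)

/-- Each component is the unique lift into the totalization of its prescribed projections. The
algebra axioms then hold because they hold after projection (`IsAction.algebra`). -/
theorem existsUnique_isInducedAction :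
    ∃! α : Algebra D.toMulticotensor Q.operad.toPreOperad fun c => (t c).pt,
      IsInducedAction Q A t α := by
  choose α hα using fun T => exists_action A t (Q.conv T) (Q.ev T) (Q.wedge T)
  have h : IsAction (Q := Q) (A := A) (t := t) α := hα
  refine ⟨h.algebra, (isInducedAction_iff h.algebra).2 h, fun β hβ => ?_⟩
  replace hβ := (isInducedAction_iff β).1 hβ
  refine PreOperad.Hom.ext (funext fun T => ?_)
  refine (t (π₀ T)).hom_ext (.leaf (Q.operad.obj T)) fun i ι X q d => ?_
  exact (hβ.comp_elEv q d).trans (h.comp_elEv q d).symm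

end

section

variable {P : PreOperad (Colored O C) V} {D : ColaxMonoidal O V K}
  {Y Z : Comp (Colored O C) → K} {A : Algebra (D.toMulticotensor.colored C) P Y}
  {B : Algebra (D.toMulticotensor.colored C) P Z} {φ : ∀ c, Y c ⟶ Z c}

variable {δ : UFunctor P V}

/-- The projections followed by φ form a wedge, since φ is natural for the restricted actions
(`IsAlgebraHom.elMap_comp`). The universal property with `W` the unit object gives a morphism of
`K`. -/
theorem IsAlgebraHom.exists_totalizationHom (h : IsAlgebraHom A B φ) {c : Comp O}
    (s : Totalization δ (restrict D A) c) (t : Totalization δ (restrict D B) c) :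
    ∃ ψ : s.pt ⟶ t.pt, ∀ i,
      s.ev i ≫ eHomWhiskerLeft V s.pt (restrictHom A B φ c i) =
        t.ev i ≫ eHomWhiskerRight V ψ ((restrict D B).obj c i) := by
  obtain ⟨y, hy, -⟩ := t.existsUnique_lift s.pt (𝟙_ V)
    (fun i => (λ_ _).hom ≫ s.ev i ≫ eHomWhiskerLeft V s.pt (restrictHom A B φ c i))
    fun i j => by
      refine Shape.hom_ext (.mul (.tens 0 Fin.elim0) (.mul (.leaf (δ.obj c i))
        (.leaf (uHom P c i j)))) fun ι X x => ?_
      suffices H : ∀ (d : El X (δ.obj c i)) (u : El X (uHom P c i j)),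
          El.map _ ((one : El X (𝟙_ V)) ⊠ d ⊠ u) = El.map _ ((one : El X (𝟙_ V)) ⊠ d ⊠ u) from
        H x.2.1 x.2.2
      intro d u
      simp only [El.map_comp, map_whiskerLeft, map_leftUnitor_hom, map_associator_inv,
        map_tensorHom, map_eHomWhiskerLeft, map_eComp]
      refine (congrArg (fun y => El.comp y (ofHom (restrictHom A B φ c j)))
        (s.elEv_act d u)).trans ?_
      rw [El.comp_assoc, h.elMap_comp, ← El.comp_assoc]
      rfl
  refine ⟨(eHomEquiv V).symm y, fun i => hom_ext_el fun ι X d => ?_⟩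
  have h' := congrArg (· ⊳ (one : El X (𝟙_ V)) ⊠ d) (hy i)
  simp only [El.map_comp, map_tensorHom, map_leftUnitor_hom, map_eComp] at h'
  rw [El.map_comp, El.map_comp, map_eHomWhiskerRight, eHomEquiv_symm_ofHom]
  exact h'.symm

theorem ofHom_comp_elEv {c : Comp O} {s : Totalization δ (restrict D A) c}
    {t : Totalization δ (restrict D B) c} {ψ : s.pt ⟶ t.pt} {i : C}
    (h : s.ev i ≫ eHomWhiskerLeft V s.pt (restrictHom A B φ c i) =
      t.ev i ≫ eHomWhiskerRight V ψ ((restrict D B).obj c i)) (d : El X (δ.obj c i)) :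
    ofHom ψ ⊙ t.elEv d = s.elEv d ⊙ ofHom (restrictHom A B φ c i) := by
  have h' := congrArg (· ⊳ d) h
  simp only [El.map_comp, map_eHomWhiskerLeft, map_eHomWhiskerRight] at h'
  exact h'.symm

/-- On classes of terms φ passes through the operad action to the inputs, where its compatibility
with the projections turns it into ψ; functoriality of `D_T` collects the result. -/
theorem IsAlgebraHom.elEvalConv_comp (h : IsAlgebraHom A B φ)
    {s : ∀ c, Totalization δ (restrict D A) c} {t : ∀ c, Totalization δ (restrict D B) c}
    {ψ : ∀ c, (s c).pt ⟶ (t c).pt}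
    (hψ : ∀ c i, (s c).ev i ≫ eHomWhiskerLeft V (s c).pt (restrictHom A B φ c i) =
      (t c).ev i ≫ eHomWhiskerRight V (ψ c) ((restrict D B).obj c i))
    {T : O} (E : Convolution δ T) {i : C} (e : El X (E.obj i)) :
    elEvalConv A s E e ⊙ ofHom (restrictHom A B φ (π₀ T) i) =
      ofHom ((D.D T).mapHom fun k => ψ (src T k)) ⊙ elEvalConv B t E e := by
  have h' : evalConv A s E i ≫ eHomWhiskerLeft V _ (restrictHom A B φ (π₀ T) i) =
      evalConv B t E i ≫ eHomWhiskerRight V ((D.D T).mapHom fun k => ψ (src T k)) _ := by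
    refine E.hom_ext_el fun ι X a p d => ?_
    rw [El.map_comp, map_eHomWhiskerLeft, El.map_comp, map_eHomWhiskerRight]
    refine (congrArg (fun y => El.comp y (ofHom (restrictHom A B φ (π₀ T) i)))
      (elEvalConv_el A s E p d)).trans (Eq.trans ?_
      (congrArg (El.comp (ofHom _)) (elEvalConv_el B t E p d)).symm)
    rw [El.comp_assoc, h.algEl_comp, ← El.comp_assoc, MultiFunctor.elMap_comp,
      ← MultiFunctor.elMap_ofHom, ← El.comp_assoc, MultiFunctor.elMap_comp]
    simp only [ofHom_comp_elEv (hψ _ _)]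
  have h'' := congrArg (· ⊳ e) h'
  simp only [El.map_comp, map_eHomWhiskerLeft, map_eHomWhiskerRight] at h''
  exact h''

end

/-- Tested after projection, both sides become evaluations of the same element of the convolution
product, and these are compared by `IsAlgebraHom.elEvalConv_comp`. -/
theorem IsAlgebraHom.isAlgebraHom_totalization {P : Operad (Colored O C) V}
    {δ : UFunctor P.toPreOperad V} {Q : Condensation δ} {D : ColaxMonoidal O V K}
    {Y Z : Comp (Colored O C) → K} {A : Algebra (D.toMulticotensor.colored C) P.toPreOperad Y}
    {B : Algebra (D.toMulticotensor.colored C) P.toPreOperad Z} {φ : ∀ c, Y c ⟶ Z c}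
    (h : IsAlgebraHom A B φ) {s : ∀ c, Totalization δ (restrict D A) c}
    {t : ∀ c, Totalization δ (restrict D B) c} {ψ : ∀ c, (s c).pt ⟶ (t c).pt}
    (hψ : ∀ c i, (s c).ev i ≫ eHomWhiskerLeft V (s c).pt (restrictHom A B φ c i) =
      (t c).ev i ≫ eHomWhiskerRight V (ψ c) ((restrict D B).obj c i))
    {α : Algebra D.toMulticotensor Q.operad.toPreOperad fun c => (s c).pt}
    {β : Algebra D.toMulticotensor Q.operad.toPreOperad fun c => (t c).pt}
    (hα : IsAction (A := A) (t := s) α.app) (hβ : IsAction (A := B) (t := t) β.app) :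
    IsAlgebraHom α β ψ := by
  intro T
  refine (t (π₀ T)).hom_ext (.leaf (Q.operad.obj T)) fun i ι X q d => ?_
  refine (congrArg (fun y => El.comp y ((t (π₀ T)).elEv d)) ((El.map_comp _ _ _).trans
    (map_eHomWhiskerLeft _ _))).trans (Eq.trans ?_ (congrArg
    (fun y => El.comp y ((t (π₀ T)).elEv d)) ((El.map_comp _ _ _).trans
    (map_eHomWhiskerRight _ _))).symm)
  refine (El.comp_assoc _ _ _).trans (Eq.trans ?_ (El.comp_assoc _ _ _).symm)
  refine (congrArg (El.comp _) (ofHom_comp_elEv (hψ _ _) d)).trans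
    (Eq.trans ?_ (congrArg (El.comp _) (hβ.comp_elEv q d)).symm)
  refine (El.comp_assoc _ _ _).symm.trans ((congrArg (fun y => El.comp y _)
    (hα.comp_elEv q d)).trans ?_)
  exact h.elEvalConv_comp hψ (Q.conv T) (Q.elEv q d)

end InducedActions

end

end OpCond

/-! ### The proposition -/

theorem mainTheorem6
    {V : Type u} [Category.{v} V] [MonoidalCategory V] [SymmetricCategory V] [MonoidalClosed V]
    [HasLimits V] [HasColimits V]
    {O : Type uo} [Category.{vo} O] [OpCond.OperadicCategory.{w} O] {C : Type v}
    (P : OpCond.Operad (OpCond.Colored O C) V) (δ : OpCond.UFunctor P.toPreOperad V) :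
    Nonempty (OpCond.Condensation δ) ∧
    ∀ (Q : OpCond.Condensation δ)
      {K : Type uk} [Category.{vk} K] [EnrichedOrdinaryCategory V K] (_ : OpCond.IsVComplete V K)
      (D : OpCond.ColaxMonoidal O V K),
      (∀ {X : OpCond.OperadicData.Comp (OpCond.Colored O C) → K}
        (A : OpCond.Algebra (D.toMulticotensor.colored C) P.toPreOperad X),
        (∀ c, Nonempty (OpCond.Totalization δ (OpCond.restrict D A) c)) ∧
        ∀ t : ∀ c, OpCond.Totalization δ (OpCond.restrict D A) c,
          ∃! α : OpCond.Algebra D.toMulticotensor Q.operad.toPreOperad fun c => (t c).pt,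
            OpCond.IsInducedAction Q A t α) ∧
      ∀ {X Y : OpCond.OperadicData.Comp (OpCond.Colored O C) → K}
        (A : OpCond.Algebra (D.toMulticotensor.colored C) P.toPreOperad X)
        (B : OpCond.Algebra (D.toMulticotensor.colored C) P.toPreOperad Y)
        (φ : ∀ c, X c ⟶ Y c) (_ : OpCond.IsAlgebraHom A B φ)
        (s : ∀ c, OpCond.Totalization δ (OpCond.restrict D A) c)
        (t : ∀ c, OpCond.Totalization δ (OpCond.restrict D B) c)
        (α : OpCond.Algebra D.toMulticotensor Q.operad.toPreOperad fun c => (s c).pt)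
        (β : OpCond.Algebra D.toMulticotensor Q.operad.toPreOperad fun c => (t c).pt)
        (_ : OpCond.IsInducedAction Q A s α) (_ : OpCond.IsInducedAction Q B t β),
        ∃ ψ : ∀ c, (s c).pt ⟶ (t c).pt,
          (∀ c i, (s c).ev i ≫ eHomWhiskerLeft V (s c).pt (φ (c, i)) =
            (t c).ev i ≫ eHomWhiskerRight V (ψ c) ((OpCond.restrict D B).obj c i)) ∧
          OpCond.IsAlgebraHom α β ψ ∧
          ∀ ψ' : ∀ c, (s c).pt ⟶ (t c).pt,
            (∀ c i, (s c).ev i ≫ eHomWhiskerLeft V (s c).pt (φ (c, i)) =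
              (t c).ev i ≫ eHomWhiskerRight V (ψ' c) ((OpCond.restrict D B).obj c i)) →
            ψ' = ψ := by
  refine ⟨OpCond.nonempty_condensation δ, fun Q K _ _ hK D => ⟨fun A => ⟨fun c =>
    OpCond.nonempty_totalization δ hK _ c, fun t => OpCond.existsUnique_isInducedAction Q A t⟩,
    fun A B φ h s t α β hα hβ => ?_⟩⟩
  choose ψ hψ using fun c => h.exists_totalizationHom (s c) (t c)
  refine ⟨ψ, hψ, h.isAlgebraHom_totalization hψ ((OpCond.isInducedAction_iff α).1 hα)
    ((OpCond.isInducedAction_iff β).1 hβ), fun ψ' hψ' => funext fun c =>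
      (t c).hom_ext_hom fun i ι X d => ?_⟩
  exact (OpCond.ofHom_comp_elEv (hψ' c i) d).trans (OpCond.ofHom_comp_elEv (hψ c i) d).symm
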